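/- **Setting.** Let $n\ge 0$ and $a,b,R>0$. For $z,\zeta\in\mathbb C^n$ write $\langle z,\zeta\rangle=\sum_j z_j\zeta_j$ and $z^2=\langle z,z\rangle$ (no conjugation), and $\langle\alpha-\beta\rangle=(1+|x-x'|^2+|\xi-\xi'|^2)^{1/2}$ for $\alpha=(x,\xi)$, $\beta=(x',\xi')$ in $T^*\mathbb R^n=\mathbb R^{2n}$. Let $c=2^{-n/2}\pi^{-3n/4}$, $c_0=(2\pi)^{-n}$. For $G\in C^\infty_{\rm c}(\mathbb R^{2n};\mathbb R)$ put $$z=z(x,\xi)=x+iG_\xi(x,\xi),\quad \zeta=\zeta(x,\xi)=\xi-iG_x(x,\xi),\quad \Lambda=\{(z(x,\xi),\zeta(x,\xi)):(x,\xi)\in\mathbb R^{2n}\},$$ $$H=G-\xi\cdot G_\xi,\qquad L^2_\Lambda=L^2(\mathbb R^{2n},e^{-2H/h}\,dx\,d\xi),$$ and let $b_\Lambda(x,\xi)=\det\dfrac{\partial(z,\zeta)}{\partial(x,\xi)}$, so that $d\beta:=b_\Lambda(x',\xi')\,dx'd\xi'$ is the holomorphic volume $d\zeta\wedge dz$ restricted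 to $\Lambda$ (oriented so that $b_\Lambda=1$ for $G=0$). Points of $\Lambda$ are identified with points $(x,\xi)$ of $\mathbb R^{2n}$. Set $$T_\Lambda v(x,\xi)=c\,h^{-3n/4}\int_{\mathbb R^n}e^{\frac ih(\langle z-y,\zeta\rangle+\frac i2(z-y)^2)}v(y)\,dy,$$ $$S_\Lambda u(y)=c\,h^{-3n/4}\int_{\mathbb R^{2n}}e^{\frac ih(\langle y-z,\zeta\rangle+\frac i2(z-y)^2)}b_\Lambda(x,\xi)\,u(x,\xi)\,dx\,d\xi,$$ $$Pv(x)=\frac1{(2\pi h)^n}\int_{\mathbb R^n}\int_{\mathbb R^n}p(x,\xi)e^{\frac ih\langle x-y,\xi\rangle}v(y)\,dy\,d\xi,$$ and, with $(z,\zeta)$, $(z',\zeta')$ the points of $\Lambda$ over $\alpha$, $\beta$, $$\psi_\Lambda(\alpha,\beta)=\tfrac12(\langle z,\zeta\rangle-\langle z',\zeta'\rangle)+\tfrac12(\langle z,\zeta'\rangle-\langle z',\zeta\rangle)+\tfrac i4\big((\zeta-\zeta')^2+(z-z')^2\big).$$ **Lemma.** For all $n,a,b,R$ there is $\varepsilon>0$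 such that the following holds for every real $G\in C_{\rm c}^\infty(\mathbb R^{2n})$ supported in the ball of radius $R$ about $0$, all of whose derivatives of order $\le 2$ are bounded by $\varepsilon$, and every $p$ that is holomorphic and bounded in the strip $\{(z,\zeta)\in\mathbb C^{2n}:|\operatorname{Im}z|<a,\ |\operatorname{Im}\zeta|<b\}$. There are $C>0$ and functions $K_P,a_P,r$ of $(\alpha,\beta)$ depending on $h$, such that for all $0<h\le1$: 1. for every $u\in\mathscr S(\mathbb R^{2n})$ the integrals defining $T_\Lambda PS_\Lambda u$ converge absolutely, and $$T_\Lambda PS_\Lambda u(\alpha)=c_0h^{-n}\int_\Lambda K_P(\alpha,\beta)u(\beta)\,d\beta\qquad\text{for every }\alpha;$$ $T_\Lambda PS_\Lambda$ extends from $\mathscr S(\mathbb R^{2n})$ to a bounded operator on $L^2_\Lambda$ of norm at most $C$, which is given by the same (absolutely convergent) integral for almost every $\alpha$ and every $u\in L^2_\Lambda$; 2. $K_P(\alpha,\beta)=e^{\frac ih\psi_\Lambda(\alpha,\beta)}a_P(\alpha,\beta)+r(\alpha,\beta)$ and $|r(\alpha,\beta)|\le Ce^{-\langle\alpha-\beta\rangle/(Ch)}$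 for all $\alpha,\beta$; 3. $a_P\sim\sum_{j\ge0}h^ja_P^j$, where $a_P$ is smooth, the $a_P^j$ are smooth and independent of $h$ with all derivatives bounded, and each derivative of $a_P-\sum_{j<N}h^ja_P^j$ is $O(h^N)$ uniformly in $\alpha,\beta$ and $0<h\le1$, for every $N$; moreover $$a_P^0(\alpha,\alpha)=p(z(\alpha),\zeta(\alpha))=p|_\Lambda(\alpha).$$ -/

import Mathlib

open MeasureTheory Filter Topology
open scoped ContDiff SchwartzMap

noncomputable section

namespace FBI

/-- The configuration space `ℝⁿ`. -/
abbrev Conf (n : ℕ) : Type := EuclideanSpace ℝ (Fin n)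

/-- The phase space `T*ℝⁿ = ℝⁿ × ℝⁿ`, with points `α = (x, ξ)`. -/
abbrev Phase (n : ℕ) : Type := Conf n × Conf n

/-- The complex space `ℂⁿ`. -/
abbrev CConf (n : ℕ) : Type := Fin n → ℂ

variable {n : ℕ}

/-- The inclusion `ℝⁿ ⊂ ℂⁿ`. -/
def toC (x : Conf n) : CConf n := fun i => (x i : ℂ)

/-- The Euclidean length `|Im z|` of the imaginary part of `z ∈ ℂⁿ`. -/
def imNorm (z : CConf n) : ℝ := Real.sqrt (∑ i, (z i).im ^ 2)

/-- The open strip `{(z, ζ) ∈ ℂⁿ × ℂⁿ : |Im z| < a, |Im ζ| < b}`. -/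
def strip (n : ℕ) (a b : ℝ) : Set (CConf n × CConf n) :=
  {w | imNorm w.1 < a ∧ imNorm w.2 < b}

/-- The complex-bilinear pairing `⟨z, ζ⟩ = ∑ zⱼ ζⱼ` (no conjugation). -/
def pair (z ζ : CConf n) : ℂ := ∑ i, z i * ζ i

/-- The Japanese bracket `⟨α - β⟩ = (1 + |x - x'|² + |ξ - ξ'|²)^{1/2}`. -/
def bracket (α β : Phase n) : ℝ :=
  Real.sqrt (1 + ‖α.1 - β.1‖ ^ 2 + ‖α.2 - β.2‖ ^ 2)

/-! ### The operators before deformation -/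

/-- The positive constant `c` for which the FBI transform is an isometry:
`c² = (2π)⁻ⁿ π^{-n/2}`. -/
def cFBI (n : ℕ) : ℝ := (2 : ℝ) ^ (-(n : ℝ) / 2) * Real.pi ^ (-(3 * (n : ℝ)) / 4)

/-- The constant `c₀ = (2π)⁻ⁿ` in the kernel `c₀ h⁻ⁿ e^{iψ₀/h}` of `T T*`. -/
def cZero (n : ℕ) : ℝ := ((2 * Real.pi) ^ n)⁻¹

/-- The kernel `c h^{-3n/4} exp((i/h)(⟨z - y, ζ⟩ + (i/2)(z - y)²))` of the FBI transform,
continued holomorphically to `(z, ζ) ∈ ℂⁿ × ℂⁿ`. -/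
def fbiKernel (h : ℝ) (z ζ : CConf n) (y : Conf n) : ℂ :=
  ((cFBI n * h ^ (-(3 * (n : ℝ)) / 4) : ℝ) : ℂ) *
    Complex.exp (Complex.I / h *
      (pair (z - toC y) ζ + Complex.I / 2 * pair (z - toC y) (z - toC y)))

/-- The kernel `c̄ h^{-3n/4} exp((i/h)(⟨y - z, ζ⟩ + (i/2)(z - y)²))` of the left inverse. -/
def invKernel (h : ℝ) (z ζ : CConf n) (y : Conf n) : ℂ :=
  ((cFBI n * h ^ (-(3 * (n : ℝ)) / 4) : ℝ) : ℂ) *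
    Complex.exp (Complex.I / h *
      (pair (toC y - z) ζ + Complex.I / 2 * pair (z - toC y) (z - toC y)))

/-- The holomorphically continued FBI transform `T u (z, ζ)`. -/
def fbi (h : ℝ) (u : Conf n → ℂ) (z ζ : CConf n) : ℂ :=
  ∫ y, fbiKernel h z ζ y * u y

/-- The integrand `p(x, ξ) e^{(i/h)⟨x - y, ξ⟩} u(y)` of the pseudodifferential operator. -/
def pseudoIntegrand (p : CConf n × CConf n → ℂ) (h : ℝ) (u : Conf n → ℂ)
    (x ξ y : Conf n) : ℂ :=
  p (toC x, toC ξ) * Complex.exp (Complex.I / h * pair (toC x - toC y) (toC ξ)) * u y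

/-- The semiclassical pseudodifferential operator
`P u(x) = (2πh)⁻ⁿ ∫ (∫ p(x, ξ) e^{(i/h)⟨x - y, ξ⟩} u(y) dy) dξ`. -/
def pseudo (p : CConf n × CConf n → ℂ) (h : ℝ) (u : Conf n → ℂ) (x : Conf n) : ℂ :=
  ((((2 * Real.pi * h) ^ n)⁻¹ : ℝ) : ℂ) * ∫ ξ, ∫ y, pseudoIntegrand p h u x ξ y

/-! ### The deformation `Λ = Λ_G` -/

/-- `G_x`. -/
def gradX (G : Phase n → ℝ) (α : Phase n) (i : Fin n) : ℝ :=
  fderiv ℝ G α (EuclideanSpace.single i 1, 0)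

/-- `G_ξ`. -/
def gradXi (G : Phase n → ℝ) (α : Phase n) (i : Fin n) : ℝ :=
  fderiv ℝ G α (0, EuclideanSpace.single i 1)

/-- The first component `z = x + i G_ξ(x, ξ)` of the point of `Λ` over `(x, ξ)`. -/
def zL (G : Phase n → ℝ) (α : Phase n) : CConf n :=
  fun i => (α.1 i : ℂ) + Complex.I * (gradXi G α i : ℂ)

/-- The second component `ζ = ξ - i G_x(x, ξ)` of the point of `Λ` over `(x, ξ)`. -/
def zetaL (G : Phase n → ℝ) (α : Phase n) : CConf n :=
  fun i => (α.2 i : ℂ) - Complex.I * (gradX G α i : ℂ)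

/-- The coordinate vectors `∂_{x_j}`, `∂_{ξ_j}` of the phase space. -/
def coordVec : Fin n ⊕ Fin n → Phase n :=
  Sum.elim (fun j => (EuclideanSpace.single j 1, 0)) (fun j => (0, EuclideanSpace.single j 1))

/-- The complex Jacobian matrix `∂(z, ζ)/∂(x, ξ)` of the parametrization of `Λ`. -/
def jac (G : Phase n → ℝ) (α : Phase n) : Matrix (Fin n ⊕ Fin n) (Fin n ⊕ Fin n) ℂ :=
  Matrix.of fun i j =>
    fderiv ℝ (fun β => (Sum.elim (zL G β) (zetaL G β) : Fin n ⊕ Fin n → ℂ) i) α (coordVec j)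

/-- The density `b` of the holomorphic volume form `dζ ∧ dz`, restricted to `Λ`, in the
coordinates `(x, ξ)`; the orientation is the one for which `b = 1` when `G = 0`.
The volume element `dβ = (σ|_Λ)ⁿ/n!` of `Λ` is `b(x', ξ') dx' dξ'`. -/
def bDens (G : Phase n → ℝ) (α : Phase n) : ℂ := (jac G α).det

/-- The weight `H = G - ξ · G_ξ`. -/
def weightH (G : Phase n → ℝ) (α : Phase n) : ℝ :=
  G α - ∑ i, α.2 i * gradXi G α i

/-- The measure `e^{-2H/h} dx dξ`; `L²_Λ` is `Lp ℂ 2 (measL G h)`. -/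
def measL (G : Phase n → ℝ) (h : ℝ) : Measure (Phase n) :=
  volume.withDensity fun α => ENNReal.ofReal (Real.exp (-2 * weightH G α / h))

/-- `T_Λ u = (T u)|_Λ`, in the parametrization of `Λ` by `(x, ξ)`. -/
def TL (G : Phase n → ℝ) (h : ℝ) (u : Conf n → ℂ) (α : Phase n) : ℂ :=
  fbi h u (zL G α) (zetaL G α)

/-- The operator `S_Λ`. -/
def SL (G : Phase n → ℝ) (h : ℝ) (u : Phase n → ℂ) (y : Conf n) : ℂ :=
  ∫ α, invKernel h (zL G α) (zetaL G α) y * (bDens G α * u α)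

/-- The composition `T_Λ P S_Λ`. -/
def TPSL (G : Phase n → ℝ) (p : CConf n × CConf n → ℂ) (h : ℝ) (u : Phase n → ℂ) :
    Phase n → ℂ :=
  TL G h (pseudo p h (SL G h u))

/-- All the integrals in the definition of `T_Λ P S_Λ u` converge absolutely. -/
def TPSLConverges (G : Phase n → ℝ) (p : CConf n × CConf n → ℂ) (h : ℝ)
    (u : Phase n → ℂ) : Prop :=
  (∀ y, Integrable fun α => invKernel h (zL G α) (zetaL G α) y * (bDens G α * u α)) ∧
  (∀ x ξ, Integrable (pseudoIntegrand p h (SL G h u) x ξ)) ∧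
  (∀ x, Integrable fun ξ => ∫ y, pseudoIntegrand p h (SL G h u) x ξ y) ∧
  (∀ α, Integrable fun y =>
    fbiKernel h (zL G α) (zetaL G α) y * pseudo p h (SL G h u) y)

/-- The phase
`ψ_Λ = ½(⟨z,ζ⟩ - ⟨z',ζ'⟩) + ½(⟨z,ζ'⟩ - ⟨z',ζ⟩) + (i/4)((ζ-ζ')² + (z-z')²)`, where
`(z, ζ)` and `(z', ζ')` are the points of `Λ` over `α` and `β`. -/
def psiL (G : Phase n → ℝ) (α β : Phase n) : ℂ :=
  1 / 2 * (pair (zL G α) (zetaL G α) - pair (zL G β) (zetaL G β)) +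
  1 / 2 * (pair (zL G α) (zetaL G β) - pair (zL G β) (zetaL G α)) +
  Complex.I / 4 *
    (pair (zetaL G α - zetaL G β) (zetaL G α - zetaL G β) +
      pair (zL G α - zL G β) (zL G α - zL G β))

/-- The asymptotic expansion `a(h) ∼ ∑ hʲ aⱼ` of symbols, for `0 < h ≤ 1`: the functions are
smooth, the coefficients have bounded derivatives of every order, and every derivative of the
`N`-th remainder is `O(hᴺ)` uniformly. -/
def SymbolExpansion (a : ℝ → Phase n × Phase n → ℂ) (aj : ℕ → Phase n × Phase n → ℂ) : Prop :=
  (∀ h, 0 < h → h ≤ 1 → ContDiff ℝ ∞ (a h)) ∧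
  (∀ j, ContDiff ℝ ∞ (aj j)) ∧
  (∀ j k : ℕ, ∃ C : ℝ, ∀ w, ‖iteratedFDeriv ℝ k (aj j) w‖ ≤ C) ∧
  (∀ N k : ℕ, ∃ C : ℝ, ∀ h : ℝ, 0 < h → h ≤ 1 → ∀ w,
    ‖iteratedFDeriv ℝ k
      (fun w' => a h w' - ∑ j ∈ Finset.range N, (h : ℂ) ^ j * aj j w') w‖ ≤ C * h ^ N)

end FBI

end

/-! The composition can be computed exactly. The `y`-integral pairing the oscillation of `P` with
the kernel of `S_Λ` is Gaussian, and completing the square in what remains (`phase_eq`) gives, with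
`W = critPt G α β (α - β)` and `Q = gaussQ`, K_P(α, β) = √2ⁿ (2πh)⁻ⁿ e^{iψ_Λ/h} ∫_{ℝ²ⁿ} p(σ) e^{Q(σ
- W)/h} dσ (`tpsKernel_eq`). Everything reduces to one integral of a bounded holomorphic function
against a Gaussian with complex centre `W`.

The same integral taken over `w + ℝ²ⁿ` is holomorphic in `w` and invariant under real translations
of `w`, hence constant as long as `w` stays in the strip (`contourInt_eq`). This replaces Stokes'
theorem and produces no boundary terms. Two choices of `w` are used.

If `W` lies in the strip, take `w = W`. After rescaling by `√h` the kernel equals e^{iψ_Λ/h} times a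
normalised Gaussian average of p(W + √h σ), with no remainder. Taylor's formula expands the average
in powers of `√h`; odd moments vanish by parity, the zeroth is p(W), and on the diagonal `W` is the
point of `Λ`. All terms are holomorphic in `W`, so sup bounds on a slightly larger strip give bounds
on all derivatives by Cauchy's inequalities. Far from the diagonal the imaginary part of `W`, which
is about half the displacement α - β, leaves the strip; `a_P` is therefore the average at a point
where this displacement is truncated (`cutPt`).

For arbitrary α, β, take for `w` the point `critPt` with the displacement shrunk by δ/⟨α - β⟩. Since
Re Q(u) is |Im u|² minus half the square of a real shift (`re_gaussQ`), this costs e^{|Im(w -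
W)|²/h}. On the other hand Im ψ_Λ + H(α) - H(β) is ¼|α - β|² up to the error of the trapezoidal rule
for `G` and squares of differences of its gradient (`im_psiL_add_weight`), which are small with ε.
The net gain is at least (δ/8)|α - β|²/⟨α - β⟩ (`SmallC2.im_psiL_sub_imSq_ge`).

This weighted estimate has two consequences. Conjugating by e^{-H/h} bounds the operator by
convolution with a function of mass O(1), and Young's inequality gives boundedness on `L²_Λ`. Away
from the diagonal the gain dominates the weights themselves, because |H| is at most δ³/160, and this
yields the exponentially small remainder. -/

noncomputable section

namespace FBI

variable {n : ℕ}

/-! ### Holomorphic functions of several variables: Cauchy estimates and parameter integrals. -/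

section Holomorphic

variable {E : Type} [NormedAddCommGroup E] [NormedSpace ℂ E]
  {F : Type} [NormedAddCommGroup F] [NormedSpace ℂ F]

/-- Cauchy's inequality for the Fréchet derivative of a bounded holomorphic function. -/
theorem norm_fderiv_le_of_norm_le_ball {f : E → F} {x : E} {r M : ℝ} (hr : 0 < r)
    (hf : DifferentiableOn ℂ f (Metric.ball x r)) (hM : ∀ y ∈ Metric.ball x r, ‖f y‖ ≤ M) :
    ‖fderiv ℂ f x‖ ≤ 2 * M / r := by
  have hM0 : 0 ≤ M := (norm_nonneg _).trans (hM x (Metric.mem_ball_self hr))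
  refine ContinuousLinearMap.opNorm_le_bound _ (by positivity) fun v => ?_
  rcases eq_or_ne v 0 with rfl | hv
  · simp
  have hv' : 0 < ‖v‖ := norm_pos_iff.2 hv
  -- Restricted to the complex line through `x` in direction `v`, the disc of this radius stays in
  -- the half-size ball, and the one-variable Cauchy inequality applies.
  set c : ℝ := r / (2 * ‖v‖) with hc
  have hc0 : 0 < c := by positivity
  have hmaps : ∀ t ∈ Metric.closedBall (0 : ℂ) c, x + t • v ∈ Metric.ball x r := by
    intro t ht
    rw [mem_closedBall_zero_iff] at ht
    rw [mem_ball_iff_norm, add_sub_cancel_left, norm_smul]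
    calc ‖t‖ * ‖v‖ ≤ c * ‖v‖ := by gcongr
      _ = r / 2 := by rw [hc]; field_simp
      _ < r := by linarith
  have hd : DifferentiableOn ℂ (fun t : ℂ => f (x + t • v)) (Metric.closedBall 0 c) :=
    hf.comp (by fun_prop) hmaps
  have h1 := Complex.norm_deriv_le_of_forall_mem_sphere_norm_le (f := fun t : ℂ => f (x + t • v))
    (c := 0) (C := M) hc0 (hd.mono Metric.closure_ball_subset_closedBall).diffContOnCl
    (fun z hz => hM _ (hmaps z (Metric.sphere_subset_closedBall hz)))
  have h2 : DifferentiableAt ℂ f (x + (0 : ℂ) • v) := by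
    rw [zero_smul, add_zero]
    exact (hf x (Metric.mem_ball_self hr)).differentiableAt (Metric.ball_mem_nhds x hr)
  rw [h2.deriv_comp_add_smul, zero_smul, add_zero] at h1
  calc ‖fderiv ℂ f x v‖ ≤ M / c := h1
    _ = 2 * M / r * ‖v‖ := by rw [hc]; field_simp

variable [FiniteDimensional ℂ E]

/-- In finite dimension an operator-valued map is a finite sum of fixed coordinate functionals times
its values on a basis, so regularity can be tested vector by vector. -/
theorem hasFDerivAt_of_forall_apply {f : E → E →L[ℂ] F} {x : E}
    (h : ∀ v, DifferentiableAt ℂ (fun y => f y v) x) : DifferentiableAt ℂ f x := by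
  let b := Module.finBasis ℂ E
  have key : f = fun y => ∑ i, ContinuousLinearMap.smulRightL ℂ E F
      (LinearMap.toContinuousLinearMap (b.coord i)) (f y (b i)) := by
    funext y
    ext v
    conv_lhs => rw [← b.sum_repr v, map_sum]
    simp
  rw [key]
  refine DifferentiableAt.fun_sum fun i _ => ?_
  exact (ContinuousLinearMap.differentiableAt _).comp x (h (b i))

theorem aestronglyMeasurable_clm_of_forall_apply {α : Type} [MeasurableSpace α] {μ : Measure α}
    {f : α → E →L[ℂ] F} (h : ∀ v, AEStronglyMeasurable (fun y => f y v) μ) :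
    AEStronglyMeasurable f μ := by
  let b := Module.finBasis ℂ E
  have key : f = fun y => ∑ i, ContinuousLinearMap.smulRightL ℂ E F
      (LinearMap.toContinuousLinearMap (b.coord i)) (f y (b i)) := by
    funext y
    ext v
    conv_lhs => rw [← b.sum_repr v, map_sum]
    simp
  rw [key]
  refine Finset.aestronglyMeasurable_fun_sum _ fun i _ => ?_
  exact (ContinuousLinearMap.continuous _).comp_aestronglyMeasurable (h (b i))

/-- An integral depending holomorphically on a parameter, with a dominated integrand, is
holomorphic. -/
theorem differentiableAt_integral_of_holomorphic {α : Type} [MeasurableSpace α] {μ : Measure α}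
    {f : E → α → F} {g : α → ℝ} {x : E} {r : ℝ} (hr : 0 < r)
    (hf : ∀ a, DifferentiableOn ℂ (fun y => f y a) (Metric.ball x r))
    (hm : ∀ y ∈ Metric.ball x r, AEStronglyMeasurable (f y) μ)
    (hb : ∀ a, ∀ y ∈ Metric.ball x r, ‖f y a‖ ≤ g a) (hg : Integrable g μ) :
    DifferentiableAt ℂ (fun y => ∫ a, f y a ∂μ) x := by
  have hx : x ∈ Metric.ball x r := Metric.mem_ball_self hr
  have hsub : ∀ y ∈ Metric.ball x (r / 2), Metric.ball y (r / 2) ⊆ Metric.ball x r := by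
    intro y hy
    refine Metric.ball_subset_ball' ?_
    rw [Metric.mem_ball] at hy
    linarith
  have hdiff : ∀ a, ∀ y ∈ Metric.ball x (r / 2), DifferentiableAt ℂ (fun y => f y a) y :=
    fun a y hy => (hf a).differentiableAt
      (Metric.isOpen_ball.mem_nhds (Metric.ball_subset_ball (by linarith) hy))
  refine (hasFDerivAt_integral_of_dominated_of_fderiv_le (𝕜 := ℂ)
    (F' := fun y a => fderiv ℂ (fun y => f y a) y)
    (bound := fun a => 2 * g a / (r / 2)) (Metric.ball_mem_nhds x (half_pos hr)) ?_ ?_ ?_ ?_ ?_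
    ?_).differentiableAt
  · filter_upwards [Metric.ball_mem_nhds x hr] with y hy using hm y hy
  · exact hg.mono' (hm x hx) (Eventually.of_forall fun a => hb a x hx)
  -- Measurability of the derivative in the integration variable: it is a pointwise limit of
  -- difference quotients with step 1/(k + N + 1), where the shift by `N` keeps all sample points in
  -- the ball.
  · refine aestronglyMeasurable_clm_of_forall_apply fun v => ?_
    obtain ⟨N, hN⟩ : ∃ N : ℕ, ∀ k : ℕ, N ≤ k →
        x + ((k + 1 : ℝ)⁻¹ : ℂ) • v ∈ Metric.ball x r := by
      have ht : Tendsto (fun k : ℕ => x + ((k + 1 : ℝ)⁻¹ : ℂ) • v) atTop (𝓝 x) := by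
        have h0 : Tendsto (fun k : ℕ => ((k + 1 : ℝ)⁻¹ : ℂ)) atTop (𝓝 0) := by
          have := tendsto_one_div_add_atTop_nhds_zero_nat (𝕜 := ℂ)
          simpa using this
        simpa using (h0.smul_const v).const_add x
      exact eventually_atTop.1 (ht.eventually (Metric.ball_mem_nhds x hr))
    refine aestronglyMeasurable_of_tendsto_ae (u := atTop)
      (f := fun (k : ℕ) a => ((k + N : ℕ) + 1 : ℂ) •
        (f (x + (((k + N : ℕ) + 1 : ℝ)⁻¹ : ℂ) • v) a - f x a)) (fun k => ?_) ?_
    · exact ((hm _ (hN _ (Nat.le_add_left _ _))).sub (hm x hx)).const_smul _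
    · refine Eventually.of_forall fun a => ?_
      have h2 : Tendsto (fun k : ℕ => ‖((k + N : ℕ) + 1 : ℂ)‖) atTop atTop := by
        have h3 : Tendsto (fun k : ℕ => ((k + N : ℕ) + 1 : ℝ)) atTop atTop :=
          tendsto_atTop_add_const_right _ _
            (tendsto_natCast_atTop_atTop.comp (tendsto_add_atTop_nat N))
        refine h3.congr fun k => ?_
        have : ((k + N : ℕ) + 1 : ℂ) = ((k + N + 1 : ℕ) : ℂ) := by push_cast; ring
        rw [this, Complex.norm_natCast]
        push_cast; ring
      refine ((hdiff a x (Metric.mem_ball_self (half_pos hr))).hasFDerivAt.lim v h2).congr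
        fun k => ?_
      simp
  · refine Eventually.of_forall fun a y hy => ?_
    exact norm_fderiv_le_of_norm_le_ball (half_pos hr) ((hf a).mono (hsub y hy))
      fun z hz => hb a z (hsub y hy hz)
  · exact (hg.const_mul 2).div_const _
  · exact Eventually.of_forall fun a y hy => (hdiff a y hy).hasFDerivAt

variable [CompleteSpace F]

/-- The Fréchet derivative of a holomorphic function of several variables is holomorphic. -/
theorem differentiableOn_fderiv_of_isOpen {f : E → F} {U : Set E} (hU : IsOpen U)
    (hf : DifferentiableOn ℂ f U) : DifferentiableOn ℂ (fderiv ℂ f) U := by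
  intro x hx
  refine (hasFDerivAt_of_forall_apply fun v => ?_).differentiableWithinAt
  obtain ⟨r, hr, hrU, M, hM⟩ : ∃ r > 0, Metric.ball x r ⊆ U ∧
      ∃ M, ∀ y ∈ Metric.ball x r, ‖f y‖ ≤ M := by
    have hc : ContinuousAt f x := (hf.differentiableAt (hU.mem_nhds hx)).continuousAt
    have h1 : ∀ᶠ y in 𝓝 x, ‖f y‖ < ‖f x‖ + 1 :=
      hc.norm.eventually (gt_mem_nhds (by linarith))
    obtain ⟨r, hr, h⟩ := Metric.eventually_nhds_iff_ball.1 (h1.and (hU.mem_nhds hx))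
    exact ⟨r, hr, fun y hy => (h y hy).2, _, fun y hy => (h y hy).1.le⟩
  -- For `y` in the half ball the circle of this radius in direction `v` stays in the full ball; the
  -- `+ 1` covers `v = 0`.
  set c : ℝ := r / (2 * (‖v‖ + 1)) with hc
  have hc0 : 0 < c := by positivity
  have hmaps : ∀ y ∈ Metric.ball x (r / 2), ∀ t ∈ Metric.closedBall (0 : ℂ) c,
      y + t • v ∈ Metric.ball x r := by
    intro y hy t ht
    rw [mem_closedBall_zero_iff] at ht
    rw [mem_ball_iff_norm] at hy ⊢
    have h2 : ‖t • v‖ ≤ r / 2 := by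
      rw [norm_smul]
      calc ‖t‖ * ‖v‖ ≤ c * (‖v‖ + 1) := by gcongr; linarith
        _ = r / 2 := by rw [hc]; field_simp
    calc ‖y + t • v - x‖ = ‖(y - x) + t • v‖ := by congr 1; abel
      _ ≤ ‖y - x‖ + ‖t • v‖ := norm_add_le _ _
      _ < r := by linarith
  have hfx : DifferentiableOn ℂ f (Metric.ball x r) := hf.mono hrU
  have hcirc : ∀ θ : ℝ, circleMap 0 c θ ∈ Metric.closedBall (0 : ℂ) c := fun θ => by
    simp [abs_of_pos hc0]
  -- Cauchy's formula on the line through `y`: the derivative becomes an integral over a fixed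
  -- circle of values of `f`, which is visibly holomorphic in `y`.
  have key : ∀ y ∈ Metric.ball x (r / 2), fderiv ℂ f y v = (2 * Real.pi * Complex.I : ℂ)⁻¹ •
      ∫ θ in Set.Icc 0 (2 * Real.pi), deriv (circleMap 0 c) θ • ((circleMap 0 c θ - 0) ^ 2)⁻¹ •
        f (y + circleMap 0 c θ • v) := by
    intro y hy
    have hy0 : y ∈ Metric.ball x r := Metric.ball_subset_ball (by linarith) hy
    have h2 : DifferentiableAt ℂ f (y + (0 : ℂ) • v) := by
      rw [zero_smul, add_zero]
      exact hfx.differentiableAt (Metric.isOpen_ball.mem_nhds hy0)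
    have h3 := h2.deriv_comp_add_smul
    rw [zero_smul, add_zero] at h3
    have hopen : IsOpen ((fun t : ℂ => y + t • v) ⁻¹' Metric.ball x r) :=
      Metric.isOpen_ball.preimage (by fun_prop)
    have h4 := Complex.cderiv_eq_deriv (f := fun t : ℂ => f (y + t • v)) hopen
      (hfx.comp (by fun_prop) fun _ h => h) hc0 (fun t ht => hmaps y hy t ht)
    rw [← h3, ← h4, Complex.cderiv, circleIntegral_def_Icc]
  have hcont : ∀ y ∈ Metric.ball x (r / 2), Continuous fun θ : ℝ =>
      deriv (circleMap 0 c) θ • ((circleMap 0 c θ - 0) ^ 2)⁻¹ • f (y + circleMap 0 c θ • v) := by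
    intro y hy
    have hC : Continuous (circleMap 0 c) := continuous_circleMap 0 c
    refine Continuous.smul ?_ (Continuous.smul ?_ ?_)
    · have : deriv (circleMap 0 c) = fun θ => circleMap 0 c θ * Complex.I :=
        funext fun θ => deriv_circleMap 0 c θ
      rw [this]
      fun_prop
    · refine Continuous.inv₀ (by fun_prop) fun θ => ?_
      simp [hc0.ne']
    · exact hfx.continuousOn.comp_continuous (by fun_prop) fun θ => hmaps y hy _ (hcirc θ)
  have hint : DifferentiableAt ℂ (fun y => ∫ θ in Set.Icc 0 (2 * Real.pi),
      deriv (circleMap 0 c) θ • ((circleMap 0 c θ - 0) ^ 2)⁻¹ •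
        f (y + circleMap 0 c θ • v)) x := by
    refine differentiableAt_integral_of_holomorphic (half_pos hr) (g := fun _ => c⁻¹ * M)
      (fun θ => ?_) (fun y hy => (hcont y hy).aestronglyMeasurable) (fun θ y hy => ?_)
      (integrable_const _)
    · refine DifferentiableOn.const_smul (DifferentiableOn.const_smul ?_ _) _
      exact hfx.comp (by fun_prop) fun y hy => hmaps y hy _ (hcirc θ)
    · have h5 := hM _ (hmaps y hy _ (hcirc θ))
      rw [norm_smul, norm_smul, deriv_circleMap, ← mul_assoc]
      refine mul_le_mul (le_of_eq ?_) h5 (norm_nonneg _) (by positivity)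
      simp only [norm_mul, norm_circleMap_zero, Complex.norm_I, mul_one, sub_zero, norm_inv,
        norm_pow, abs_of_pos hc0]
      field_simp
  refine (hint.const_smul (2 * Real.pi * Complex.I : ℂ)⁻¹).congr_of_eventuallyEq ?_
  filter_upwards [Metric.ball_mem_nhds x (half_pos hr)] with y hy using key y hy

/-- Holomorphy passes to the Fréchet derivative, so induction on the order applies, with the target
space enlarged at each step. -/
theorem contDiffOn_of_differentiableOn_several {f : E → F} {U : Set E} (hU : IsOpen U)
    (hf : DifferentiableOn ℂ f U) : ContDiffOn ℂ ∞ f U := by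
  rw [contDiffOn_infty]
  intro k
  induction k generalizing F with
  | zero => exact contDiffOn_zero.2 hf.continuousOn
  | succ k ih =>
    rw [Nat.cast_succ, contDiffOn_succ_iff_fderiv_of_isOpen hU]
    exact ⟨hf, by simp, ih (differentiableOn_fderiv_of_isOpen hU hf)⟩

/-- Cauchy's inequalities for all derivatives of a bounded holomorphic function. -/
theorem exists_norm_iteratedFDeriv_le_of_holomorphic (k : ℕ) {r : ℝ} (hr : 0 < r) :
    ∃ C : ℝ, 0 ≤ C ∧ ∀ (f : E → F) (x : E) (M : ℝ), DifferentiableOn ℂ f (Metric.ball x r) →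
      (∀ y ∈ Metric.ball x r, ‖f y‖ ≤ M) → ‖iteratedFDeriv ℂ k f x‖ ≤ C * M := by
  induction k generalizing F r with
  | zero =>
    exact ⟨1, zero_le_one, fun f x M _ hM => by
      simpa using hM x (Metric.mem_ball_self hr)⟩
  | succ k ih =>
    -- Half of the radius pays for the first derivative, the other half for the remaining `k`.
    obtain ⟨C, hC, h⟩ := ih (F := E →L[ℂ] F) (half_pos hr)
    refine ⟨C * (2 / (r / 2)), by positivity, fun f x M hf hM => ?_⟩
    rw [← norm_iteratedFDeriv_fderiv]
    have hsub : ∀ y ∈ Metric.ball x (r / 2), Metric.ball y (r / 2) ⊆ Metric.ball x r := by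
      intro y hy
      refine Metric.ball_subset_ball' ?_
      rw [Metric.mem_ball] at hy
      linarith
    refine (h (fderiv ℂ f) x (2 * M / (r / 2)) ?_ fun y hy => ?_).trans (le_of_eq (by ring))
    · exact (differentiableOn_fderiv_of_isOpen Metric.isOpen_ball hf).mono
        (Metric.ball_subset_ball (by linarith))
    · exact norm_fderiv_le_of_norm_le_ball (half_pos hr) (hf.mono (hsub y hy))
        fun z hz => hM z (hsub y hy hz)

omit [FiniteDimensional ℂ E] [CompleteSpace F] in
theorem norm_iteratedFDeriv_real_eq {f : E → F} {x : E} {k : ℕ} (h : ContDiffAt ℂ k f x) :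
    ‖iteratedFDeriv ℝ k f x‖ = ‖iteratedFDeriv ℂ k f x‖ := by
  rw [← h.restrictScalars_iteratedFDeriv (𝕜 := ℝ)]
  simp

end Holomorphic

/-! ### The strip and the real phase space inside it -/

/-- The inclusion of the phase space in its complexification. -/
def toCC (σ : Phase n) : CConf n × CConf n := (toC σ.1, toC σ.2)

@[simp] theorem toC_apply (x : Conf n) (i : Fin n) : toC x i = (x i : ℂ) := rfl

theorem toCC_add (x y : Phase n) : toCC (x + y) = toCC x + toCC y := by
  ext i <;> simp [toCC]

theorem toCC_smul (t : ℝ) (x : Phase n) : toCC (t • x) = (t : ℂ) • toCC x := by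
  ext i <;> simp [toCC]

theorem toCC_neg (x : Phase n) : toCC (-x) = -toCC x := by
  ext i <;> simp [toCC]

theorem continuous_toC : Continuous (toC : Conf n → CConf n) := by
  refine continuous_pi fun i => ?_
  simp only [toC_apply]
  fun_prop

theorem continuous_toCC : Continuous (toCC : Phase n → CConf n × CConf n) :=
  (continuous_toC.comp continuous_fst).prodMk (continuous_toC.comp continuous_snd)

theorem norm_toC_le (x : Conf n) : ‖toC x‖ ≤ ‖x‖ := by
  refine (pi_norm_le_iff_of_nonneg (norm_nonneg _)).2 fun i => ?_
  simpa using PiLp.norm_apply_le x i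

theorem norm_toCC_le (σ : Phase n) : ‖toCC σ‖ ≤ ‖σ‖ :=
  max_le_max (norm_toC_le σ.1) (norm_toC_le σ.2)

theorem imNorm_eq (z : CConf n) :
    imNorm z = ‖(WithLp.toLp 2 (fun i => (z i).im) : Conf n)‖ := by
  simp [imNorm, EuclideanSpace.norm_eq]

theorem sq_imNorm (z : CConf n) : imNorm z ^ 2 = ∑ i, (z i).im ^ 2 :=
  Real.sq_sqrt (Finset.sum_nonneg fun _ _ => sq_nonneg _)

theorem imNorm_add_le (z w : CConf n) : imNorm (z + w) ≤ imNorm z + imNorm w := by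
  simp only [imNorm_eq]
  refine le_trans (le_of_eq ?_) (norm_add_le _ _)
  congr 1

theorem imNorm_smul (t : ℝ) (z : CConf n) : imNorm (t • z) = |t| * imNorm z := by
  simp only [imNorm_eq]
  rw [← Real.norm_eq_abs, ← norm_smul]
  congr 1
  ext i
  simp

/-- The ambient norm on `CConf n` is the maximum norm, whereas the strip is Euclidean; the crude
factor `n` stands in for √n. -/
theorem imNorm_le (z : CConf n) : imNorm z ≤ n * ‖z‖ := by
  refine Real.sqrt_le_iff.2 ⟨by positivity, ?_⟩
  calc ∑ i, (z i).im ^ 2 ≤ ∑ _i : Fin n, ‖z‖ ^ 2 := by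
        refine Finset.sum_le_sum fun i _ => ?_
        rw [← sq_abs]
        gcongr
        exact (Complex.abs_im_le_norm _).trans (norm_le_pi_norm z i)
    _ = n * ‖z‖ ^ 2 := by simp
    _ ≤ (n * ‖z‖) ^ 2 := by
        rw [mul_pow]
        gcongr
        rcases Nat.eq_zero_or_pos n with rfl | hn
        · simp
        · have : (1 : ℝ) ≤ n := by exact_mod_cast hn
          nlinarith

theorem continuous_imNorm : Continuous (imNorm : CConf n → ℝ) := by
  unfold imNorm
  refine Real.continuous_sqrt.comp ?_
  refine continuous_finsetSum _ fun i _ => ?_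
  exact (Complex.continuous_im.comp (continuous_apply i)).pow 2

theorem isOpen_strip (a b : ℝ) : IsOpen (strip n a b) :=
  (isOpen_lt (continuous_imNorm.comp continuous_fst) continuous_const).inter
    (isOpen_lt (continuous_imNorm.comp continuous_snd) continuous_const)

theorem strip_mono {a b a' b' : ℝ} (ha : a' ≤ a) (hb : b' ≤ b) :
    strip n a' b' ⊆ strip n a b := fun _ h => ⟨h.1.trans_le ha, h.2.trans_le hb⟩

theorem convex_strip (a b : ℝ) : Convex ℝ (strip n a b) := by
  intro w hw w' hw' s t hs ht hst
  have aux : ∀ (c : ℝ) (z z' : CConf n), imNorm z < c → imNorm z' < c →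
      imNorm (s • z + t • z') < c := by
    intro c z z' hz hz'
    refine (imNorm_add_le _ _).trans_lt ?_
    rw [imNorm_smul, imNorm_smul, abs_of_nonneg hs, abs_of_nonneg ht]
    -- Strictness must come from a positive weight, hence the separate case `s = 0`.
    rcases hs.eq_or_lt with rfl | hs'
    · have : t = 1 := by linarith
      subst this; linarith
    · calc s * imNorm z + t * imNorm z' < s * c + t * c :=
            add_lt_add_of_lt_of_le (mul_lt_mul_of_pos_left hz hs') (by gcongr)
        _ = c := by rw [← add_mul, hst, one_mul]
  exact ⟨aux a _ _ hw.1 hw'.1, aux b _ _ hw.2 hw'.2⟩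

theorem imNorm_add_toC (z : CConf n) (x : Conf n) : imNorm (z + toC x) = imNorm z := by
  simp [imNorm]

theorem add_toCC_mem_strip {a b : ℝ} {w : CConf n × CConf n} (hw : w ∈ strip n a b)
    (σ : Phase n) : w + toCC σ ∈ strip n a b := by
  refine ⟨?_, ?_⟩
  · simpa [toCC, imNorm_add_toC] using hw.1
  · simpa [toCC, imNorm_add_toC] using hw.2

theorem toCC_mem_strip {a b : ℝ} (ha : 0 < a) (hb : 0 < b) (σ : Phase n) :
    toCC σ ∈ strip n a b := by
  have : (0 : CConf n × CConf n) ∈ strip n a b := by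
    constructor <;> simpa [imNorm]
  simpa using add_toCC_mem_strip this σ

theorem ball_subset_strip {a b a' b' r : ℝ} (hra : n * r ≤ a - a') (hrb : n * r ≤ b - b')
    {w : CConf n × CConf n} (hw : w ∈ strip n a' b') : Metric.ball w r ⊆ strip n a b := by
  intro y hy
  rw [mem_ball_iff_norm] at hy
  have aux : ∀ (c c' : ℝ) (z z' : CConf n), imNorm z < c' → ‖z' - z‖ < r → n * r ≤ c - c' →
      imNorm z' < c := by
    intro c c' z z' hz hz' hr
    have h1 := imNorm_add_le z (z' - z)
    rw [add_sub_cancel] at h1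
    have h2 : (n : ℝ) * ‖z' - z‖ ≤ n * r := by gcongr
    linarith [imNorm_le (z' - z)]
  exact ⟨aux a a' _ _ hw.1 ((norm_fst_le (y - w)).trans_lt hy) hra,
    aux b b' _ _ hw.2 ((norm_snd_le (y - w)).trans_lt hy) hrb⟩

theorem exists_ball_subset_strip {a b a' b' : ℝ} (ha : a' < a) (hb : b' < b) :
    ∃ r > 0, ∀ w ∈ strip n a' b', Metric.ball w r ⊆ strip n a b := by
  have hm : 0 < min (a - a') (b - b') := lt_min (by linarith) (by linarith)
  -- Dividing the gap by `n + 1` instead of `n` also covers `n = 0`.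
  have h : (n : ℝ) * (min (a - a') (b - b') / (n + 1)) ≤ min (a - a') (b - b') := by
    rw [mul_div_assoc', div_le_iff₀ (by positivity)]
    nlinarith
  exact ⟨min (a - a') (b - b') / (n + 1), by positivity, fun w hw =>
    ball_subset_strip (h.trans (min_le_left _ _)) (h.trans (min_le_right _ _)) hw⟩

/-! ### Gaussian integrals on the phase space -/

/-- The Euclidean norm squared on the phase space. -/
def phaseSq (σ : Phase n) : ℝ := ‖σ.1‖ ^ 2 + ‖σ.2‖ ^ 2

theorem phaseSq_nonneg (σ : Phase n) : 0 ≤ phaseSq σ := by unfold phaseSq; positivity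

theorem continuous_phaseSq : Continuous (phaseSq : Phase n → ℝ) := by
  unfold phaseSq; fun_prop

theorem sq_norm_le_phaseSq (σ : Phase n) : ‖σ‖ ^ 2 ≤ phaseSq σ := by
  unfold phaseSq
  rcases max_choice ‖σ.1‖ ‖σ.2‖ with h | h <;> rw [Prod.norm_def, h] <;>
    nlinarith [sq_nonneg ‖σ.1‖, sq_nonneg ‖σ.2‖]

theorem phaseSq_le_add (c σ : Phase n) :
    phaseSq σ ≤ 2 * phaseSq (c + σ) + 2 * phaseSq c := by
  have aux : ∀ x y : Conf n, ‖y‖ ^ 2 ≤ 2 * ‖x + y‖ ^ 2 + 2 * ‖x‖ ^ 2 := by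
    intro x y
    have h : ‖y‖ ≤ ‖x + y‖ + ‖x‖ := by
      calc ‖y‖ = ‖(x + y) - x‖ := by congr 1; abel
        _ ≤ _ := norm_sub_le _ _
    have := pow_le_pow_left₀ (norm_nonneg _) h 2
    nlinarith [sq_nonneg (‖x + y‖ - ‖x‖)]
  have h1 := aux c.1 σ.1
  have h2 := aux c.2 σ.2
  simp only [phaseSq, Prod.fst_add, Prod.snd_add]
  linarith

theorem integrable_exp_neg_mul_sq_norm {c : ℝ} (hc : 0 < c) :
    Integrable fun x : Conf n => Real.exp (-c * ‖x‖ ^ 2) := by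
  have := (GaussianFourier.integrable_cexp_neg_mul_sq_norm_add (V := Conf n) (b := (c : ℂ))
    (by simpa) 0 0).norm
  refine this.congr (Eventually.of_forall fun x => ?_)
  simp only [zero_mul, add_zero, Complex.norm_exp]
  congr 1
  norm_cast

theorem integrable_exp_neg_mul_phaseSq {c : ℝ} (hc : 0 < c) :
    Integrable fun σ : Phase n => Real.exp (-c * phaseSq σ) := by
  have h := (integrable_exp_neg_mul_sq_norm (n := n) hc)
  refine (h.mul_prod h).congr (Eventually.of_forall fun σ => ?_)
  simp only [phaseSq]
  rw [← Real.exp_add]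
  ring_nf

theorem integral_exp_neg_mul_phaseSq {h : ℝ} (hh : 0 < h) :
    ∫ σ : Phase n, Real.exp (-(1 / (2 * h)) * phaseSq σ) = (2 * Real.pi * h) ^ n := by
  have h1 : ∫ x : Conf n, Real.exp (-(1 / (2 * h)) * ‖x‖ ^ 2) =
      (2 * Real.pi * h) ^ ((n : ℝ) / 2) := by
    rw [GaussianFourier.integral_rexp_neg_mul_sq_norm (by positivity)]
    simp only [finrank_euclideanSpace, Fintype.card_fin]
    congr 1
    field_simp
  have h2 : (fun σ : Phase n => Real.exp (-(1 / (2 * h)) * phaseSq σ)) = fun σ =>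
      Real.exp (-(1 / (2 * h)) * ‖σ.1‖ ^ 2) * Real.exp (-(1 / (2 * h)) * ‖σ.2‖ ^ 2) := by
    funext σ
    rw [← Real.exp_add, phaseSq]
    ring_nf
  rw [h2, Measure.volume_eq_prod, integral_prod_mul
    (fun x : Conf n => Real.exp (-(1 / (2 * h)) * ‖x‖ ^ 2))
    (fun x : Conf n => Real.exp (-(1 / (2 * h)) * ‖x‖ ^ 2)), h1,
    ← Real.rpow_add (by positivity), add_halves, Real.rpow_natCast]

/-- Half of the Gaussian absorbs the polynomial, by the bound of a power by the exponential series.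
-/
theorem integrable_norm_pow_mul_exp (k : ℕ) :
    Integrable fun σ : Phase n => ‖σ‖ ^ k * Real.exp (-(1 / 2) * phaseSq σ) := by
  have h1 : ∀ σ : Phase n, ‖σ‖ ^ k ≤ (1 + 4 ^ k * k.factorial) * Real.exp (1 / 4 * phaseSq σ) := by
    intro σ
    have h2 := Real.pow_div_factorial_le_exp (1 / 4 * phaseSq σ)
      (by have := phaseSq_nonneg σ; positivity) k
    have h3 : phaseSq σ ^ k ≤ 4 ^ k * k.factorial * Real.exp (1 / 4 * phaseSq σ) := by
      rw [mul_pow, div_pow, one_pow, div_mul_eq_mul_div, one_mul, div_div,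
        div_le_iff₀ (by positivity)] at h2
      linarith
    have h4 : ‖σ‖ ^ k ≤ 1 + phaseSq σ ^ k := by
      rcases le_total ‖σ‖ 1 with h | h
      · have := pow_le_one₀ (n := k) (norm_nonneg σ) h
        have := pow_nonneg (phaseSq_nonneg σ) k
        linarith
      · have h5 : ‖σ‖ ≤ phaseSq σ := (le_self_pow₀ h two_ne_zero).trans (sq_norm_le_phaseSq σ)
        have := pow_le_pow_left₀ (norm_nonneg σ) h5 k
        linarith
    have h6 : (1 : ℝ) ≤ Real.exp (1 / 4 * phaseSq σ) :=
      Real.one_le_exp (by have := phaseSq_nonneg σ; positivity)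
    linarith
  refine ((integrable_exp_neg_mul_phaseSq (n := n) (c := 1 / 4) (by norm_num)).const_mul
    (1 + 4 ^ k * k.factorial)).mono' ?_ (Eventually.of_forall fun σ => ?_)
  · have := continuous_phaseSq (n := n)
    exact Continuous.aestronglyMeasurable (by fun_prop)
  · rw [Real.norm_of_nonneg (by positivity)]
    calc ‖σ‖ ^ k * Real.exp (-(1 / 2) * phaseSq σ)
        ≤ (1 + 4 ^ k * k.factorial) * Real.exp (1 / 4 * phaseSq σ) *
          Real.exp (-(1 / 2) * phaseSq σ) := by gcongr; exact h1 σ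
      _ = _ := by rw [mul_assoc, ← Real.exp_add]; ring_nf

/-- The complex quadratic form `-u₁²/2 - u₂²/2 + i⟨u₁, u₂⟩`. -/
def gaussQ (u : CConf n × CConf n) : ℂ :=
  -(1 / 2) * pair u.1 u.1 - 1 / 2 * pair u.2 u.2 + Complex.I * pair u.1 u.2

/-- The real point `(Re u₁ + Im u₂, Re u₂ + Im u₁)`. -/
def shiftRe (u : CConf n × CConf n) : Phase n :=
  (WithLp.toLp 2 fun i => (u.1 i).re + (u.2 i).im,
    WithLp.toLp 2 fun i => (u.2 i).re + (u.1 i).im)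

theorem shiftRe_add_toCC (u : CConf n × CConf n) (σ : Phase n) :
    shiftRe (u + toCC σ) = shiftRe u + σ := by
  ext i <;> simp [shiftRe, toCC] <;> ring

/-- `|Im u₁|² + |Im u₂|²`. -/
def imSq (u : CConf n × CConf n) : ℝ := imNorm u.1 ^ 2 + imNorm u.2 ^ 2

theorem imSq_add_toCC (u : CConf n × CConf n) (σ : Phase n) : imSq (u + toCC σ) = imSq u := by
  simp [imSq, toCC, imNorm_add_toC]

/-- Completing squares coordinate by coordinate. The only growth comes from the imaginary part of
`u`, and adding a real vector merely translates the real Gaussian; every estimate on contour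
integrals below rests on this. -/
theorem re_gaussQ (u : CConf n × CConf n) :
    (gaussQ u).re = imSq u - 1 / 2 * phaseSq (shiftRe u) := by
  have h : imSq u - 1 / 2 * phaseSq (shiftRe u) =
      ∑ i, ((u.1 i).im ^ 2 + (u.2 i).im ^ 2 - 1 / 2 * (((u.1 i).re + (u.2 i).im) ^ 2 +
        ((u.2 i).re + (u.1 i).im) ^ 2)) := by
    simp only [imSq, sq_imNorm, phaseSq, shiftRe, EuclideanSpace.real_norm_sq_eq]
    rw [Finset.sum_sub_distrib, Finset.sum_add_distrib, ← Finset.mul_sum, Finset.sum_add_distrib]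
  have h2 : gaussQ u = ∑ i, (-(1 / 2) * (u.1 i * u.1 i) - 1 / 2 * (u.2 i * u.2 i) +
      Complex.I * (u.1 i * u.2 i)) := by
    simp only [gaussQ, pair]
    rw [Finset.sum_add_distrib, Finset.sum_sub_distrib, Finset.mul_sum, Finset.mul_sum,
      Finset.mul_sum]
  rw [h, h2, Complex.re_sum]
  refine Finset.sum_congr rfl fun i _ => ?_
  simp
  ring

theorem re_gaussQ_toCC (σ : Phase n) : (gaussQ (toCC σ)).re = -(1 / 2) * phaseSq σ := by
  have h := re_gaussQ ((0 : CConf n × CConf n) + toCC σ)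
  rw [imSq_add_toCC, shiftRe_add_toCC] at h
  have h0 : shiftRe (0 : CConf n × CConf n) = 0 := by ext i <;> simp [shiftRe]
  have h1 : imSq (0 : CConf n × CConf n) = 0 := by simp [imSq, imNorm]
  rw [zero_add, h0, h1, zero_add] at h
  rw [h]; ring

theorem norm_exp_gaussQ_div {h : ℝ} (u : CConf n × CConf n) (σ : Phase n) :
    ‖Complex.exp (gaussQ (u + toCC σ) / h)‖ =
      Real.exp (imSq u / h) * Real.exp (-(1 / (2 * h)) * phaseSq (shiftRe u + σ)) := by
  rw [Complex.norm_exp, Complex.div_ofReal_re, re_gaussQ, imSq_add_toCC, shiftRe_add_toCC,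
    ← Real.exp_add]
  congr 1
  ring

theorem differentiable_pair {f g : CConf n × CConf n → CConf n} (hf : Differentiable ℂ f)
    (hg : Differentiable ℂ g) : Differentiable ℂ fun u => pair (f u) (g u) := by
  unfold pair
  fun_prop

theorem differentiable_gaussQ : Differentiable ℂ (gaussQ : CConf n × CConf n → ℂ) := by
  unfold gaussQ
  have h1 := differentiable_pair (n := n) differentiable_fst differentiable_fst
  have h2 := differentiable_pair (n := n) differentiable_snd differentiable_snd
  have h3 := differentiable_pair (n := n) differentiable_fst differentiable_snd
  fun_prop

theorem continuous_shiftRe : Continuous (shiftRe : CConf n × CConf n → Phase n) := by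
  unfold shiftRe
  refine Continuous.prodMk ?_ ?_ <;>
  · refine (PiLp.continuous_toLp 2 _).comp (continuous_pi fun i => ?_)
    fun_prop

theorem continuous_imSq : Continuous (imSq : CConf n × CConf n → ℝ) :=
  ((continuous_imNorm.comp continuous_fst).pow 2).add
    ((continuous_imNorm.comp continuous_snd).pow 2)

/-- The Gaussian integral normalising the composition of the two phases. -/
theorem integral_exp_gaussQ :
    ∫ σ : Phase n, Complex.exp (gaussQ (toCC σ)) =
      (((2 * Real.pi) ^ n / Real.sqrt 2 ^ n : ℝ) : ℂ) := by
  have hint : Integrable (fun σ : Phase n => Complex.exp (gaussQ (toCC σ)))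
      ((volume : Measure (Conf n)).prod (volume : Measure (Conf n))) := by
    refine (integrable_exp_neg_mul_phaseSq (n := n) (c := 1 / 2) (by norm_num)).mono' ?_
      (Eventually.of_forall fun σ => ?_)
    · exact (Complex.continuous_exp.comp
        (differentiable_gaussQ.continuous.comp continuous_toCC)).aestronglyMeasurable
    · rw [Complex.norm_exp, re_gaussQ_toCC]
  have hpair : ∀ x y : Conf n, pair (toC x) (toC y) = ((inner ℝ y x : ℝ) : ℂ) := by
    intro x y
    simp [pair, PiLp.inner_apply]
  have hsq : ∀ x : Conf n, pair (toC x) (toC x) = (‖x‖ : ℂ) ^ 2 := by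
    intro x
    rw [hpair, real_inner_self_eq_norm_sq]
    push_cast; rfl
  rw [Measure.volume_eq_prod, integral_prod_symm _ hint]
  -- The `x`-integral contributes a second factor e^{-|y|²/2} from the cross term `i⟨x, y⟩`, so the
  -- `y`-integral has the weight e^{-|y|²} and the total is (2π · π)^{n/2}.
  have inner_int : ∀ y : Conf n, ∫ x : Conf n, Complex.exp (gaussQ (toCC (x, y))) =
      ((2 * Real.pi : ℝ) : ℂ) ^ ((n : ℂ) / 2) * Complex.exp (-(1 : ℂ) * (‖y‖ : ℂ) ^ 2) := by
    intro y
    have h1 : ∀ x : Conf n, Complex.exp (gaussQ (toCC (x, y))) =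
        Complex.exp (-(1 / 2) * (‖y‖ : ℂ) ^ 2) *
          Complex.exp (-(1 / 2 : ℂ) * (‖x‖ : ℂ) ^ 2 + Complex.I * (inner ℝ y x : ℝ)) := by
      intro x
      rw [← Complex.exp_add]
      congr 1
      simp only [gaussQ, toCC, hsq, hpair]
      ring
    simp_rw [h1]
    rw [integral_const_mul, GaussianFourier.integral_cexp_neg_mul_sq_norm_add (by norm_num)]
    rw [mul_left_comm, ← Complex.exp_add]
    congr 1
    · simp only [finrank_euclideanSpace, Fintype.card_fin]
      congr 1
      push_cast; field_simp
    · congr 1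
      rw [Complex.I_sq]; ring
  simp_rw [inner_int]
  rw [integral_const_mul, GaussianFourier.integral_cexp_neg_mul_sq_norm (by norm_num)]
  simp only [finrank_euclideanSpace, Fintype.card_fin, div_one]
  have h2 : ((n : ℂ) / 2) = (((n : ℝ) / 2 : ℝ) : ℂ) := by push_cast; rfl
  rw [h2, ← Complex.ofReal_cpow (by positivity), ← Complex.ofReal_cpow (by positivity),
    ← Complex.ofReal_mul]
  congr 1
  rw [← Real.mul_rpow (by positivity) (by positivity), ← div_pow, ← Real.rpow_natCast,
    Real.sqrt_eq_rpow]
  have h3 : 2 * Real.pi * Real.pi = (2 * Real.pi / 2 ^ (1 / 2 : ℝ)) ^ (2 : ℝ) := by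
    rw [Real.div_rpow (by positivity) (by positivity), ← Real.rpow_mul (by norm_num)]
    norm_num
    ring
  rw [h3, ← Real.rpow_mul (by positivity)]
  congr 1
  ring

/-! ### Contour deformation -/

instance instIsAddHaarMeasurePhase : (volume : Measure (Phase n)).IsAddHaarMeasure :=
  inferInstanceAs ((volume : Measure (Conf n)).prod (volume : Measure (Conf n))).IsAddHaarMeasure

/-- The integral of `p(w) exp(Q(w - W)/h)` over the shifted contour `w ∈ w₀ + ℝ²ⁿ`. -/
def contourInt (p : CConf n × CConf n → ℂ) (h : ℝ) (W w : CConf n × CConf n) : ℂ :=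
  ∫ σ : Phase n, p (w + toCC σ) * Complex.exp (gaussQ (w - W + toCC σ) / h)

section Strip

variable {a b M : ℝ} {p : CConf n × CConf n → ℂ}

theorem continuous_comp_add_toCC (hp : DifferentiableOn ℂ p (strip n a b))
    {w : CConf n × CConf n} (hw : w ∈ strip n a b) :
    Continuous fun σ : Phase n => p (w + toCC σ) :=
  hp.continuousOn.comp_continuous (continuous_const.add continuous_toCC)
    fun σ => add_toCC_mem_strip hw σ

theorem continuous_contourIntegrand (hp : DifferentiableOn ℂ p (strip n a b)) (h : ℝ)
    (W : CConf n × CConf n) {w : CConf n × CConf n} (hw : w ∈ strip n a b) :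
    Continuous fun σ : Phase n =>
      p (w + toCC σ) * Complex.exp (gaussQ (w - W + toCC σ) / h) := by
  refine (continuous_comp_add_toCC hp hw).mul (Complex.continuous_exp.comp ?_)
  exact (differentiable_gaussQ.continuous.comp
    (continuous_const.add continuous_toCC)).div_const _

/-- Locally in `w` the Gaussian has its centre and growth factor in a compact set, so giving up half
of its rate yields a dominating function independent of `w`. -/
theorem differentiableOn_contourInt (hp : DifferentiableOn ℂ p (strip n a b))
    (hM : ∀ w ∈ strip n a b, ‖p w‖ ≤ M) {h : ℝ} (hh : 0 < h) (W : CConf n × CConf n) :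
    DifferentiableOn ℂ (contourInt p h W) (strip n a b) := by
  intro w hw
  refine DifferentiableAt.differentiableWithinAt ?_
  obtain ⟨r, hr, hball⟩ := Metric.isOpen_iff.1 (isOpen_strip a b) w hw
  obtain ⟨B, hB⟩ := (isCompact_closedBall w r).exists_bound_of_continuousOn
    (f := fun y => imSq (y - W) + 1 / 2 * phaseSq (shiftRe (y - W)))
    (Continuous.continuousOn (by
      have h1 := continuous_imSq (n := n)
      have h2 := continuous_phaseSq (n := n)
      have h3 := continuous_shiftRe (n := n)
      fun_prop))
  have hM0 : 0 ≤ M := (norm_nonneg _).trans (hM w hw)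
  refine differentiableAt_integral_of_holomorphic hr
    (g := fun σ => M * (Real.exp (B / h) * Real.exp (-(1 / (4 * h)) * phaseSq σ)))
    (fun σ => ?_) (fun y hy => ?_) (fun σ y hy => ?_) ?_
  · have h1 : DifferentiableOn ℂ (fun y => p (y + toCC σ)) (Metric.ball w r) :=
      hp.comp (by fun_prop) fun y hy => add_toCC_mem_strip (hball hy) σ
    refine h1.mul (Differentiable.differentiableOn ?_)
    have h2 : Differentiable ℂ fun y : CConf n × CConf n => gaussQ (y - W + toCC σ) :=
      differentiable_gaussQ.comp (by fun_prop)
    fun_prop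
  · exact (continuous_contourIntegrand hp h W (hball hy)).aestronglyMeasurable
  · rw [norm_mul, norm_exp_gaussQ_div]
    refine mul_le_mul (hM _ (add_toCC_mem_strip (hball hy) σ)) ?_ (by positivity) hM0
    rw [← Real.exp_add, ← Real.exp_add]
    refine Real.exp_le_exp.2 ?_
    have h1 := (le_abs_self _).trans (hB y (Metric.ball_subset_closedBall hy))
    have h2 := phaseSq_le_add (shiftRe (y - W)) σ
    have h3 : (imSq (y - W) + -(1 / 2) * phaseSq (shiftRe (y - W) + σ)) / h ≤
        (B + -(1 / 4) * phaseSq σ) / h :=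
      div_le_div_of_nonneg_right (by linarith) hh.le
    refine (le_of_eq ?_).trans (h3.trans (le_of_eq ?_)) <;> field_simp
  · exact ((integrable_exp_neg_mul_phaseSq (by positivity)).const_mul _).const_mul _

/-- Translation invariance of Lebesgue measure: a real shift of the base point only reparametrises
the contour. -/
theorem contourInt_add_toCC (p : CConf n × CConf n → ℂ) (h : ℝ) (W w : CConf n × CConf n)
    (γ : Phase n) : contourInt p h W (w + toCC γ) = contourInt p h W w := by
  unfold contourInt
  rw [← integral_add_left_eq_self (μ := (volume : Measure (Phase n)))
    (fun σ => p (w + toCC σ) * Complex.exp (gaussQ (w - W + toCC σ) / h)) γ]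
  refine integral_congr_ae (Eventually.of_forall fun σ => ?_)
  simp only [toCC_add]
  congr 2
  · abel
  · congr 2; abel

/-- Contours may be moved freely inside the strip. -/
theorem contourInt_eq (hp : DifferentiableOn ℂ p (strip n a b))
    (hM : ∀ w ∈ strip n a b, ‖p w‖ ≤ M) {h : ℝ} (hh : 0 < h) (W : CConf n × CConf n)
    {w w' : CConf n × CConf n} (hw : w ∈ strip n a b) (hw' : w' ∈ strip n a b) :
    contourInt p h W w = contourInt p h W w' := by
  have hd := differentiableOn_contourInt hp hM hh W
  refine (isOpen_strip a b).is_const_of_fderiv_eq_zero (convex_strip a b).isPreconnected hd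
    (fun x hx => ?_) hw hw'
  have hdx : DifferentiableAt ℂ (contourInt p h W) x :=
    hd.differentiableAt ((isOpen_strip a b).mem_nhds hx)
  -- Along real directions the function is constant, so its derivative vanishes there.
  have hreal : ∀ γ : Phase n, fderiv ℂ (contourInt p h W) x (toCC γ) = 0 := by
    intro γ
    have h1 : HasDerivAt (fun t : ℝ => contourInt p h W (x + (t : ℂ) • toCC γ))
        (fderiv ℂ (contourInt p h W) x (toCC γ)) 0 := by
      have h2 : HasFDerivAt (contourInt p h W) (fderiv ℂ (contourInt p h W) x)
          (x + ((0 : ℝ) : ℂ) • toCC γ) := by simpa using hdx.hasFDerivAt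
      have h3 : HasDerivAt (fun t : ℝ => x + (t : ℂ) • toCC γ) (toCC γ) 0 := by
        have := ((Complex.ofRealCLM.hasDerivAt (x := (0 : ℝ))).smul_const (toCC γ)).const_add x
        simpa using this
      exact (h2.restrictScalars ℝ).comp_hasDerivAt (0 : ℝ) h3
    have h4 : (fun t : ℝ => contourInt p h W (x + (t : ℂ) • toCC γ)) =
        fun _ => contourInt p h W x := by
      funext t
      rw [← toCC_smul, contourInt_add_toCC]
    rw [h4] at h1
    exact h1.unique (hasDerivAt_const _ _)
  -- The derivative is complex linear and real vectors span ℂ²ⁿ over ℂ, so it vanishes altogether.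
  refine ContinuousLinearMap.ext fun v => ?_
  have hv : v = toCC ((WithLp.toLp 2 fun i => (v.1 i).re, WithLp.toLp 2 fun i => (v.2 i).re)) +
      Complex.I • toCC ((WithLp.toLp 2 fun i => (v.1 i).im,
        WithLp.toLp 2 fun i => (v.2 i).im)) := by
    ext i
    · simp [toCC, mul_comm Complex.I, Complex.re_add_im]
    · simp [toCC, mul_comm Complex.I, Complex.re_add_im]
  rw [hv, map_add, map_smul, hreal, hreal]
  simp

/-- The price of a contour depends only on its imaginary distance from the centre `W`; the real
offset disappears on integrating over all real translates. -/
theorem norm_contourInt_le (hM : ∀ w ∈ strip n a b, ‖p w‖ ≤ M) {h : ℝ} (hh : 0 < h)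
    (W : CConf n × CConf n) {w : CConf n × CConf n} (hw : w ∈ strip n a b) :
    ‖contourInt p h W w‖ ≤ M * Real.exp (imSq (w - W) / h) * (2 * Real.pi * h) ^ n := by
  have hint := integrable_exp_neg_mul_phaseSq (n := n) (c := 1 / (2 * h)) (by positivity)
  refine (norm_integral_le_of_norm_le
    (g := fun σ => M * Real.exp (imSq (w - W) / h) *
      Real.exp (-(1 / (2 * h)) * phaseSq (shiftRe (w - W) + σ))) ?_
    (Eventually.of_forall fun σ => ?_)).trans (le_of_eq ?_)
  · exact (hint.comp_add_left (shiftRe (w - W))).const_mul _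
  · rw [norm_mul, norm_exp_gaussQ_div, mul_assoc]
    gcongr
    exact hM _ (add_toCC_mem_strip hw σ)
  · rw [integral_const_mul, integral_add_left_eq_self
      (fun σ : Phase n => Real.exp (-(1 / (2 * h)) * phaseSq σ)), integral_exp_neg_mul_phaseSq hh]

/-! ### The amplitude and its expansion -/

/-- The constant normalising the Gaussian averages. -/
def gaussNorm (n : ℕ) : ℝ := Real.sqrt 2 ^ n / (2 * Real.pi) ^ n

theorem gaussNorm_pos (n : ℕ) : 0 < gaussNorm n := by unfold gaussNorm; positivity

/-- The Gaussian average of `p(w + tσ)`. -/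
def gaussAvg (p : CConf n × CConf n → ℂ) (t : ℝ) (w : CConf n × CConf n) : ℂ :=
  gaussNorm n * ∫ σ : Phase n, p (w + toCC (t • σ)) * Complex.exp (gaussQ (toCC σ))

theorem gaussQ_smul (t : ℂ) (u : CConf n × CConf n) : gaussQ (t • u) = t ^ 2 * gaussQ u := by
  have hp : ∀ x y : CConf n, pair (t • x) (t • y) = t ^ 2 * pair x y := by
    intro x y
    simp only [pair, Finset.mul_sum]
    refine Finset.sum_congr rfl fun i _ => ?_
    simp only [Pi.smul_apply, smul_eq_mul]
    ring
  simp only [gaussQ, Prod.smul_fst, Prod.smul_snd, hp]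
  ring

/-- Over the contour through the critical point, the integral is a Gaussian average. -/
theorem contourInt_self {h : ℝ} (hh : 0 < h) (W : CConf n × CConf n) :
    contourInt p h W W =
      (((2 * Real.pi * h) ^ n / Real.sqrt 2 ^ n : ℝ) : ℂ) * gaussAvg p (Real.sqrt h) W := by
  have h1 := Measure.integral_comp_smul (volume : Measure (Phase n))
    (fun σ => p (W + toCC σ) * Complex.exp (gaussQ (W - W + toCC σ) / h)) (Real.sqrt h)
  have hs : 0 < Real.sqrt h := Real.sqrt_pos.2 hh
  -- The real dimension is 2n, so rescaling by `√h` has Jacobian `hⁿ`.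
  have hdim : Module.finrank ℝ (Phase n) = n + n := by simp
  have hpow : Real.sqrt h ^ (n + n) = h ^ n := by
    rw [← two_mul, pow_mul, Real.sq_sqrt hh.le]
  have h2 : ∀ σ : Phase n, p (W + toCC (Real.sqrt h • σ)) *
      Complex.exp (gaussQ (W - W + toCC (Real.sqrt h • σ)) / h) =
      p (W + toCC (Real.sqrt h • σ)) * Complex.exp (gaussQ (toCC σ)) := by
    intro σ
    rw [sub_self, zero_add, toCC_smul, gaussQ_smul, ← Complex.ofReal_pow, Real.sq_sqrt hh.le,
      mul_div_cancel_left₀ _ (Complex.ofReal_ne_zero.2 hh.ne')]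
  simp_rw [h2] at h1
  rw [hdim, hpow, abs_of_pos (by positivity)] at h1
  unfold gaussAvg
  rw [h1, Complex.real_smul, contourInt, ← mul_assoc, ← mul_assoc, ← Complex.ofReal_mul,
    ← Complex.ofReal_mul]
  have h3 : (2 * Real.pi * h) ^ n / Real.sqrt 2 ^ n * gaussNorm n * (h ^ n)⁻¹ = 1 := by
    unfold gaussNorm
    rw [mul_pow (2 * Real.pi)]
    field_simp
  rw [h3, Complex.ofReal_one, one_mul]

theorem norm_exp_gaussQ_toCC (σ : Phase n) :
    ‖Complex.exp (gaussQ (toCC σ))‖ = Real.exp (-(1 / 2) * phaseSq σ) := by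
  rw [Complex.norm_exp, re_gaussQ_toCC]

theorem continuous_exp_gaussQ_toCC :
    Continuous fun σ : Phase n => Complex.exp (gaussQ (toCC σ)) :=
  Complex.continuous_exp.comp (differentiable_gaussQ.continuous.comp continuous_toCC)

theorem differentiableOn_gaussAvg (hp : DifferentiableOn ℂ p (strip n a b))
    (hM : ∀ w ∈ strip n a b, ‖p w‖ ≤ M) (t : ℝ) :
    DifferentiableOn ℂ (gaussAvg p t) (strip n a b) := by
  intro w hw
  refine DifferentiableAt.differentiableWithinAt (DifferentiableAt.const_mul ?_ _)
  obtain ⟨r, hr, hball⟩ := Metric.isOpen_iff.1 (isOpen_strip a b) w hw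
  refine differentiableAt_integral_of_holomorphic hr
    (g := fun σ => M * Real.exp (-(1 / 2) * phaseSq σ))
    (fun σ => ?_) (fun y hy => ?_) (fun σ y hy => ?_) ?_
  · exact DifferentiableOn.mul_const (hp.comp (by fun_prop)
      fun y hy => add_toCC_mem_strip (hball hy) _) _
  · exact (((continuous_comp_add_toCC hp (hball hy)).comp (continuous_const_smul t)).mul
      continuous_exp_gaussQ_toCC).aestronglyMeasurable
  · rw [norm_mul, norm_exp_gaussQ_toCC]
    gcongr
    exact hM _ (add_toCC_mem_strip (hball hy) _)
  · exact (integrable_exp_neg_mul_phaseSq (by norm_num)).const_mul _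

/-- The bound is uniform in `t` because real translates never leave the strip. The factor √2ⁿ is the
ratio of the integral of |e^Q| to the integral of e^Q. -/
theorem norm_gaussAvg_le (hM : ∀ w ∈ strip n a b, ‖p w‖ ≤ M) (t : ℝ)
    {w : CConf n × CConf n} (hw : w ∈ strip n a b) :
    ‖gaussAvg p t w‖ ≤ M * Real.sqrt 2 ^ n := by
  have h1 : ‖∫ σ : Phase n, p (w + toCC (t • σ)) * Complex.exp (gaussQ (toCC σ))‖ ≤
      M * (2 * Real.pi) ^ n := by
    refine (norm_integral_le_of_norm_le (g := fun σ => M * Real.exp (-(1 / 2) * phaseSq σ)) ?_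
      (Eventually.of_forall fun σ => ?_)).trans (le_of_eq ?_)
    · exact (integrable_exp_neg_mul_phaseSq (by norm_num)).const_mul _
    · rw [norm_mul, norm_exp_gaussQ_toCC]
      gcongr
      exact hM _ (add_toCC_mem_strip hw _)
    · have := integral_exp_neg_mul_phaseSq (n := n) one_pos
      simp only [mul_one] at this
      rw [integral_const_mul, this]
  rw [gaussAvg, norm_mul, Complex.norm_real, Real.norm_of_nonneg (gaussNorm_pos n).le]
  calc gaussNorm n * _ ≤ gaussNorm n * (M * (2 * Real.pi) ^ n) :=
        mul_le_mul_of_nonneg_left h1 (gaussNorm_pos n).le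
    _ = M * Real.sqrt 2 ^ n := by unfold gaussNorm; field_simp

/-- The `k`-th derivative of `p` at `w` in the real direction `σ`. -/
def dirDeriv (p : CConf n × CConf n → ℂ) (k : ℕ) (w : CConf n × CConf n) (σ : Phase n) : ℂ :=
  iteratedFDeriv ℂ k p w fun _ => toCC σ

/-- The coefficient of `tᵏ` in the expansion of the Gaussian average. -/
def gaussMoment (p : CConf n × CConf n → ℂ) (k : ℕ) (w : CConf n × CConf n) : ℂ :=
  gaussNorm n * ∫ σ : Phase n,
    (((k.factorial : ℝ)⁻¹ : ℝ) : ℂ) * dirDeriv p k w σ * Complex.exp (gaussQ (toCC σ))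

theorem continuous_dirDeriv (k : ℕ) (w : CConf n × CConf n) : Continuous (dirDeriv p k w) :=
  (iteratedFDeriv ℂ k p w).cont.comp (continuous_pi fun _ => continuous_toCC)

/-- Points of the smaller strip carry balls of one common radius inside the larger strip, so
Cauchy's inequalities are uniform. -/
theorem exists_norm_dirDeriv_le {a' b' : ℝ} (hp : DifferentiableOn ℂ p (strip n a b))
    (hM : ∀ w ∈ strip n a b, ‖p w‖ ≤ M) (ha : a' < a) (hb : b' < b) (k : ℕ) :
    ∃ C : ℝ, 0 ≤ C ∧ ∀ w ∈ strip n a' b', ∀ σ, ‖dirDeriv p k w σ‖ ≤ C * ‖σ‖ ^ k := by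
  obtain ⟨r, hr, hball⟩ := exists_ball_subset_strip (n := n) ha hb
  obtain ⟨C, hC, h⟩ := exists_norm_iteratedFDeriv_le_of_holomorphic (E := CConf n × CConf n)
    (F := ℂ) k hr
  refine ⟨C * |M|, by positivity, fun w hw σ => ?_⟩
  have h1 := h p w |M| (hp.mono (hball w hw))
    fun y hy => (hM y (hball w hw hy)).trans (le_abs_self M)
  refine ((iteratedFDeriv ℂ k p w).le_opNorm _).trans ?_
  rw [Finset.prod_const, Finset.card_univ, Fintype.card_fin]
  have := norm_toCC_le σ
  gcongr

theorem norm_moment_integrand_le {C : ℝ} {k : ℕ} {w : CConf n × CConf n} {σ : Phase n}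
    (h : ‖dirDeriv p k w σ‖ ≤ C * ‖σ‖ ^ k) :
    ‖(((k.factorial : ℝ)⁻¹ : ℝ) : ℂ) * dirDeriv p k w σ * Complex.exp (gaussQ (toCC σ))‖ ≤
      C * (‖σ‖ ^ k * Real.exp (-(1 / 2) * phaseSq σ)) := by
  rw [norm_mul, norm_mul, norm_exp_gaussQ_toCC, ← mul_assoc, Complex.norm_real,
    Real.norm_of_nonneg (by positivity)]
  refine mul_le_mul_of_nonneg_right ?_ (Real.exp_pos _).le
  have h1 : ((k.factorial : ℝ))⁻¹ ≤ 1 :=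
    inv_le_one_of_one_le₀ (by exact_mod_cast k.factorial_pos)
  calc ((k.factorial : ℝ))⁻¹ * ‖dirDeriv p k w σ‖ ≤ 1 * ‖dirDeriv p k w σ‖ := by gcongr
    _ ≤ C * ‖σ‖ ^ k := by rw [one_mul]; exact h

theorem continuous_moment_integrand (k : ℕ) (w : CConf n × CConf n) :
    Continuous fun σ : Phase n =>
      (((k.factorial : ℝ)⁻¹ : ℝ) : ℂ) * dirDeriv p k w σ * Complex.exp (gaussQ (toCC σ)) :=
  (continuous_const.mul (continuous_dirDeriv k w)).mul continuous_exp_gaussQ_toCC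

theorem integrable_moment_integrand {a' b' : ℝ} (hp : DifferentiableOn ℂ p (strip n a b))
    (hM : ∀ w ∈ strip n a b, ‖p w‖ ≤ M) (ha : a' < a) (hb : b' < b) (k : ℕ)
    {w : CConf n × CConf n} (hw : w ∈ strip n a' b') :
    Integrable fun σ : Phase n =>
      (((k.factorial : ℝ)⁻¹ : ℝ) : ℂ) * dirDeriv p k w σ * Complex.exp (gaussQ (toCC σ)) := by
  obtain ⟨C, _, h⟩ := exists_norm_dirDeriv_le hp hM ha hb k
  exact ((integrable_norm_pow_mul_exp k).const_mul C).mono'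
    (continuous_moment_integrand k w).aestronglyMeasurable
    (Eventually.of_forall fun σ => norm_moment_integrand_le (h w hw σ))

theorem differentiableOn_gaussMoment {a' b' : ℝ} (hp : DifferentiableOn ℂ p (strip n a b))
    (hM : ∀ w ∈ strip n a b, ‖p w‖ ≤ M) (ha : a' < a) (hb : b' < b) (k : ℕ) :
    DifferentiableOn ℂ (gaussMoment p k) (strip n a' b') := by
  intro w hw
  refine DifferentiableAt.differentiableWithinAt (DifferentiableAt.const_mul ?_ _)
  obtain ⟨r, hr, hball⟩ := Metric.isOpen_iff.1 (isOpen_strip a' b') w hw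
  obtain ⟨C, _, h⟩ := exists_norm_dirDeriv_le hp hM ha hb k
  refine differentiableAt_integral_of_holomorphic hr
    (g := fun σ => C * (‖σ‖ ^ k * Real.exp (-(1 / 2) * phaseSq σ)))
    (fun σ => ?_) (fun y _ => (continuous_moment_integrand k y).aestronglyMeasurable)
    (fun σ y hy => norm_moment_integrand_le (h y (hball hy) σ))
    ((integrable_norm_pow_mul_exp k).const_mul C)
  refine DifferentiableOn.mul_const (DifferentiableOn.const_mul (fun y hy => ?_) _) _
  have hy' : y ∈ strip n a b := strip_mono ha.le hb.le (hball hy)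
  have h1 : ContDiffAt ℂ ∞ p y := (contDiffOn_of_differentiableOn_several (isOpen_strip a b) hp
    ).contDiffAt ((isOpen_strip a b).mem_nhds hy')
  have h2 : DifferentiableAt ℂ (iteratedFDeriv ℂ k p) y :=
    h1.differentiableAt_iteratedFDeriv (by exact_mod_cast WithTop.coe_lt_top k)
  exact (h2.continuousMultilinear_apply_const _).differentiableWithinAt

theorem exists_norm_gaussMoment_le {a' b' : ℝ} (hp : DifferentiableOn ℂ p (strip n a b))
    (hM : ∀ w ∈ strip n a b, ‖p w‖ ≤ M) (ha : a' < a) (hb : b' < b) (k : ℕ) :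
    ∃ C : ℝ, ∀ w ∈ strip n a' b', ‖gaussMoment p k w‖ ≤ C := by
  obtain ⟨C, _, h⟩ := exists_norm_dirDeriv_le hp hM ha hb k
  refine ⟨gaussNorm n * ∫ σ : Phase n, C * (‖σ‖ ^ k * Real.exp (-(1 / 2) * phaseSq σ)),
    fun w hw => ?_⟩
  rw [gaussMoment, norm_mul, Complex.norm_real, Real.norm_of_nonneg (gaussNorm_pos n).le]
  refine mul_le_mul_of_nonneg_left ?_ (gaussNorm_pos n).le
  exact norm_integral_le_of_norm_le ((integrable_norm_pow_mul_exp k).const_mul C)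
    (Eventually.of_forall fun σ => norm_moment_integrand_le (h w hw σ))

/-- This is what `gaussNorm` is normalised for; it identifies the principal symbol. -/
theorem gaussMoment_zero (p : CConf n × CConf n → ℂ) (w : CConf n × CConf n) :
    gaussMoment p 0 w = p w := by
  simp only [gaussMoment, dirDeriv, iteratedFDeriv_zero_apply, Nat.factorial_zero, Nat.cast_one,
    inv_one, Complex.ofReal_one, one_mul]
  rw [integral_const_mul, integral_exp_gaussQ, mul_left_comm, ← Complex.ofReal_mul]
  have : gaussNorm n * ((2 * Real.pi) ^ n / Real.sqrt 2 ^ n) = 1 := by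
    unfold gaussNorm; field_simp
  rw [this, Complex.ofReal_one, mul_one]

/-- Under σ ↦ -σ the Gaussian is even and the derivative is odd. This removes the half-integer
powers of `h` from the expansion. -/
theorem gaussMoment_odd (p : CConf n × CConf n → ℂ) {k : ℕ} (hk : Odd k)
    (w : CConf n × CConf n) : gaussMoment p k w = 0 := by
  have hneg : ∀ σ : Phase n, dirDeriv p k w (-σ) = -dirDeriv p k w σ := by
    intro σ
    have := (iteratedFDeriv ℂ k p w).map_smul_univ (fun _ => (-1 : ℂ)) fun _ => toCC σ
    simp only [neg_smul, one_smul, Finset.prod_const, Finset.card_univ, Fintype.card_fin,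
      hk.neg_one_pow] at this
    simp only [dirDeriv, toCC_neg]
    exact this
  have hQ : ∀ σ : Phase n, gaussQ (toCC (-σ)) = gaussQ (toCC σ) := by
    intro σ
    have := gaussQ_smul (-1) (toCC σ)
    rw [toCC_neg]
    simpa using this
  have h := Measure.integral_comp_smul (volume : Measure (Phase n)) (fun σ : Phase n =>
    (((k.factorial : ℝ)⁻¹ : ℝ) : ℂ) * dirDeriv p k w σ * Complex.exp (gaussQ (toCC σ))) (-1)
  simp only [neg_smul, one_smul, abs_inv, abs_pow, abs_neg, abs_one, one_pow, inv_one, hneg, hQ, mul_neg, neg_mul, integral_neg] at h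
  rw [gaussMoment, self_eq_neg.1 h.symm, mul_zero]

theorem sum_range_two_mul {A : Type} [AddCommMonoid A] (f : ℕ → A) (N : ℕ) :
    ∑ k ∈ Finset.range (2 * N), f k =
      ∑ j ∈ Finset.range N, (f (2 * j) + f (2 * j + 1)) := by
  induction N with
  | zero => simp
  | succ N ih =>
    rw [Finset.sum_range_succ, ← ih, mul_add, mul_one, Finset.sum_range_succ,
      Finset.sum_range_succ, add_assoc]

/-- Taylor's formula in a real direction inside the strip, with uniform remainder. -/
theorem norm_sub_taylor_le {a' b' C : ℝ} {N : ℕ} (hp : DifferentiableOn ℂ p (strip n a b))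
    (ha : a' < a) (hb : b' < b)
    (hC : ∀ w ∈ strip n a' b', ∀ σ, ‖dirDeriv p (N + 1) w σ‖ ≤ C * ‖σ‖ ^ (N + 1))
    {w : CConf n × CConf n} (hw : w ∈ strip n a' b') (σ : Phase n) :
    ‖p (w + toCC σ) - ∑ k ∈ Finset.range (N + 1),
      (((k.factorial : ℝ)⁻¹ : ℝ) : ℂ) * dirDeriv p k w σ‖ ≤ C * ‖σ‖ ^ (N + 1) := by
  have hline : ∀ t : ℝ, w + t • toCC σ ∈ strip n a' b' := fun t => by
    have := add_toCC_mem_strip hw (t • σ)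
    rwa [toCC_smul, Complex.coe_smul] at this
  have hcd : ∀ y ∈ strip n a' b', ContDiffAt ℂ ∞ p y := fun y hy =>
    (contDiffOn_of_differentiableOn_several (isOpen_strip a b) hp).contDiffAt
      ((isOpen_strip a b).mem_nhds (strip_mono ha.le hb.le hy))
  have hreal : ∀ (k : ℕ), ∀ y ∈ strip n a' b',
      iteratedFDeriv ℝ k p y (fun _ => toCC σ) = dirDeriv p k y σ := by
    intro k y hy
    have hk : ContDiffAt ℂ k p y := (hcd y hy).of_le (by exact_mod_cast le_top)
    rw [← hk.restrictScalars_iteratedFDeriv (𝕜 := ℝ)]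
    rfl
  have h := map_add_eq_sum_add_integral_iteratedFDeriv (f := p) (x := w) (y := toCC σ) (n := N)
    fun t _ => ((hcd _ (hline t)).restrict_scalars ℝ).of_le (by exact_mod_cast le_top)
  rw [h]
  have hsum : ∑ k ∈ Finset.range (N + 1),
      ((k.factorial : ℝ))⁻¹ • (iteratedFDeriv ℝ k p w fun _ => toCC σ) =
      ∑ k ∈ Finset.range (N + 1), (((k.factorial : ℝ)⁻¹ : ℝ) : ℂ) * dirDeriv p k w σ :=
    Finset.sum_congr rfl fun k _ => by rw [hreal k w hw, Complex.real_smul]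
  rw [hsum, add_sub_cancel_left, norm_smul]
  have hint : ‖∫ t in (0 : ℝ)..1, (1 - t) ^ N •
      iteratedFDeriv ℝ (N + 1) p (w + t • toCC σ) fun _ => toCC σ‖ ≤
      C * ‖σ‖ ^ (N + 1) * |(1 : ℝ) - 0| := by
    refine intervalIntegral.norm_integral_le_of_norm_le_const fun t ht => ?_
    rw [Set.uIoc_of_le zero_le_one] at ht
    rw [hreal _ _ (hline t), norm_smul, norm_pow, Real.norm_of_nonneg (by linarith [ht.2])]
    have h1 : (1 - t) ^ N ≤ 1 := pow_le_one₀ (by linarith [ht.2]) (by linarith [ht.1])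
    calc (1 - t) ^ N * ‖dirDeriv p (N + 1) (w + t • toCC σ) σ‖
        ≤ 1 * ‖dirDeriv p (N + 1) (w + t • toCC σ) σ‖ := by gcongr
      _ ≤ C * ‖σ‖ ^ (N + 1) := by rw [one_mul]; exact hC _ (hline t) σ
  rw [sub_zero, abs_one, mul_one] at hint
  rw [Real.norm_of_nonneg (by positivity)]
  have h1 : ((N.factorial : ℝ))⁻¹ ≤ 1 :=
    inv_le_one_of_one_le₀ (by exact_mod_cast N.factorial_pos)
  calc ((N.factorial : ℝ))⁻¹ * _ ≤ 1 * _ := by gcongr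
    _ ≤ C * ‖σ‖ ^ (N + 1) := by rw [one_mul]; exact hint

theorem dirDeriv_smul (k : ℕ) (w : CConf n × CConf n) (t : ℝ) (σ : Phase n) :
    dirDeriv p k w (t • σ) = (t : ℂ) ^ k * dirDeriv p k w σ := by
  have := (iteratedFDeriv ℂ k p w).map_smul_univ (fun _ => (t : ℂ)) fun _ => toCC σ
  simp only [Finset.prod_const, Finset.card_univ, Fintype.card_fin] at this
  simp only [dirDeriv, toCC_smul]
  exact this

/-- The expansion of the Gaussian average in powers of `h = t²`. -/
theorem exists_norm_gaussAvg_sub_le {a' b' : ℝ} (hp : DifferentiableOn ℂ p (strip n a b))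
    (hM : ∀ w ∈ strip n a b, ‖p w‖ ≤ M) (ha : a' < a) (hb : b' < b) (N : ℕ) :
    ∃ C : ℝ, ∀ h : ℝ, 0 < h → ∀ w ∈ strip n a' b',
      ‖gaussAvg p (Real.sqrt h) w -
        ∑ j ∈ Finset.range N, (h : ℂ) ^ j * gaussMoment p (2 * j) w‖ ≤ C * h ^ N := by
  -- The Taylor formula used below has at least one term, so `N = 0` is the plain bound on the
  -- average.
  rcases Nat.eq_zero_or_pos N with rfl | hN
  · refine ⟨M * Real.sqrt 2 ^ n, fun h _ w hw => ?_⟩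
    simpa using norm_gaussAvg_le hM (Real.sqrt h) (strip_mono ha.le hb.le hw)
  -- Expanding to order 2N in `t = √h` leaves a remainder of size t^{2N} = h^N.
  obtain ⟨K, hK⟩ : ∃ K, 2 * N = K + 1 := ⟨2 * N - 1, by omega⟩
  obtain ⟨C, hC, hD⟩ := exists_norm_dirDeriv_le hp hM ha hb (2 * N)
  refine ⟨gaussNorm n * ∫ σ : Phase n, C * (‖σ‖ ^ (2 * N) * Real.exp (-(1 / 2) * phaseSq σ)),
    fun h hh w hw => ?_⟩
  set t := Real.sqrt h with ht
  have ht2 : t ^ 2 = h := Real.sq_sqrt hh.le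
  have hw' : w ∈ strip n a b := strip_mono ha.le hb.le hw
  have hsum : ∑ j ∈ Finset.range N, (h : ℂ) ^ j * gaussMoment p (2 * j) w =
      ∑ k ∈ Finset.range (2 * N), (t : ℂ) ^ k * gaussMoment p k w := by
    rw [sum_range_two_mul]
    refine Finset.sum_congr rfl fun j _ => ?_
    rw [gaussMoment_odd p (odd_two_mul_add_one j), mul_zero, add_zero, pow_mul,
      ← Complex.ofReal_pow t 2, ht2]
  have hI1 : Integrable fun σ : Phase n =>
      p (w + toCC (t • σ)) * Complex.exp (gaussQ (toCC σ)) := by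
    refine ((integrable_exp_neg_mul_phaseSq (n := n) (c := 1 / 2) (by norm_num)).const_mul
      M).mono' ?_ (Eventually.of_forall fun σ => ?_)
    · exact (((continuous_comp_add_toCC hp hw').comp (continuous_const_smul t)).mul
        continuous_exp_gaussQ_toCC).aestronglyMeasurable
    · rw [norm_mul, norm_exp_gaussQ_toCC]
      gcongr
      exact hM _ (add_toCC_mem_strip hw' _)
  have hI2 := fun k => integrable_moment_integrand (p := p) hp hM ha hb k hw
  have key : gaussAvg p t w - ∑ k ∈ Finset.range (2 * N), (t : ℂ) ^ k * gaussMoment p k w =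
      gaussNorm n * ∫ σ : Phase n, (p (w + toCC (t • σ)) - ∑ k ∈ Finset.range (2 * N),
        (((k.factorial : ℝ)⁻¹ : ℝ) : ℂ) * dirDeriv p k w (t • σ)) *
          Complex.exp (gaussQ (toCC σ)) := by
    have h1 : ∀ σ : Phase n, (p (w + toCC (t • σ)) - ∑ k ∈ Finset.range (2 * N),
        (((k.factorial : ℝ)⁻¹ : ℝ) : ℂ) * dirDeriv p k w (t • σ)) *
          Complex.exp (gaussQ (toCC σ)) =
        p (w + toCC (t • σ)) * Complex.exp (gaussQ (toCC σ)) -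
        ∑ k ∈ Finset.range (2 * N), (t : ℂ) ^ k *
          ((((k.factorial : ℝ)⁻¹ : ℝ) : ℂ) * dirDeriv p k w σ *
            Complex.exp (gaussQ (toCC σ))) := by
      intro σ
      rw [sub_mul, Finset.sum_mul]
      congr 1
      refine Finset.sum_congr rfl fun k _ => ?_
      rw [dirDeriv_smul]
      ring
    simp_rw [h1]
    rw [integral_sub hI1 (integrable_finsetSum _ fun k _ => (hI2 k).const_mul _),
      integral_finsetSum _ fun k _ => (hI2 k).const_mul _]
    simp only [integral_const_mul, gaussAvg, gaussMoment]
    rw [mul_sub, Finset.mul_sum]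
    congr 1
    refine Finset.sum_congr rfl fun k _ => ?_
    ring
  rw [hsum, key, norm_mul, Complex.norm_real, Real.norm_of_nonneg (gaussNorm_pos n).le, mul_assoc]
  refine mul_le_mul_of_nonneg_left ?_ (gaussNorm_pos n).le
  rw [← integral_mul_const]
  refine norm_integral_le_of_norm_le
    (((integrable_norm_pow_mul_exp (2 * N)).const_mul C).mul_const _)
    (Eventually.of_forall fun σ => ?_)
  rw [norm_mul, norm_exp_gaussQ_toCC]
  rw [hK] at hD
  have h2 := norm_sub_taylor_le hp ha hb hD hw (t • σ)
  rw [← hK, norm_smul, mul_pow, Real.norm_of_nonneg (Real.sqrt_nonneg h), pow_mul _ 2 N,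
    ← ht, ht2] at h2
  calc _ ≤ C * (h ^ N * ‖σ‖ ^ (2 * N)) * Real.exp (-(1 / 2) * phaseSq σ) := by gcongr
    _ = _ := by ring

end Strip

/-! ### Geometry of the deformation -/

/-- The first two derivatives of `G` are bounded by `ε`, and so is `G`. -/
structure SmallC2 (G : Phase n → ℝ) (ε : ℝ) : Prop where
  contDiff : ContDiff ℝ ∞ G
  abs_apply_le : ∀ α, |G α| ≤ ε
  norm_fderiv_le : ∀ α, ‖fderiv ℝ G α‖ ≤ ε
  norm_fderiv_fderiv_le : ∀ α, ‖fderiv ℝ (fderiv ℝ G) α‖ ≤ ε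

theorem SmallC2.of_iteratedFDeriv {G : Phase n → ℝ} {ε : ℝ} (hG : ContDiff ℝ ∞ G)
    (h : ∀ k : ℕ, k ≤ 2 → ∀ α, ‖iteratedFDeriv ℝ k G α‖ ≤ ε) : SmallC2 G ε where
  contDiff := hG
  abs_apply_le α := by simpa using h 0 (by norm_num) α
  norm_fderiv_le α := by
    have := h 1 (by norm_num) α
    rw [← zero_add 1, ← norm_iteratedFDeriv_fderiv] at this
    simpa using this
  norm_fderiv_fderiv_le α := by
    have := h 2 le_rfl α
    rw [show 2 = (0 + 1) + 1 from rfl, ← norm_iteratedFDeriv_fderiv,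
      ← norm_iteratedFDeriv_fderiv] at this
    simpa using this

theorem norm_coordX (i : Fin n) :
    ‖((EuclideanSpace.single i 1, 0) : Phase n)‖ = 1 := by simp [Prod.norm_def]

theorem norm_coordXi (i : Fin n) :
    ‖((0, EuclideanSpace.single i 1) : Phase n)‖ = 1 := by simp [Prod.norm_def]

theorem sum_grad_mul (G : Phase n → ℝ) (α γ : Phase n) :
    ∑ i, gradX G α i * γ.1 i + ∑ i, gradXi G α i * γ.2 i = fderiv ℝ G α γ := by
  have h1 : ∀ x : Conf n, x = ∑ i, x i • EuclideanSpace.single i (1 : ℝ) := by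
    intro x
    ext j
    simp [Finset.sum_apply, Pi.single_apply]
  have h2 : γ = ∑ i, γ.1 i • ((EuclideanSpace.single i 1, 0) : Phase n) +
      ∑ i, γ.2 i • ((0, EuclideanSpace.single i 1) : Phase n) := by
    refine Prod.ext ?_ ?_
    · simp only [Prod.fst_add, Prod.fst_sum, Prod.smul_fst, smul_zero, Finset.sum_const_zero,
        add_zero]
      exact h1 γ.1
    · simp only [Prod.snd_add, Prod.snd_sum, Prod.smul_snd, smul_zero, Finset.sum_const_zero,
        zero_add]
      exact h1 γ.2
  conv_rhs => rw [h2]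
  simp only [map_add, map_sum, map_smul, smul_eq_mul, gradX, gradXi]
  congr 1 <;> exact Finset.sum_congr rfl fun i _ => mul_comm _ _

namespace SmallC2

variable {G : Phase n → ℝ} {ε : ℝ}

theorem nonneg (h : SmallC2 G ε) : 0 ≤ ε := (abs_nonneg _).trans (h.abs_apply_le 0)

theorem differentiable (h : SmallC2 G ε) : Differentiable ℝ G :=
  h.contDiff.differentiable (by simp)

theorem differentiable_fderiv (h : SmallC2 G ε) : Differentiable ℝ (fderiv ℝ G) :=
  (contDiff_infty_iff_fderiv.1 h.contDiff).2.differentiable (by simp)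

theorem norm_fderiv_sub_le (h : SmallC2 G ε) (α β : Phase n) :
    ‖fderiv ℝ G α - fderiv ℝ G β‖ ≤ ε * ‖α - β‖ :=
  Convex.norm_image_sub_le_of_norm_fderiv_le (𝕜 := ℝ) (s := Set.univ)
    (fun x _ => h.differentiable_fderiv x) (fun x _ => h.norm_fderiv_fderiv_le x) convex_univ
    (Set.mem_univ β) (Set.mem_univ α)

theorem abs_gradX_le (h : SmallC2 G ε) (α : Phase n) (i : Fin n) : |gradX G α i| ≤ ε := by
  have := (fderiv ℝ G α).le_opNorm (EuclideanSpace.single i 1, 0)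
  rw [norm_coordX, mul_one] at this
  exact this.trans (h.norm_fderiv_le α)

theorem abs_gradXi_le (h : SmallC2 G ε) (α : Phase n) (i : Fin n) : |gradXi G α i| ≤ ε := by
  have := (fderiv ℝ G α).le_opNorm (0, EuclideanSpace.single i 1)
  rw [norm_coordXi, mul_one] at this
  exact this.trans (h.norm_fderiv_le α)

theorem abs_gradX_sub_le (h : SmallC2 G ε) (α β : Phase n) (i : Fin n) :
    |gradX G α i - gradX G β i| ≤ ε * ‖α - β‖ := by
  have := (fderiv ℝ G α - fderiv ℝ G β).le_opNorm (EuclideanSpace.single i 1, 0)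
  rw [norm_coordX, mul_one] at this
  exact this.trans (h.norm_fderiv_sub_le α β)

theorem abs_gradXi_sub_le (h : SmallC2 G ε) (α β : Phase n) (i : Fin n) :
    |gradXi G α i - gradXi G β i| ≤ ε * ‖α - β‖ := by
  have := (fderiv ℝ G α - fderiv ℝ G β).le_opNorm (0, EuclideanSpace.single i 1)
  rw [norm_coordXi, mul_one] at this
  exact this.trans (h.norm_fderiv_sub_le α β)

end SmallC2

/-- The error of the trapezoidal rule for `G α - G β`. -/
def trapezoid (G : Phase n → ℝ) (α β : Phase n) : ℝ :=
  G α - G β - 1 / 2 * (fderiv ℝ G α (α - β) + fderiv ℝ G β (α - β))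

/-- The first bound is the mean value inequality for `G`; the second comes from its second
derivative. Both are needed, for large and for small displacements, in order to apply `le_decay`. -/
theorem SmallC2.abs_trapezoid_le {G : Phase n → ℝ} {ε : ℝ} (h : SmallC2 G ε) (α β : Phase n) :
    |trapezoid G α β| ≤ 2 * ε * ‖α - β‖ ∧ |trapezoid G α β| ≤ 2 * ε * ‖α - β‖ ^ 2 := by
  have hA : ∀ γ, |fderiv ℝ G γ (α - β)| ≤ ε * ‖α - β‖ := fun γ =>
    ((fderiv ℝ G γ).le_opNorm _).trans (by gcongr; exact h.norm_fderiv_le γ)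
  constructor
  · have h1 : |G α - G β| ≤ ε * ‖α - β‖ :=
      Convex.norm_image_sub_le_of_norm_fderiv_le (𝕜 := ℝ) (s := Set.univ)
        (fun x _ => h.differentiable x) (fun x _ => h.norm_fderiv_le x) convex_univ
        (Set.mem_univ β) (Set.mem_univ α)
    have h2 := hA α
    have h3 := hA β
    rw [abs_le] at *
    unfold trapezoid
    constructor <;> linarith
  · have h1 : |G α - G β - fderiv ℝ G β (α - β)| ≤ ε * ‖α - β‖ * ‖α - β‖ := by
      refine Convex.norm_image_sub_le_of_norm_fderiv_le' (𝕜 := ℝ) (s := segment ℝ β α)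
        (fun x _ => h.differentiable x) (fun x hx => ?_) (convex_segment β α)
        (left_mem_segment ℝ β α) (right_mem_segment ℝ β α)
      refine (h.norm_fderiv_sub_le x β).trans ?_
      have := norm_sub_le_of_mem_segment hx
      have := h.nonneg
      gcongr
    have h2 : |fderiv ℝ G α (α - β) - fderiv ℝ G β (α - β)| ≤ ε * ‖α - β‖ * ‖α - β‖ :=
      ((fderiv ℝ G α - fderiv ℝ G β).le_opNorm (α - β)).trans
        (by gcongr; exact h.norm_fderiv_sub_le α β)
    have h3 : 0 ≤ ε * ‖α - β‖ * ‖α - β‖ := (abs_nonneg _).trans h1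
    have h4 : ε * ‖α - β‖ ^ 2 = ε * ‖α - β‖ * ‖α - β‖ := by ring
    rw [abs_le] at *
    unfold trapezoid
    constructor <;> linarith

/-! ### The rate of decay off the diagonal -/

/-- `|γ|² / (1 + |γ|²)^{1/2}`. -/
def decay (γ : Phase n) : ℝ := phaseSq γ / Real.sqrt (1 + phaseSq γ)

theorem bracket_eq (α β : Phase n) : bracket α β = Real.sqrt (1 + phaseSq (α - β)) := by
  simp only [bracket, phaseSq, Prod.fst_sub, Prod.snd_sub]
  congr 1; ring

theorem one_le_bracket (γ : Phase n) : 1 ≤ Real.sqrt (1 + phaseSq γ) :=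
  Real.one_le_sqrt.2 (by linarith [phaseSq_nonneg γ])

theorem decay_nonneg (γ : Phase n) : 0 ≤ decay γ :=
  div_nonneg (phaseSq_nonneg γ) (Real.sqrt_nonneg _)

theorem decay_le_phaseSq (γ : Phase n) : decay γ ≤ phaseSq γ :=
  div_le_self (phaseSq_nonneg γ) (one_le_bracket γ)

/-- The function `decay` behaves like |γ|² near 0 and like |γ| at infinity, so it dominates the
minimum of the two up to a factor 2; the proof splits at |γ|² = 1 in the Euclidean norm. Error terms
of this kind can thus be absorbed into the gain. -/
theorem le_decay {γ : Phase n} {c y : ℝ} (hc : 0 ≤ c) (h1 : y ≤ c * ‖γ‖)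
    (h2 : y ≤ c * ‖γ‖ ^ 2) : y ≤ 2 * c * decay γ := by
  have hs := phaseSq_nonneg γ
  have hB := one_le_bracket γ
  have hB2 : Real.sqrt (1 + phaseSq γ) ^ 2 = 1 + phaseSq γ := Real.sq_sqrt (by linarith)
  have hle := sq_norm_le_phaseSq γ
  have key : ‖γ‖ ≤ 2 * decay γ ∨ ‖γ‖ ^ 2 ≤ 2 * decay γ := by
    unfold decay
    rw [mul_div_assoc', le_div_iff₀ (by linarith), le_div_iff₀ (by linarith)]
    set B := Real.sqrt (1 + phaseSq γ)
    rcases le_total 1 (phaseSq γ) with h | h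
    · left
      refine abs_le_of_sq_le_sq' ?_ (by linarith) |>.2
      rw [mul_pow, hB2]
      nlinarith
    · right
      have hB' : B ≤ 2 := by nlinarith
      nlinarith [sq_nonneg ‖γ‖]
  rcases key with h | h
  · calc y ≤ c * ‖γ‖ := h1
      _ ≤ c * (2 * decay γ) := by gcongr
      _ = _ := by ring
  · calc y ≤ c * ‖γ‖ ^ 2 := h2
      _ ≤ c * (2 * decay γ) := by gcongr
      _ = _ := by ring

/-! ### The critical point -/

/-- The point `(X, Ξ)` with `X = (x + x' - G_x + G'_x)/2 + i(G_ξ + G'_ξ - γ₂)/2` and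
`Ξ = (ξ + ξ' - G_ξ + G'_ξ)/2 - i(G_x + G'_x - γ₁)/2`. For `γ = α - β` this is the critical point
of the phase of `T_Λ P S_Λ`. -/
def critPt (G : Phase n → ℝ) (α β γ : Phase n) : CConf n × CConf n :=
  (fun i => ((1 / 2 * (α.1 i + β.1 i + (gradX G β i - gradX G α i)) : ℝ) : ℂ) +
      ((1 / 2 * (gradXi G α i + gradXi G β i - γ.2 i) : ℝ) : ℂ) * Complex.I,
    fun i => ((1 / 2 * (α.2 i + β.2 i + (gradXi G β i - gradXi G α i)) : ℝ) : ℂ) +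
      ((-1 / 2 * (gradX G α i + gradX G β i - γ.1 i) : ℝ) : ℂ) * Complex.I)

theorem critPt_self (G : Phase n → ℝ) (α : Phase n) : critPt G α α 0 = (zL G α, zetaL G α) := by
  refine Prod.ext (funext fun i => ?_) (funext fun i => ?_)
  · simp only [critPt, zL, Prod.snd_zero, PiLp.zero_apply]
    push_cast; ring
  · simp only [critPt, zetaL, Prod.fst_zero, PiLp.zero_apply]
    push_cast; ring

/-- The displacement argument enters `critPt` only through imaginary parts, linearly and with factor
½. The result is the exponent paid for replacing one displacement by another. -/
theorem imSq_critPt_sub (G : Phase n → ℝ) (α β γ γ' : Phase n) :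
    imSq (critPt G α β γ - critPt G α β γ') = 1 / 4 * phaseSq (γ - γ') := by
  simp only [imSq, sq_imNorm, phaseSq, EuclideanSpace.real_norm_sq_eq]
  rw [mul_add, Finset.mul_sum, Finset.mul_sum, add_comm]
  congr 1
  · refine Finset.sum_congr rfl fun i _ => ?_
    simp [critPt]; ring
  · refine Finset.sum_congr rfl fun i _ => ?_
    simp [critPt]; ring

theorem norm_toLp_le {c : Fin n → ℝ} {ε : ℝ} (hε : 0 ≤ ε) (h : ∀ i, |c i| ≤ ε) :
    ‖(WithLp.toLp 2 c : Conf n)‖ ≤ n * ε := by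
  have h1 := imNorm_le (n := n) fun i => (c i : ℂ) * Complex.I
  rw [imNorm_eq] at h1
  simp only [Complex.mul_im, Complex.ofReal_re, Complex.I_im, mul_one, Complex.ofReal_im,
    Complex.I_re, mul_zero, add_zero] at h1
  refine h1.trans ?_
  gcongr
  refine (pi_norm_le_iff_of_nonneg hε).2 fun i => ?_
  simpa using h i

/-- The imaginary parts are half the displacement plus averages of gradients of `G`. The components
are interchanged: the momentum displacement moves the position off the real space, and conversely.
-/
theorem SmallC2.critPt_mem_strip {G : Phase n → ℝ} {ε a b : ℝ} (h : SmallC2 G ε)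
    (α β : Phase n) {γ : Phase n} (h2 : 1 / 2 * ‖γ.2‖ + n * ε < a)
    (h1 : 1 / 2 * ‖γ.1‖ + n * ε < b) : critPt G α β γ ∈ strip n a b := by
  constructor
  · refine lt_of_le_of_lt ?_ h2
    rw [imNorm_eq]
    have : (WithLp.toLp 2 fun i => ((critPt G α β γ).1 i).im : Conf n) =
        -((1 / 2 : ℝ) • γ.2) +
          WithLp.toLp 2 fun i => 1 / 2 * (gradXi G α i + gradXi G β i) := by
      ext i
      simp [critPt]; ring
    rw [this]
    refine (norm_add_le _ _).trans (add_le_add (le_of_eq ?_) (norm_toLp_le h.nonneg fun i => ?_))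
    · rw [norm_neg, norm_smul]; norm_num
    · have h3 := h.abs_gradXi_le α i
      have h4 := h.abs_gradXi_le β i
      rw [abs_le] at *
      constructor <;> linarith
  · refine lt_of_le_of_lt ?_ h1
    rw [imNorm_eq]
    have : (WithLp.toLp 2 fun i => ((critPt G α β γ).2 i).im : Conf n) =
        ((1 / 2 : ℝ) • γ.1) +
          WithLp.toLp 2 fun i => -1 / 2 * (gradX G α i + gradX G β i) := by
      ext i
      simp [critPt]; ring
    rw [this]
    refine (norm_add_le _ _).trans (add_le_add (le_of_eq ?_) (norm_toLp_le h.nonneg fun i => ?_))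
    · rw [norm_smul]; norm_num
    · have h3 := h.abs_gradX_le α i
      have h4 := h.abs_gradX_le β i
      rw [abs_le] at *
      constructor <;> linarith

/-- Completion of the square in the phase of `T_Λ P S_Λ`. -/
theorem phase_eq (G : Phase n → ℝ) (α β σ : Phase n) :
    Complex.I * (pair (zL G α - toC σ.1) (zetaL G α) +
        Complex.I / 2 * pair (zL G α - toC σ.1) (zL G α - toC σ.1)) +
      (Complex.I * pair (toC σ.1 - zL G β) (toC σ.2) -
        1 / 2 * pair (toC σ.2 - zetaL G β) (toC σ.2 - zetaL G β)) =
      Complex.I * psiL G α β + gaussQ (toCC σ - critPt G α β (α - β)) := by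
  simp only [psiL, gaussQ, pair, toCC, Finset.mul_sum, ← Finset.sum_add_distrib,
    ← Finset.sum_sub_distrib]
  refine Finset.sum_congr rfl fun i _ => ?_
  have hI := Complex.I_sq
  -- In complex form the centre is X = (z + z')/2 + (i/2)(ζ' - ζ) and Ξ = (ζ + ζ')/2 + (i/2)(z -
  -- z'), which makes the identity purely algebraic.
  have h1 : (critPt G α β (α - β)).1 i = 1 / 2 * (zL G α i + zL G β i) +
      Complex.I / 2 * (zetaL G β i - zetaL G α i) := by
    simp only [critPt, zL, zetaL, Prod.snd_sub, PiLp.sub_apply]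
    push_cast
    linear_combination (1 / 2 * ((gradX G β i : ℂ) - gradX G α i)) * hI
  have h2 : (critPt G α β (α - β)).2 i = 1 / 2 * (zetaL G α i + zetaL G β i) +
      Complex.I / 2 * (zL G α i - zL G β i) := by
    simp only [critPt, zL, zetaL, Prod.fst_sub, PiLp.sub_apply]
    push_cast
    linear_combination (1 / 2 * ((gradXi G β i : ℂ) - gradXi G α i)) * hI
  simp only [Prod.fst_sub, Prod.snd_sub, Pi.sub_apply, toC_apply, h1, h2]
  generalize zL G α i = z
  generalize zL G β i = z'
  generalize zetaL G α i = w
  generalize zetaL G β i = w'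
  generalize (σ.1 i : ℂ) = y
  generalize (σ.2 i : ℂ) = t
  generalize Complex.I = I at hI
  grind

/-- The term ξ·G_ξ in `H` cancels the part of Im ψ_Λ that is not a difference, leaving G(α) - G(β)
minus its trapezoidal approximation. The quadratic part of ψ_Λ gives ¼|α - β|² and, from the
imaginary parts of `z` and `ζ`, the negative gradient terms. -/
theorem im_psiL_add_weight (G : Phase n → ℝ) (α β : Phase n) :
    (psiL G α β).im + weightH G α - weightH G β =
      1 / 4 * phaseSq (α - β) -
        1 / 4 * (∑ i, (gradX G α i - gradX G β i) ^ 2 + ∑ i, (gradXi G α i - gradXi G β i) ^ 2) +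
        trapezoid G α β := by
  have h1 : psiL G α β = ∑ i, (1 / 2 * (zL G α i * zetaL G α i - zL G β i * zetaL G β i) +
      1 / 2 * (zL G α i * zetaL G β i - zL G β i * zetaL G α i) +
      Complex.I / 4 * ((zetaL G α i - zetaL G β i) * (zetaL G α i - zetaL G β i) +
        (zL G α i - zL G β i) * (zL G α i - zL G β i))) := by
    simp only [psiL, pair, Finset.sum_add_distrib, ← Finset.mul_sum, Finset.sum_sub_distrib,
      Pi.sub_apply]
  have h2 : trapezoid G α β = G α - G β - ∑ i, (1 / 2 * ((gradX G α i + gradX G β i) *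
      (α.1 i - β.1 i) + (gradXi G α i + gradXi G β i) * (α.2 i - β.2 i))) := by
    rw [trapezoid, ← sum_grad_mul, ← sum_grad_mul, ← Finset.mul_sum]
    simp only [← Finset.sum_add_distrib, Prod.fst_sub, Prod.snd_sub, PiLp.sub_apply]
    congr 2
    exact Finset.sum_congr rfl fun i _ => by ring
  rw [h1, h2, weightH, weightH, Complex.im_sum]
  simp only [phaseSq, EuclideanSpace.real_norm_sq_eq]
  have h3 : ∀ A B C E F X Y Z : ℝ, A - B + C = 1 / 4 * (E + F) - 1 / 4 * (X + Y) - Z →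
      A + (G α - B) - (G β - C) =
        1 / 4 * (E + F) - 1 / 4 * (X + Y) + (G α - G β - Z) := by
    intros; linarith
  refine h3 _ _ _ _ _ _ _ _ ?_
  · simp only [← Finset.sum_add_distrib, ← Finset.sum_sub_distrib, Finset.mul_sum]
    refine Finset.sum_congr rfl fun i _ => ?_
    simp [zL, zetaL]
    ring

/-- The basic lower bound for the weighted imaginary part of the phase. -/
theorem SmallC2.im_psiL_add_weight_ge {G : Phase n → ℝ} {ε : ℝ} (h : SmallC2 G ε) (hε : ε ≤ 1)
    (α β : Phase n) :
    1 / 4 * phaseSq (α - β) - (2 * n + 4) * ε * decay (α - β) ≤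
      (psiL G α β).im + weightH G α - weightH G β := by
  rw [im_psiL_add_weight]
  have hε0 := h.nonneg
  have hd := decay_nonneg (α - β)
  have hT : |trapezoid G α β| ≤ 2 * (2 * ε) * decay (α - β) :=
    le_decay (by positivity) (h.abs_trapezoid_le α β).1 (h.abs_trapezoid_le α β).2
  -- The linear bound uses the Lipschitz estimate for one factor and |c - c'| ≤ 2 for the other; the
  -- quadratic bound uses the Lipschitz estimate twice. Together the two gradients cost 2nε and the
  -- trapezoidal error 4ε times `decay`.
  have aux : ∀ c c' : Fin n → ℝ, (∀ i, |c i| ≤ ε) → (∀ i, |c' i| ≤ ε) →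
      (∀ i, |c i - c' i| ≤ ε * ‖α - β‖) →
      ∑ i, (c i - c' i) ^ 2 ≤ 2 * (n * (2 * ε)) * decay (α - β) := by
    intro c c' hc hc' hcc
    refine le_decay (by positivity) ?_ ?_
    · calc ∑ i, (c i - c' i) ^ 2 ≤ ∑ _i : Fin n, 2 * ε * ‖α - β‖ := by
            refine Finset.sum_le_sum fun i _ => ?_
            have h1 : |c i - c' i| ≤ 2 * 1 := by
              have := hc i; have := hc' i
              rw [abs_le] at *
              constructor <;> linarith
            rw [← sq_abs, sq]
            calc |c i - c' i| * |c i - c' i| ≤ (2 * 1) * (ε * ‖α - β‖) :=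
                  mul_le_mul h1 (hcc i) (abs_nonneg _) (by norm_num)
              _ = _ := by ring
        _ = _ := by simp; ring
    · calc ∑ i, (c i - c' i) ^ 2 ≤ ∑ _i : Fin n, 2 * ε * ‖α - β‖ ^ 2 := by
            refine Finset.sum_le_sum fun i _ => ?_
            rw [← sq_abs]
            calc |c i - c' i| ^ 2 ≤ (ε * ‖α - β‖) ^ 2 := by gcongr; exact hcc i
              _ = ε * (ε * ‖α - β‖ ^ 2) := by ring
              _ ≤ 2 * (ε * ‖α - β‖ ^ 2) := by gcongr; linarith
              _ = _ := by ring
        _ = _ := by simp; ring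
  have hX := aux _ _ (h.abs_gradX_le α) (h.abs_gradX_le β) (h.abs_gradX_sub_le α β)
  have hXi := aux _ _ (h.abs_gradXi_le α) (h.abs_gradXi_le β) (h.abs_gradXi_sub_le α β)
  have := (abs_le.1 hT).1
  nlinarith

/-- Shrinking the displacement all the way to 0 would cost exactly the gain ¼|α - β|². Keeping the
fraction θ = δ/⟨α - β⟩ leaves ¼(1 - (1 - θ)²)|α - β|² ≥ ¼θ|α - β|² = (δ/4) `decay`, of which half
absorbs the errors. This fraction also keeps the contour inside the strip. -/
theorem SmallC2.im_psiL_sub_imSq_ge {G : Phase n → ℝ} {ε δ : ℝ} (h : SmallC2 G ε) (hε : ε ≤ 1)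
    (hδ0 : 0 ≤ δ) (hδ : δ ≤ 1) (hεδ : (2 * n + 4) * ε ≤ δ / 8) (α β : Phase n) :
    δ / 8 * decay (α - β) ≤ (psiL G α β).im + weightH G α - weightH G β -
      imSq (critPt G α β ((δ / bracket α β) • (α - β)) - critPt G α β (α - β)) := by
  have h1 := h.im_psiL_add_weight_ge hε α β
  have hd := decay_nonneg (α - β)
  have hB : 1 ≤ bracket α β := by rw [bracket_eq]; exact one_le_bracket _
  set θ := δ / bracket α β with hθ
  have hθ0 : 0 ≤ θ := by positivity
  have hθ1 : θ ≤ 1 := (div_le_one (by linarith)).2 (hδ.trans hB)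
  have h2 : θ • (α - β) - (α - β) = (θ - 1) • (α - β) := by rw [sub_smul, one_smul]
  have h3 : phaseSq ((θ - 1) • (α - β)) = (1 - θ) ^ 2 * phaseSq (α - β) := by
    simp only [phaseSq, Prod.smul_fst, Prod.smul_snd, norm_smul, mul_pow, Real.norm_eq_abs,
      sq_abs]
    ring
  have h4 : θ * phaseSq (α - β) = δ * decay (α - β) := by
    rw [hθ, decay, bracket_eq]; ring
  rw [imSq_critPt_sub, h2, h3]
  have h5 : (2 * n + 4) * ε * decay (α - β) ≤ δ / 8 * decay (α - β) := by gcongr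
  have h6 : (1 - θ) ^ 2 * phaseSq (α - β) ≤ (1 - θ) * phaseSq (α - β) := by
    have := phaseSq_nonneg (α - β)
    gcongr
    nlinarith
  nlinarith

/-- The same lower bound without any contour shift, needed for the oscillatory factor multiplying
`a_P`. -/
theorem SmallC2.im_psiL_ge {G : Phase n → ℝ} {ε δ : ℝ} (h : SmallC2 G ε) (hε : ε ≤ 1)
    (hδ : δ ≤ 1) (hεδ : (2 * n + 4) * ε ≤ δ / 8) (α β : Phase n) :
    δ / 8 * decay (α - β) ≤ (psiL G α β).im + weightH G α - weightH G β := by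
  have h1 := h.im_psiL_add_weight_ge hε α β
  have hd := decay_nonneg (α - β)
  have h5 : (2 * n + 4) * ε * decay (α - β) ≤ δ / 8 * decay (α - β) := by gcongr
  have h6 := decay_le_phaseSq (α - β)
  nlinarith

/-- The momentum is unbounded, but the gradient vanishes outside the support of `G`, where |ξ| may
exceed `R`. -/
theorem SmallC2.abs_mul_gradXi_le {G : Phase n → ℝ} {ε R : ℝ} (h : SmallC2 G ε) (hR : 0 ≤ R)
    (hsupp : tsupport G ⊆ Metric.closedBall 0 R) (α : Phase n) (i : Fin n) :
    |α.2 i * gradXi G α i| ≤ R * ε := by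
  have hε := h.nonneg
  by_cases hα : α ∈ tsupport G
  · have h2 := hsupp hα
    rw [mem_closedBall_zero_iff] at h2
    have h3 : |α.2 i| ≤ R := (PiLp.norm_apply_le α.2 i).trans ((norm_snd_le α).trans h2)
    rw [abs_mul]
    exact mul_le_mul h3 (h.abs_gradXi_le α i) (abs_nonneg _) hR
  · have h2 : fderiv ℝ G α = 0 := by
      by_contra hne
      exact hα (support_fderiv_subset ℝ (f := G) hne)
    simp only [gradXi, h2, zero_apply, mul_zero, abs_zero]
    positivity

theorem SmallC2.abs_weightH_le {G : Phase n → ℝ} {ε R : ℝ} (h : SmallC2 G ε) (hR : 0 ≤ R)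
    (hsupp : tsupport G ⊆ Metric.closedBall 0 R) (α : Phase n) :
    |weightH G α| ≤ ε * (1 + n * R) := by
  have hε := h.nonneg
  have h1 := h.abs_mul_gradXi_le hR hsupp α
  have h2 : |∑ i, α.2 i * gradXi G α i| ≤ n * (R * ε) :=
    (Finset.abs_sum_le_sum_abs _ _).trans ((Finset.sum_le_sum fun i _ => h1 i).trans (by simp))
  have h3 := h.abs_apply_le α
  unfold weightH
  rw [abs_le] at *
  constructor <;> nlinarith

/-! ### The composition `T_Λ P S_Λ` as an integral operator -/

/-- The constant `c h^{-3n/4}`. -/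
def kerConst (n : ℕ) (h : ℝ) : ℝ := cFBI n * h ^ (-(3 * (n : ℝ)) / 4)

/-- The integral of `e^{(i/h)⟨x - y, ξ⟩}` against the kernel of `S_Λ`, over `y`. -/
def midKernel (h : ℝ) (z ζ : CConf n) (x ξ : Conf n) : ℂ :=
  ((kerConst n h * (2 * Real.pi * h) ^ ((n : ℝ) / 2) : ℝ) : ℂ) *
    Complex.exp ((Complex.I * pair (toC x - z) (toC ξ) -
      1 / 2 * pair (toC ξ - ζ) (toC ξ - ζ)) / h)

theorem kerConst_pos (n : ℕ) {h : ℝ} (hh : 0 < h) : 0 < kerConst n h := by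
  have := Real.pi_pos
  unfold kerConst cFBI
  positivity

theorem kernel_const_eq (n : ℕ) {h : ℝ} (hh : 0 < h) :
    kerConst n h * (kerConst n h * (2 * Real.pi * h) ^ ((n : ℝ) / 2)) * ((2 * Real.pi * h) ^ n)⁻¹ *
      (cZero n * (h ^ n)⁻¹)⁻¹ = Real.sqrt 2 ^ n / (2 * Real.pi * h) ^ n := by
  have h1 := Real.pi_pos
  unfold kerConst cFBI cZero
  -- Logarithms turn the identity between powers into a linear one in log 2, log π and log h.
  refine Real.log_injOn_pos (Set.mem_Ioi.2 (by positivity)) (Set.mem_Ioi.2 (by positivity)) ?_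
  rw [Real.log_div (by positivity) (by positivity)]
  repeat rw [Real.log_mul (by positivity) (by positivity)]
  simp only [Real.log_inv]
  repeat rw [Real.log_mul (by positivity) (by positivity)]
  simp only [Real.log_inv, Real.log_pow]
  rw [Real.log_rpow (by positivity), Real.log_rpow (by positivity), Real.log_rpow (by positivity),
    Real.log_rpow (by positivity), Real.log_sqrt (by positivity)]
  repeat rw [Real.log_mul (by positivity) (by positivity)]
  ring

theorem integral_cexp_conf {b : ℂ} (hb : 0 < b.re) (c : Fin n → ℂ) :
    ∫ y : Conf n, Complex.exp (-b * ∑ i, (y i : ℂ) ^ 2 + ∑ i, c i * y i) =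
      (Real.pi / b) ^ ((n : ℂ) / 2) * Complex.exp ((∑ i, c i ^ 2) / (4 * b)) := by
  rw [← (PiLp.volume_preserving_toLp (Fin n)).integral_comp
    (MeasurableEquiv.toLp 2 _).measurableEmbedding]
  have := GaussianFourier.integral_cexp_neg_mul_sum_add hb c
  rw [Fintype.card_fin] at this
  exact this

/-- The symbol does not depend on `y`, so this integral is an exact Gaussian and stationary phase is
not needed. -/
theorem integral_exp_mul_invKernel {h : ℝ} (hh : 0 < h) (z ζ : CConf n) (x ξ : Conf n) :
    ∫ y : Conf n, Complex.exp (Complex.I / h * pair (toC x - toC y) (toC ξ)) *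
      invKernel h z ζ y = midKernel h z ζ x ξ := by
  have hne : (h : ℂ) ≠ 0 := Complex.ofReal_ne_zero.2 hh.ne'
  have hI := Complex.I_sq
  set c : Fin n → ℂ := fun i => (z i + Complex.I * (ζ i - ξ i)) / h with hc
  set d : ℂ := (Complex.I * (∑ i, ((x i : ℂ) * ξ i - z i * ζ i)) - 1 / 2 * ∑ i, z i ^ 2) / h
    with hd
  have h1 : ∀ y : Conf n, Complex.exp (Complex.I / h * pair (toC x - toC y) (toC ξ)) *
      invKernel h z ζ y = ((kerConst n h : ℝ) : ℂ) * Complex.exp d *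
        Complex.exp (-(1 / (2 * h) : ℂ) * ∑ i, (y i : ℂ) ^ 2 + ∑ i, c i * y i) := by
    intro y
    rw [invKernel, ← kerConst, mul_left_comm, mul_assoc, ← Complex.exp_add, ← Complex.exp_add]
    congr 2
    simp only [hd, hc, pair, Finset.mul_sum, Finset.sum_div, ← Finset.sum_add_distrib,
      ← Finset.sum_sub_distrib, Pi.sub_apply, toC_apply]
    refine Finset.sum_congr rfl fun i _ => ?_
    field_simp
    linear_combination (z i - y i) ^ 2 * hI
  simp_rw [h1]
  have hre : 0 < (1 / (2 * h) : ℂ).re := by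
    have : (1 / (2 * h) : ℂ) = ((1 / (2 * h) : ℝ) : ℂ) := by push_cast; rfl
    rw [this, Complex.ofReal_re]; positivity
  rw [integral_const_mul, integral_cexp_conf hre, midKernel]
  have h2 : ((Real.pi : ℂ) / (1 / (2 * h))) ^ ((n : ℂ) / 2) =
      (((2 * Real.pi * h) ^ ((n : ℝ) / 2) : ℝ) : ℂ) := by
    rw [Complex.ofReal_cpow (by positivity)]
    congr 1
    · push_cast; field_simp
    · push_cast; rfl
  rw [h2, Complex.ofReal_mul]
  rw [show ∀ A B C D : ℂ, A * B * (C * D) = A * C * (B * D) by intros; ring, ← Complex.exp_add]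
  congr 2
  simp only [hd, hc, pair, Finset.mul_sum, Finset.sum_div, ← Finset.sum_add_distrib,
    ← Finset.sum_sub_distrib, Pi.sub_apply, toC_apply]
  refine Finset.sum_congr rfl fun i _ => ?_
  field_simp
  linear_combination 4 * (ζ i - ξ i) ^ 2 * hI

/-! ### Gaussian bounds on the kernels -/

/-- Uniform bounds on the displacement of `Λ`. -/
structure DisplacementBound (G : Phase n → ℝ) (B : ℝ) : Prop where
  sq_gradX : ∀ α, ∑ i, gradX G α i ^ 2 ≤ B
  sq_gradXi : ∀ α, ∑ i, gradXi G α i ^ 2 ≤ B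
  abs_pair : ∀ α : Phase n, |∑ i, α.2 i * gradXi G α i| ≤ B

theorem SmallC2.displacementBound {G : Phase n → ℝ} {ε R : ℝ} (h : SmallC2 G ε) (hR : 0 ≤ R)
    (hsupp : tsupport G ⊆ Metric.closedBall 0 R) :
    DisplacementBound G (n * ε ^ 2 + n * (R * ε)) := by
  have hε := h.nonneg
  have aux : ∀ c : Fin n → ℝ, (∀ i, |c i| ≤ ε) →
      ∑ i, c i ^ 2 ≤ n * ε ^ 2 + n * (R * ε) := by
    intro c hc
    calc ∑ i, c i ^ 2 ≤ ∑ _i : Fin n, ε ^ 2 := Finset.sum_le_sum fun i _ => by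
          rw [← sq_abs]; gcongr; exact hc i
      _ = n * ε ^ 2 := by simp
      _ ≤ _ := by have : 0 ≤ n * (R * ε) := by positivity
                  linarith
  refine ⟨fun α => aux _ (h.abs_gradX_le α), fun α => aux _ (h.abs_gradXi_le α), fun α => ?_⟩
  calc |∑ i, α.2 i * gradXi G α i| ≤ ∑ _i : Fin n, R * ε :=
        (Finset.abs_sum_le_sum_abs _ _).trans
          (Finset.sum_le_sum fun i _ => h.abs_mul_gradXi_le hR hsupp α i)
    _ = n * (R * ε) := by simp
    _ ≤ _ := by have : 0 ≤ n * ε ^ 2 := by positivity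
                linarith

section Bounds

variable {G : Phase n → ℝ} {B h : ℝ}

theorem norm_exp_div_le {w : ℂ} {t : ℝ} (hh : 0 < h) {C : ℝ} (hw : w.re ≤ C - 1 / 4 * t) :
    ‖Complex.exp (w / h)‖ ≤ Real.exp (C / h) * Real.exp (-(1 / (4 * h)) * t) := by
  rw [Complex.norm_exp, Complex.div_ofReal_re, ← Real.exp_add]
  refine Real.exp_le_exp.2 ?_
  have h1 : w.re / h ≤ (C - 1 / 4 * t) / h := div_le_div_of_nonneg_right hw hh.le
  refine h1.trans (le_of_eq ?_)
  field_simp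
  ring

/-- The linear term in y - x is absorbed by half of the Gaussian. The factor e^{3B/h} is harmless,
since this bound and the next two serve only to justify Fubini at fixed `h`. -/
theorem DisplacementBound.norm_invKernel_le (hB : DisplacementBound G B) (hh : 0 < h)
    (α : Phase n) (y : Conf n) : ‖invKernel h (zL G α) (zetaL G α) y‖ ≤
      kerConst n h * Real.exp (3 * B / h) * Real.exp (-(1 / (4 * h)) * ‖y - α.1‖ ^ 2) := by
  rw [invKernel, ← kerConst, norm_mul, Complex.norm_real,
    Real.norm_of_nonneg (kerConst_pos n hh).le, mul_assoc]
  refine mul_le_mul_of_nonneg_left ?_ (kerConst_pos n hh).le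
  rw [div_mul_eq_mul_div]
  refine norm_exp_div_le hh ?_
  have h1 : (Complex.I * (pair (toC y - zL G α) (zetaL G α) +
      Complex.I / 2 * pair (zL G α - toC y) (zL G α - toC y))).re =
      ∑ i, ((y i - α.1 i) * gradX G α i + α.2 i * gradXi G α i -
        1 / 2 * ((y i - α.1 i) ^ 2 - gradXi G α i ^ 2)) := by
    simp only [pair, Finset.mul_sum, ← Finset.sum_add_distrib, Complex.re_sum]
    refine Finset.sum_congr rfl fun i _ => ?_
    simp [zL, zetaL]
    ring
  have h2 : ∑ i, ((y i - α.1 i) * gradX G α i + α.2 i * gradXi G α i -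
        1 / 2 * ((y i - α.1 i) ^ 2 - gradXi G α i ^ 2)) ≤
      ∑ i, (gradX G α i ^ 2 + α.2 i * gradXi G α i + 1 / 2 * gradXi G α i ^ 2 -
        1 / 4 * (y i - α.1 i) ^ 2) := by
    refine Finset.sum_le_sum fun i _ => ?_
    nlinarith [sq_nonneg ((y i - α.1 i) - 2 * gradX G α i)]
  rw [h1]
  refine h2.trans ?_
  rw [Finset.sum_sub_distrib, Finset.sum_add_distrib, Finset.sum_add_distrib, ← Finset.mul_sum,
    ← Finset.mul_sum, EuclideanSpace.real_norm_sq_eq]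
  simp only [PiLp.sub_apply]
  linarith [hB.sq_gradX α, hB.sq_gradXi α, (abs_le.1 (hB.abs_pair α)).2,
    Finset.sum_nonneg fun (i : Fin n) (_ : i ∈ Finset.univ) => sq_nonneg (gradXi G α i)]

theorem DisplacementBound.norm_fbiKernel_le (hB : DisplacementBound G B) (hh : 0 < h)
    (α : Phase n) (y : Conf n) : ‖fbiKernel h (zL G α) (zetaL G α) y‖ ≤
      kerConst n h * Real.exp (3 * B / h) * Real.exp (-(1 / (4 * h)) * ‖y - α.1‖ ^ 2) := by
  rw [fbiKernel, ← kerConst, norm_mul, Complex.norm_real,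
    Real.norm_of_nonneg (kerConst_pos n hh).le, mul_assoc]
  refine mul_le_mul_of_nonneg_left ?_ (kerConst_pos n hh).le
  rw [div_mul_eq_mul_div]
  refine norm_exp_div_le hh ?_
  have h1 : (Complex.I * (pair (zL G α - toC y) (zetaL G α) +
      Complex.I / 2 * pair (zL G α - toC y) (zL G α - toC y))).re =
      ∑ i, (-(y i - α.1 i) * gradX G α i - α.2 i * gradXi G α i -
        1 / 2 * ((y i - α.1 i) ^ 2 - gradXi G α i ^ 2)) := by
    simp only [pair, Finset.mul_sum, ← Finset.sum_add_distrib, Complex.re_sum]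
    refine Finset.sum_congr rfl fun i _ => ?_
    simp [zL, zetaL]
    ring
  have h2 : ∑ i, (-(y i - α.1 i) * gradX G α i - α.2 i * gradXi G α i -
        1 / 2 * ((y i - α.1 i) ^ 2 - gradXi G α i ^ 2)) ≤
      ∑ i, (gradX G α i ^ 2 - α.2 i * gradXi G α i + 1 / 2 * gradXi G α i ^ 2 -
        1 / 4 * (y i - α.1 i) ^ 2) := by
    refine Finset.sum_le_sum fun i _ => ?_
    nlinarith [sq_nonneg ((y i - α.1 i) + 2 * gradX G α i)]
  rw [h1]
  refine h2.trans ?_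
  rw [Finset.sum_sub_distrib, Finset.sum_add_distrib, Finset.sum_sub_distrib, ← Finset.mul_sum,
    ← Finset.mul_sum, EuclideanSpace.real_norm_sq_eq]
  simp only [PiLp.sub_apply]
  linarith [hB.sq_gradX α, hB.sq_gradXi α, (abs_le.1 (hB.abs_pair α)).1,
    Finset.sum_nonneg fun (i : Fin n) (_ : i ∈ Finset.univ) => sq_nonneg (gradXi G α i)]

/-- Decay is in the momentum only; decay in `x` is supplied by the kernel of `T_Λ`. -/
theorem DisplacementBound.norm_midKernel_le (hB : DisplacementBound G B) (hh : 0 < h)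
    (α : Phase n) (x ξ : Conf n) : ‖midKernel h (zL G α) (zetaL G α) x ξ‖ ≤
      kerConst n h * (2 * Real.pi * h) ^ ((n : ℝ) / 2) * Real.exp (3 * B / h) *
        Real.exp (-(1 / (4 * h)) * ‖ξ - α.2‖ ^ 2) := by
  have hk : 0 ≤ kerConst n h * (2 * Real.pi * h) ^ ((n : ℝ) / 2) := by
    have := kerConst_pos n hh
    positivity
  rw [midKernel, norm_mul, Complex.norm_real, Real.norm_of_nonneg hk, mul_assoc (_ * _)]
  refine mul_le_mul_of_nonneg_left ?_ hk
  refine norm_exp_div_le hh ?_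
  have h1 : (Complex.I * pair (toC x - zL G α) (toC ξ) -
      1 / 2 * pair (toC ξ - zetaL G α) (toC ξ - zetaL G α)).re =
      ∑ i, (ξ i * gradXi G α i - 1 / 2 * ((ξ i - α.2 i) ^ 2 - gradX G α i ^ 2)) := by
    simp only [pair, Finset.mul_sum, ← Finset.sum_sub_distrib, Complex.re_sum]
    refine Finset.sum_congr rfl fun i _ => ?_
    simp [zL, zetaL]
    ring
  have h2 : ∑ i, (ξ i * gradXi G α i - 1 / 2 * ((ξ i - α.2 i) ^ 2 - gradX G α i ^ 2)) ≤
      ∑ i, (gradXi G α i ^ 2 + α.2 i * gradXi G α i + 1 / 2 * gradX G α i ^ 2 -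
        1 / 4 * (ξ i - α.2 i) ^ 2) := by
    refine Finset.sum_le_sum fun i _ => ?_
    nlinarith [sq_nonneg ((ξ i - α.2 i) - 2 * gradXi G α i)]
  rw [h1]
  refine h2.trans ?_
  rw [Finset.sum_sub_distrib, Finset.sum_add_distrib, Finset.sum_add_distrib, ← Finset.mul_sum,
    ← Finset.mul_sum, EuclideanSpace.real_norm_sq_eq]
  simp only [PiLp.sub_apply]
  linarith [hB.sq_gradX α, hB.sq_gradXi α, (abs_le.1 (hB.abs_pair α)).2,
    Finset.sum_nonneg fun (i : Fin n) (_ : i ∈ Finset.univ) => sq_nonneg (gradX G α i)]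

end Bounds

/-! ### Continuity of the kernels -/

theorem Continuous.pair {X : Type} [TopologicalSpace X] {f g : X → CConf n} (hf : Continuous f)
    (hg : Continuous g) : Continuous fun x => pair (f x) (g x) :=
  continuous_finsetSum _ fun i _ =>
    ((continuous_apply i).comp hf).mul ((continuous_apply i).comp hg)

section Continuity

variable {G : Phase n → ℝ} {X : Type} [TopologicalSpace X]

theorem continuous_gradX (hG : ContDiff ℝ ∞ G) (i : Fin n) : Continuous fun α => gradX G α i :=
  (hG.continuous_fderiv (by simp)).clm_apply continuous_const

theorem continuous_gradXi (hG : ContDiff ℝ ∞ G) (i : Fin n) : Continuous fun α => gradXi G α i :=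
  (hG.continuous_fderiv (by simp)).clm_apply continuous_const

theorem continuous_zL (hG : ContDiff ℝ ∞ G) : Continuous (zL G) := by
  refine continuous_pi fun i => ?_
  have := continuous_gradXi hG i
  unfold zL
  fun_prop

theorem continuous_zetaL (hG : ContDiff ℝ ∞ G) : Continuous (zetaL G) := by
  refine continuous_pi fun i => ?_
  have := continuous_gradX hG i
  unfold zetaL
  fun_prop

theorem continuous_invKernel (hG : ContDiff ℝ ∞ G) (h : ℝ) {f : X → Phase n} {y : X → Conf n}
    (hf : Continuous f) (hy : Continuous y) :
    Continuous fun q => invKernel h (zL G (f q)) (zetaL G (f q)) (y q) := by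
  have h1 := (continuous_zL hG).comp hf
  have h2 := (continuous_zetaL hG).comp hf
  have h3 := continuous_toC.comp hy
  have h4 := Continuous.pair (h3.sub h1) h2
  have h5 := Continuous.pair (h1.sub h3) (h1.sub h3)
  exact continuous_const.mul (Complex.continuous_exp.comp
    (continuous_const.mul (h4.add (continuous_const.mul h5))))

theorem continuous_fbiKernel (hG : ContDiff ℝ ∞ G) (h : ℝ) {f : X → Phase n} {y : X → Conf n}
    (hf : Continuous f) (hy : Continuous y) :
    Continuous fun q => fbiKernel h (zL G (f q)) (zetaL G (f q)) (y q) := by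
  have h1 := (continuous_zL hG).comp hf
  have h2 := (continuous_zetaL hG).comp hf
  have h3 := continuous_toC.comp hy
  have h4 := Continuous.pair (h1.sub h3) h2
  have h5 := Continuous.pair (h1.sub h3) (h1.sub h3)
  exact continuous_const.mul (Complex.continuous_exp.comp
    (continuous_const.mul (h4.add (continuous_const.mul h5))))

theorem continuous_midKernel (hG : ContDiff ℝ ∞ G) (h : ℝ) {f : X → Phase n} {x ξ : X → Conf n}
    (hf : Continuous f) (hx : Continuous x) (hξ : Continuous ξ) :
    Continuous fun q => midKernel h (zL G (f q)) (zetaL G (f q)) (x q) (ξ q) := by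
  have h1 := (continuous_zL hG).comp hf
  have h2 := (continuous_zetaL hG).comp hf
  have h3 := continuous_toC.comp hx
  have h6 := continuous_toC.comp hξ
  have h4 := Continuous.pair (h3.sub h1) h6
  have h5 := Continuous.pair (h6.sub h2) (h6.sub h2)
  exact continuous_const.mul (Complex.continuous_exp.comp
    (((continuous_const.mul h4).sub (continuous_const.mul h5)).div_const _))

end Continuity

/-! ### Absolute convergence -/

theorem integrable_mul_translate {A E : Type} [MeasurableSpace A] [TopologicalSpace A]
    [OpensMeasurableSpace A] [SecondCountableTopology A] [NormedAddCommGroup E] [NormedSpace ℝ E]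
    [MeasurableSpace E] [BorelSpace E] [SecondCountableTopology E]
    {μ : Measure A} {ν : Measure E} [SFinite μ] [SFinite ν]
    [ν.IsAddRightInvariant] {u : A → ℝ} {k : E → ℝ} {m : A → E} (hu : Integrable u μ)
    (hk : Integrable k ν) (hkc : Continuous k) (hm : Continuous m) :
    Integrable (fun q : A × E => u q.1 * k (q.2 - m q.1)) (μ.prod ν) := by
  have hmeas : AEStronglyMeasurable (fun q : A × E => u q.1 * k (q.2 - m q.1)) (μ.prod ν) :=
    hu.1.comp_fst.mul (Continuous.aestronglyMeasurable (by fun_prop))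
  refine (integrable_prod_iff hmeas).2 ⟨Eventually.of_forall fun a => ?_, ?_⟩
  · exact (hk.comp_sub_right (m a)).const_mul (u a)
  · simp only [norm_mul]
    simp_rw [integral_const_mul]
    have : ∀ a, ∫ y, ‖k (y - m a)‖ ∂ν = ∫ y, ‖k y‖ ∂ν := fun a =>
      integral_sub_right_eq_self (fun y => ‖k y‖) (m a)
    simp_rw [this]
    exact hu.norm.mul_const _

section Composition

variable {G : Phase n → ℝ} {a b M B h : ℝ} {p : CConf n × CConf n → ℂ} {U : Phase n → ℂ}

/-- The integral operator with the kernel of `S_Λ`, without the density of `Λ`. -/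
def invTransform (G : Phase n → ℝ) (h : ℝ) (U : Phase n → ℂ) (y : Conf n) : ℂ :=
  ∫ α, invKernel h (zL G α) (zetaL G α) y * U α

theorem integrable_invKernel_prod (hG : ContDiff ℝ ∞ G) (hB : DisplacementBound G B) (hh : 0 < h)
    (hU : Integrable U) (hUc : Continuous U) :
    Integrable (fun q : Phase n × Conf n => invKernel h (zL G q.1) (zetaL G q.1) q.2 * U q.1)
      ((volume : Measure (Phase n)).prod (volume : Measure (Conf n))) := by
  refine ((integrable_mul_translate (hU.norm.const_mul (kerConst n h * Real.exp (3 * B / h)))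
    (integrable_exp_neg_mul_sq_norm (n := n) (c := 1 / (4 * h)) (by positivity)) (by fun_prop)
    (continuous_fst (X := Conf n) (Y := Conf n)))).mono' ?_ (Eventually.of_forall fun q => ?_)
  · exact ((continuous_invKernel hG h continuous_fst continuous_snd).mul
      (hUc.comp continuous_fst)).aestronglyMeasurable
  · rw [norm_mul]
    refine (mul_le_mul_of_nonneg_right (hB.norm_invKernel_le hh q.1 q.2)
      (norm_nonneg _)).trans (le_of_eq ?_)
    ring

theorem integrable_invTransform (hG : ContDiff ℝ ∞ G) (hB : DisplacementBound G B) (hh : 0 < h)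
    (hU : Integrable U) (hUc : Continuous U) : Integrable (invTransform G h U) :=
  (integrable_invKernel_prod hG hB hh hU hUc).integral_prod_right

theorem integrable_invKernel (hG : ContDiff ℝ ∞ G) (hB : DisplacementBound G B) (hh : 0 < h)
    (hU : Integrable U) (hUc : Continuous U) (y : Conf n) :
    Integrable fun α => invKernel h (zL G α) (zetaL G α) y * U α := by
  refine (hU.norm.const_mul (kerConst n h * Real.exp (3 * B / h))).mono'
    ((continuous_invKernel hG h continuous_id continuous_const).mul hUc).aestronglyMeasurable
    (Eventually.of_forall fun α => ?_)
  rw [norm_mul]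
  refine mul_le_mul_of_nonneg_right ((hB.norm_invKernel_le hh α y).trans ?_) (norm_nonneg _)
  have := kerConst_pos n hh
  refine mul_le_of_le_one_right (by positivity) (Real.exp_le_one_iff.2 ?_)
  have : 0 ≤ 1 / (4 * h) * ‖y - α.1‖ ^ 2 := by positivity
  linarith

theorem norm_exp_pair (h : ℝ) (x y ξ : Conf n) :
    ‖Complex.exp (Complex.I / h * pair (toC x - toC y) (toC ξ))‖ = 1 := by
  have : Complex.I / h * pair (toC x - toC y) (toC ξ) =
      ((1 / h * ∑ i, (x i - y i) * ξ i : ℝ) : ℂ) * Complex.I := by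
    simp only [pair, Pi.sub_apply, toC_apply]
    push_cast
    ring
  rw [this, Complex.norm_exp_ofReal_mul_I]

theorem continuous_exp_pair (h : ℝ) (x ξ : Conf n) :
    Continuous fun y : Conf n => Complex.exp (Complex.I / h * pair (toC x - toC y) (toC ξ)) :=
  Complex.continuous_exp.comp (continuous_const.mul
    (Continuous.pair (continuous_const.sub continuous_toC) continuous_const))

theorem integrable_pseudoIntegrand (p : CConf n × CConf n → ℂ) {v : Conf n → ℂ}
    (hv : Integrable v) (x ξ : Conf n) :
    Integrable (pseudoIntegrand p h v x ξ) := by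
  unfold pseudoIntegrand
  simp_rw [mul_assoc]
  refine Integrable.const_mul ?_ _
  exact hv.bdd_mul (c := 1) (continuous_exp_pair h x ξ).aestronglyMeasurable
    (Eventually.of_forall fun y => (norm_exp_pair h x y ξ).le)

/-- The exponential of `P` is unimodular on real points, so the `y`- and `β`-integrals may be
exchanged and the former evaluated. -/
theorem integral_pseudoIntegrand (hG : ContDiff ℝ ∞ G) (hB : DisplacementBound G B) (hh : 0 < h)
    (hU : Integrable U) (hUc : Continuous U) (x ξ : Conf n) :
    ∫ y, pseudoIntegrand p h (invTransform G h U) x ξ y =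
      ∫ β, p (toC x, toC ξ) * midKernel h (zL G β) (zetaL G β) x ξ * U β := by
  have hint : Integrable (fun q : Conf n × Phase n =>
      Complex.exp (Complex.I / h * pair (toC x - toC q.1) (toC ξ)) *
        (invKernel h (zL G q.2) (zetaL G q.2) q.1 * U q.2))
      ((volume : Measure (Conf n)).prod (volume : Measure (Phase n))) := by
    refine (integrable_invKernel_prod hG hB hh hU hUc).swap.bdd_mul (c := 1)
      ((continuous_exp_pair h x ξ).comp continuous_fst).aestronglyMeasurable
      (Eventually.of_forall fun q => (norm_exp_pair h x q.1 ξ).le)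
  simp only [pseudoIntegrand, invTransform, mul_assoc]
  rw [integral_const_mul, integral_const_mul]
  congr 1
  simp_rw [← integral_const_mul]
  rw [integral_integral_swap hint]
  refine integral_congr_ae (Eventually.of_forall fun β => ?_)
  simp only
  simp_rw [← mul_assoc]
  rw [integral_mul_const, integral_exp_mul_invKernel hh]

theorem integrable_midKernel_prod (hp : DifferentiableOn ℂ p (strip n a b))
    (hM : ∀ w ∈ strip n a b, ‖p w‖ ≤ M) (ha : 0 < a) (hb : 0 < b) (hG : ContDiff ℝ ∞ G)
    (hB : DisplacementBound G B) (hh : 0 < h)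
    (hU : Integrable U) (hUc : Continuous U) (x : Conf n) :
    Integrable (fun q : Phase n × Conf n =>
      p (toC x, toC q.2) * midKernel h (zL G q.1) (zetaL G q.1) x q.2 * U q.1)
      ((volume : Measure (Phase n)).prod (volume : Measure (Conf n))) := by
  have hM0 : 0 ≤ M := (norm_nonneg _).trans (hM _ (toCC_mem_strip ha hb 0))
  refine ((integrable_mul_translate (hU.norm.const_mul
    (M * (kerConst n h * (2 * Real.pi * h) ^ ((n : ℝ) / 2) * Real.exp (3 * B / h))))
    (integrable_exp_neg_mul_sq_norm (n := n) (c := 1 / (4 * h)) (by positivity)) (by fun_prop)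
    (continuous_snd (X := Conf n) (Y := Conf n)))).mono' ?_ (Eventually.of_forall fun q => ?_)
  · have hpc : Continuous fun q : Phase n × Conf n => p (toC x, toC q.2) :=
      hp.continuousOn.comp_continuous (continuous_const.prodMk
        (continuous_toC.comp continuous_snd)) fun q => toCC_mem_strip ha hb (x, q.2)
    exact ((hpc.mul (continuous_midKernel hG h continuous_fst continuous_const
      continuous_snd)).mul (hUc.comp continuous_fst)).aestronglyMeasurable
  · rw [norm_mul, norm_mul]
    calc _ ≤ M * (kerConst n h * (2 * Real.pi * h) ^ ((n : ℝ) / 2) * Real.exp (3 * B / h) *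
          Real.exp (-(1 / (4 * h)) * ‖q.2 - q.1.2‖ ^ 2)) * ‖U q.1‖ := by
          gcongr
          · exact hM _ (toCC_mem_strip ha hb (x, q.2))
          · exact hB.norm_midKernel_le hh q.1 x q.2
      _ = _ := by ring

/-- The integrand of the kernel of `T_Λ P S_Λ`. -/
def tpsIntegrand (G : Phase n → ℝ) (p : CConf n × CConf n → ℂ) (h : ℝ) (α β σ : Phase n) : ℂ :=
  fbiKernel h (zL G α) (zetaL G α) σ.1 * ((((2 * Real.pi * h) ^ n)⁻¹ : ℝ) : ℂ) *
    (p (toC σ.1, toC σ.2) * midKernel h (zL G β) (zetaL G β) σ.1 σ.2)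

/-- The two Gaussian bounds combine into one in σ centred at (α.1, β.2), a continuous function of β;
`integrable_mul_translate` then applies. -/
theorem integrable_tpsIntegrand_prod (hp : DifferentiableOn ℂ p (strip n a b))
    (hM : ∀ w ∈ strip n a b, ‖p w‖ ≤ M) (ha : 0 < a) (hb : 0 < b) (hG : ContDiff ℝ ∞ G)
    (hB : DisplacementBound G B) (hh : 0 < h)
    (hU : Integrable U) (hUc : Continuous U) (α : Phase n) :
    Integrable (fun q : Phase n × Phase n => tpsIntegrand G p h α q.1 q.2 * U q.1)
      ((volume : Measure (Phase n)).prod (volume : Measure (Phase n))) := by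
  have hM0 : 0 ≤ M := (norm_nonneg _).trans (hM _ (toCC_mem_strip ha hb 0))
  have hk := kerConst_pos n hh
  refine ((integrable_mul_translate (hU.norm.const_mul
    (kerConst n h * Real.exp (3 * B / h) * ((2 * Real.pi * h) ^ n)⁻¹ *
      (M * (kerConst n h * (2 * Real.pi * h) ^ ((n : ℝ) / 2) * Real.exp (3 * B / h)))))
    (integrable_exp_neg_mul_phaseSq (n := n) (c := 1 / (4 * h)) (by positivity))
    (Real.continuous_exp.comp (continuous_const.mul continuous_phaseSq))
    (continuous_const.prodMk continuous_snd : Continuous fun β : Phase n => (α.1, β.2)))).mono'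
    ?_ (Eventually.of_forall fun q => ?_)
  · have hpc : Continuous fun q : Phase n × Phase n => p (toC q.2.1, toC q.2.2) :=
      hp.continuousOn.comp_continuous (continuous_toCC.comp continuous_snd)
        fun q => toCC_mem_strip ha hb q.2
    have h1 : Continuous fun q : Phase n × Phase n => fbiKernel h (zL G α) (zetaL G α) q.2.1 :=
      continuous_fbiKernel (f := fun _ : Phase n × Phase n => α) hG h continuous_const
        (continuous_fst.comp continuous_snd)
    exact (((h1.mul continuous_const).mul (hpc.mul (continuous_midKernel hG h continuous_fst
      (continuous_fst.comp continuous_snd) (continuous_snd.comp continuous_snd)))).mul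
      (hUc.comp continuous_fst)).aestronglyMeasurable
  · rw [tpsIntegrand, norm_mul, norm_mul, norm_mul, norm_mul, Complex.norm_real,
      Real.norm_of_nonneg (by positivity)]
    calc _ ≤ kerConst n h * Real.exp (3 * B / h) *
          Real.exp (-(1 / (4 * h)) * ‖q.2.1 - α.1‖ ^ 2) * ((2 * Real.pi * h) ^ n)⁻¹ *
          (M * (kerConst n h * (2 * Real.pi * h) ^ ((n : ℝ) / 2) * Real.exp (3 * B / h) *
          Real.exp (-(1 / (4 * h)) * ‖q.2.2 - q.1.2‖ ^ 2))) * ‖U q.1‖ := by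
          gcongr
          · exact hB.norm_fbiKernel_le hh α q.2.1
          · exact hM _ (toCC_mem_strip ha hb q.2)
          · exact hB.norm_midKernel_le hh q.1 q.2.1 q.2.2
      _ = _ := by
          simp only [phaseSq, Prod.fst_sub, Prod.snd_sub, mul_add, Real.exp_add]
          ring

theorem fbiKernel_mul_pseudo (hG : ContDiff ℝ ∞ G) (hB : DisplacementBound G B) (hh : 0 < h)
    (hU : Integrable U) (hUc : Continuous U) (α : Phase n) (x : Conf n) :
    fbiKernel h (zL G α) (zetaL G α) x * pseudo p h (invTransform G h U) x =
      ∫ ξ, ∫ β, tpsIntegrand G p h α β (x, ξ) * U β := by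
  rw [pseudo, ← mul_assoc, ← integral_const_mul]
  congr 1
  funext ξ
  rw [integral_pseudoIntegrand hG hB hh hU hUc, ← integral_const_mul]
  congr 1
  funext β
  simp only [tpsIntegrand]
  ring

/-- Fubini for the integrable function of (β, σ); in the application `U` is `bDens G` times `u`. -/
theorem composition_formula (hp : DifferentiableOn ℂ p (strip n a b))
    (hM : ∀ w ∈ strip n a b, ‖p w‖ ≤ M) (ha : 0 < a) (hb : 0 < b) (hG : ContDiff ℝ ∞ G)
    (hB : DisplacementBound G B) (hh : 0 < h)
    (hU : Integrable U) (hUc : Continuous U) :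
    (∀ x, Integrable fun ξ => ∫ y, pseudoIntegrand p h (invTransform G h U) x ξ y) ∧
    (∀ α, Integrable fun y =>
      fbiKernel h (zL G α) (zetaL G α) y * pseudo p h (invTransform G h U) y) ∧
    (∀ α, Integrable fun β => (∫ σ, tpsIntegrand G p h α β σ) * U β) ∧
    (∀ α, TL G h (pseudo p h (invTransform G h U)) α =
      ∫ β, (∫ σ, tpsIntegrand G p h α β σ) * U β) := by
  have hI := fun α => integrable_tpsIntegrand_prod hp hM ha hb hG hB hh hU hUc α
  have hE : ∀ α, Integrable (fun σ : Conf n × Conf n => ∫ β, tpsIntegrand G p h α β σ * U β)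
      ((volume : Measure (Conf n)).prod (volume : Measure (Conf n))) :=
    fun α => (hI α).integral_prod_right
  refine ⟨fun x => ?_, fun α => ?_, fun α => ?_, fun α => ?_⟩
  · simp_rw [integral_pseudoIntegrand hG hB hh hU hUc]
    exact (integrable_midKernel_prod hp hM ha hb hG hB hh hU hUc x).integral_prod_right
  · simp_rw [fbiKernel_mul_pseudo hG hB hh hU hUc]
    exact (hE α).integral_prod_left
  · simp_rw [← integral_mul_const]
    exact (hI α).integral_prod_left
  · rw [TL, fbi]
    simp_rw [fbiKernel_mul_pseudo hG hB hh hU hUc, ← integral_mul_const]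
    rw [← integral_prod _ (hE α)]
    exact (integral_integral_swap (hI α)).symm

end Composition

/-! ### The kernel as a contour integral. -/

/-- The kernel `K_P` of `T_Λ P S_Λ`, normalised by `c₀ h⁻ⁿ`. -/
def tpsKernel (G : Phase n → ℝ) (p : CConf n × CConf n → ℂ) (h : ℝ) (α β : Phase n) : ℂ :=
  (((cZero n * (h ^ n)⁻¹)⁻¹ : ℝ) : ℂ) * ∫ σ, tpsIntegrand G p h α β σ

/-- After completion of the square, α and β enter only through ψ_Λ and the centre of the Gaussian;
the original contour is the real one, `w = 0`. -/
theorem tpsKernel_eq (G : Phase n → ℝ) (p : CConf n × CConf n → ℂ) {h : ℝ} (hh : 0 < h)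
    (α β : Phase n) : tpsKernel G p h α β =
      ((Real.sqrt 2 ^ n / (2 * Real.pi * h) ^ n : ℝ) : ℂ) *
        Complex.exp (Complex.I / h * psiL G α β) *
          contourInt p h (critPt G α β (α - β)) 0 := by
  rw [← kernel_const_eq n hh, tpsKernel, contourInt, mul_assoc, ← integral_const_mul,
    ← integral_const_mul, ← integral_const_mul]
  congr 1
  funext σ
  have h1 := phase_eq G α β σ
  have h2 : Complex.exp (Complex.I / h * (pair (zL G α - toC σ.1) (zetaL G α) +
      Complex.I / 2 * pair (zL G α - toC σ.1) (zL G α - toC σ.1))) *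
      Complex.exp ((Complex.I * pair (toC σ.1 - zL G β) (toC σ.2) -
        1 / 2 * pair (toC σ.2 - zetaL G β) (toC σ.2 - zetaL G β)) / h) =
      Complex.exp (Complex.I / h * psiL G α β) *
        Complex.exp (gaussQ (0 - critPt G α β (α - β) + toCC σ) / h) := by
    rw [← Complex.exp_add, ← Complex.exp_add]
    congr 1
    rw [zero_sub, neg_add_eq_sub]
    linear_combination (1 / h : ℂ) * h1
  rw [tpsIntegrand, fbiKernel, ← kerConst, midKernel, zero_add]
  simp only [Complex.ofReal_mul, toCC]
  simp only [toCC] at h2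
  linear_combination ((((cZero n * (h ^ n)⁻¹)⁻¹ : ℝ) : ℂ) * kerConst n h *
    ((((2 * Real.pi * h) ^ n)⁻¹ : ℝ) : ℂ) * (kerConst n h *
      (((2 * Real.pi * h) ^ ((n : ℝ) / 2) : ℝ) : ℂ)) * p (toC σ.1, toC σ.2)) * h2

/-! ### Functions with bounded derivatives -/

/-- Smooth functions all of whose derivatives of positive order are bounded. -/
structure BddDeriv {E F : Type} [NormedAddCommGroup E] [NormedSpace ℝ E] [NormedAddCommGroup F]
    [NormedSpace ℝ F] (f : E → F) : Prop where
  contDiff : ContDiff ℝ ∞ f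
  bound : ∀ k : ℕ, 1 ≤ k → ∃ C : ℝ, ∀ x, ‖iteratedFDeriv ℝ k f x‖ ≤ C

namespace BddDeriv

variable {E F F' : Type} [NormedAddCommGroup E] [NormedSpace ℝ E] [NormedAddCommGroup F]
    [NormedSpace ℝ F] [NormedAddCommGroup F'] [NormedSpace ℝ F'] {f g : E → F}

theorem clm (L : E →L[ℝ] F) : BddDeriv fun x => L x where
  contDiff := L.contDiff
  bound k hk := by
    obtain ⟨k, rfl⟩ := Nat.exists_eq_add_of_le' hk
    refine ⟨‖L‖, fun x => ?_⟩
    rw [← norm_iteratedFDeriv_fderiv]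
    have : fderiv ℝ (fun x => L x) = fun _ => L := funext fun x => L.fderiv
    rw [this]
    rcases Nat.eq_zero_or_pos k with rfl | hk'
    · simp
    · rw [iteratedFDeriv_const_of_ne hk'.ne']
      simp

theorem of_hasCompactSupport (hf : ContDiff ℝ ∞ f) (hc : HasCompactSupport f) : BddDeriv f where
  contDiff := hf
  bound k _ := (hf.continuous_iteratedFDeriv (by exact_mod_cast le_top)
    ).bounded_above_of_compact_support (hc.iteratedFDeriv k)

theorem add (hf : BddDeriv f) (hg : BddDeriv g) : BddDeriv fun x => f x + g x where
  contDiff := hf.contDiff.add hg.contDiff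
  bound k hk := by
    obtain ⟨C, hC⟩ := hf.bound k hk
    obtain ⟨C', hC'⟩ := hg.bound k hk
    refine ⟨C + C', fun x => ?_⟩
    have h1 : ContDiff ℝ k f := hf.contDiff.of_le (by exact_mod_cast le_top)
    have h2 : ContDiff ℝ k g := hg.contDiff.of_le (by exact_mod_cast le_top)
    rw [show (fun x => f x + g x) = f + g from rfl, iteratedFDeriv_add h1 h2]
    exact (norm_add_le _ _).trans (add_le_add (hC x) (hC' x))

theorem clm_comp (L : F →L[ℝ] F') (hf : BddDeriv f) : BddDeriv fun x => L (f x) where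
  contDiff := L.contDiff.comp hf.contDiff
  bound k hk := by
    obtain ⟨C, hC⟩ := hf.bound k hk
    refine ⟨‖L‖ * C, fun x => ?_⟩
    have h1 := L.norm_iteratedFDeriv_comp_left (n := k) (x := x) (f := f) (N := ∞)
      hf.contDiff.contDiffAt (by exact_mod_cast le_top)
    exact h1.trans (mul_le_mul_of_nonneg_left (hC x) (norm_nonneg _))

theorem comp_clm {E' : Type} [NormedAddCommGroup E'] [NormedSpace ℝ E'] (hf : BddDeriv f)
    (L : E' →L[ℝ] E) : BddDeriv fun x => f (L x) where
  contDiff := hf.contDiff.comp L.contDiff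
  bound k hk := by
    obtain ⟨C, hC⟩ := hf.bound k hk
    refine ⟨C * ‖L‖ ^ k, fun x => ?_⟩
    have h1 := L.iteratedFDeriv_comp_right (f := f) (i := k) hf.contDiff x
      (by exact_mod_cast le_top)
    rw [show (fun x => f (L x)) = f ∘ L from rfl, h1]
    refine (ContinuousMultilinearMap.norm_compContinuousLinearMap_le _ _).trans ?_
    rw [Finset.prod_const, Finset.card_univ, Fintype.card_fin]
    exact mul_le_mul_of_nonneg_right (hC _) (by positivity)

theorem smul_const {f : E → ℝ} (hf : BddDeriv f) (v : F) : BddDeriv fun x => f x • v :=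
  hf.clm_comp (ContinuousLinearMap.toSpanSingleton ℝ v)

theorem const_mul {f : E → ℝ} (hf : BddDeriv f) (c : ℝ) : BddDeriv fun x => c * f x :=
  hf.clm_comp (c • ContinuousLinearMap.id ℝ ℝ)

theorem sub {f g : E → ℝ} (hf : BddDeriv f) (hg : BddDeriv g) :
    BddDeriv fun x => f x - g x := by
  have := hf.add (hg.const_mul (-1))
  refine cast ?_ this
  congr 1
  funext x
  ring

theorem sum {ι : Type} (s : Finset ι) {f : ι → E → F} (hf : ∀ i ∈ s, BddDeriv (f i)) :
    BddDeriv fun x => ∑ i ∈ s, f i x := by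
  classical
  induction s using Finset.induction_on with
  | empty => simpa using clm (0 : E →L[ℝ] F)
  | insert i s hi ih =>
    simp_rw [Finset.sum_insert hi]
    exact (hf i (Finset.mem_insert_self i s)).add
      (ih fun j hj => hf j (Finset.mem_insert_of_mem hj))

theorem exists_norm_fderiv_le (hf : BddDeriv f) : ∃ C : ℝ, ∀ x, ‖fderiv ℝ f x‖ ≤ C := by
  obtain ⟨C, hC⟩ := hf.bound 1 le_rfl
  refine ⟨C, fun x => ?_⟩
  have := hC x
  rw [← zero_add 1, ← norm_iteratedFDeriv_fderiv] at this
  simpa using this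

end BddDeriv

/-! ### Bounds on the parametrisation of `Λ` and its density. -/

section Density

variable {G : Phase n → ℝ}

theorem contDiff_gradX (hG : ContDiff ℝ ∞ G) (i : Fin n) :
    ContDiff ℝ ∞ fun α => gradX G α i :=
  (contDiff_infty_iff_fderiv.1 hG).2.clm_apply contDiff_const

theorem contDiff_gradXi (hG : ContDiff ℝ ∞ G) (i : Fin n) :
    ContDiff ℝ ∞ fun α => gradXi G α i :=
  (contDiff_infty_iff_fderiv.1 hG).2.clm_apply contDiff_const

theorem bddDeriv_gradX (hG : ContDiff ℝ ∞ G) (hc : HasCompactSupport G) (i : Fin n) :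
    BddDeriv fun α => gradX G α i :=
  .of_hasCompactSupport (contDiff_gradX hG i) (hc.fderiv_apply ℝ _)

theorem bddDeriv_gradXi (hG : ContDiff ℝ ∞ G) (hc : HasCompactSupport G) (i : Fin n) :
    BddDeriv fun α => gradXi G α i :=
  .of_hasCompactSupport (contDiff_gradXi hG i) (hc.fderiv_apply ℝ _)

/-- The position coordinates on the phase space. -/
def coordX (i : Fin n) : Phase n →L[ℝ] ℝ :=
  (EuclideanSpace.proj i : Conf n →L[ℝ] ℝ).comp (ContinuousLinearMap.fst ℝ (Conf n) (Conf n))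

/-- The momentum coordinates on the phase space. -/
def coordXi (i : Fin n) : Phase n →L[ℝ] ℝ :=
  (EuclideanSpace.proj i : Conf n →L[ℝ] ℝ).comp (ContinuousLinearMap.snd ℝ (Conf n) (Conf n))

theorem bddDeriv_paramL (hG : ContDiff ℝ ∞ G) (hc : HasCompactSupport G) (i : Fin n ⊕ Fin n) :
    BddDeriv fun β => (Sum.elim (zL G β) (zetaL G β) : Fin n ⊕ Fin n → ℂ) i := by
  rcases i with i | i
  · have h := ((BddDeriv.clm (coordX i)).smul_const (1 : ℂ)).add
      ((bddDeriv_gradXi hG hc i).smul_const Complex.I)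
    refine cast ?_ h
    congr 1
    funext β
    simp [zL, coordX, mul_comm]
  · have h := ((BddDeriv.clm (coordXi i)).smul_const (1 : ℂ)).add
      ((bddDeriv_gradX hG hc i).smul_const (-Complex.I))
    refine cast ?_ h
    congr 1
    funext β
    simp [zetaL, coordXi, mul_comm, sub_eq_add_neg]

theorem norm_coordVec (j : Fin n ⊕ Fin n) : ‖(coordVec j : Phase n)‖ = 1 := by
  rcases j with j | j
  · exact norm_coordX j
  · exact norm_coordXi j

theorem continuous_bDens (hG : ContDiff ℝ ∞ G) (hc : HasCompactSupport G) :
    Continuous (bDens G) := by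
  have hE : ∀ i j : Fin n ⊕ Fin n, Continuous fun α => fderiv ℝ
      (fun β => (Sum.elim (zL G β) (zetaL G β) : Fin n ⊕ Fin n → ℂ) i) α (coordVec j) :=
    fun i j => ((bddDeriv_paramL hG hc i).contDiff.continuous_fderiv (by simp)).clm_apply
      continuous_const
  have hJ : Continuous (jac G) := continuous_pi fun i => continuous_pi fun j => hE i j
  exact hJ.matrix_det

/-- The entries of the Jacobian are bounded because `G` has compact support. The constant may depend
on `G`, which is fixed before `C` is chosen. -/
theorem exists_norm_bDens_le (hG : ContDiff ℝ ∞ G) (hc : HasCompactSupport G) :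
    ∃ C : ℝ, ∀ α, ‖bDens G α‖ ≤ C := by
  choose C hC using fun i => (bddDeriv_paramL hG hc i).exists_norm_fderiv_le
  have hC0 : ∀ i, 0 ≤ C i := fun i => (norm_nonneg _).trans (hC i 0)
  refine ⟨_, fun α => Matrix.det_le (abv := NormedField.toAbsoluteValue ℂ) (A := jac G α)
    (x := ∑ i, C i) fun i j => ?_⟩
  change ‖fderiv ℝ (fun β => (Sum.elim (zL G β) (zetaL G β) : Fin n ⊕ Fin n → ℂ) i) α
    (coordVec j)‖ ≤ _
  refine (ContinuousLinearMap.le_opNorm _ _).trans ?_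
  rw [norm_coordVec, mul_one]
  exact (hC i α).trans (Finset.single_le_sum (fun j _ => hC0 j) (Finset.mem_univ i))

end Density

/-! ### Integrability of the off-diagonal decay -/

theorem norm_sub_one_le_decay (γ : Phase n) : ‖γ‖ - 1 ≤ decay γ := by
  have hB := one_le_bracket γ
  have hs := phaseSq_nonneg γ
  have hB2 : Real.sqrt (1 + phaseSq γ) ^ 2 = 1 + phaseSq γ := Real.sq_sqrt (by linarith)
  have h1 : ‖γ‖ ≤ Real.sqrt (1 + phaseSq γ) :=
    Real.le_sqrt_of_sq_le (by linarith [sq_norm_le_phaseSq γ])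
  unfold decay
  rw [le_div_iff₀ (by linarith)]
  nlinarith [norm_nonneg γ]

theorem continuous_decay : Continuous (decay : Phase n → ℝ) :=
  continuous_phaseSq.div (Real.continuous_sqrt.comp (continuous_const.add continuous_phaseSq))
    fun γ => (zero_lt_one.trans_le (one_le_bracket γ)).ne'

/-- Linear growth of `decay` makes the exponential smaller than a multiple of (1 + |γ|)^{-(2n+1)},
one power more than the dimension 2n. -/
theorem integrable_exp_neg_decay {κ : ℝ} (hκ : 0 < κ) :
    Integrable fun γ : Phase n => Real.exp (-κ * decay γ) := by
  have hr : (Module.finrank ℝ (Phase n) : ℝ) < ((2 * n + 1 : ℕ) : ℝ) := by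
    have : Module.finrank ℝ (Phase n) = n + n := by simp
    rw [this]; push_cast; linarith
  have h0 := (integrable_one_add_norm (μ := (volume : Measure (Phase n))) hr)
  refine (h0.const_mul ((2 * n + 1).factorial / κ ^ (2 * n + 1) * Real.exp (2 * κ))).mono'
    (Continuous.aestronglyMeasurable ?_) (Eventually.of_forall fun γ => ?_)
  · exact Real.continuous_exp.comp (continuous_const.mul continuous_decay)
  · rw [Real.norm_of_nonneg (Real.exp_pos _).le, Real.rpow_neg (by positivity), Real.rpow_natCast]
    have h1 := Real.pow_div_factorial_le_exp (κ * (1 + ‖γ‖)) (by positivity) (2 * n + 1)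
    -- The constant e^{2κ} comes from `decay γ` ≥ (1 + ‖γ‖) - 2.
    have h2 : Real.exp (-κ * decay γ) ≤ Real.exp (2 * κ) * (Real.exp (κ * (1 + ‖γ‖)))⁻¹ := by
      rw [← Real.exp_neg, ← Real.exp_add]
      refine Real.exp_le_exp.2 ?_
      nlinarith [norm_sub_one_le_decay γ]
    refine h2.trans ?_
    have h3 : (Real.exp (κ * (1 + ‖γ‖)))⁻¹ ≤
        ((κ * (1 + ‖γ‖)) ^ (2 * n + 1) / (2 * n + 1).factorial)⁻¹ :=
      inv_anti₀ (by positivity) h1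
    calc _ ≤ Real.exp (2 * κ) * ((κ * (1 + ‖γ‖)) ^ (2 * n + 1) / (2 * n + 1).factorial)⁻¹ := by
          gcongr
      _ = _ := by rw [mul_pow]; field_simp

/-- Scaling by `√h` multiplies the numerator by `h`, which cancels, and for `h ≤ 1` it only
decreases the denominator. -/
theorem decay_le_decay_smul_div {h : ℝ} (hh : 0 < h) (h1 : h ≤ 1) (γ : Phase n) :
    decay γ ≤ decay (Real.sqrt h • γ) / h := by
  have h2 : phaseSq (Real.sqrt h • γ) = h * phaseSq γ := by
    simp only [phaseSq, Prod.smul_fst, Prod.smul_snd, norm_smul, mul_pow,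
      Real.norm_of_nonneg (Real.sqrt_nonneg h), Real.sq_sqrt hh.le]
    ring
  have hs := phaseSq_nonneg γ
  unfold decay
  rw [h2, mul_div_assoc, mul_div_cancel_left₀ _ hh.ne']
  gcongr
  nlinarith

/-- The rescaled off-diagonal decay has bounded mass as `h → 0`. -/
theorem integral_exp_neg_decay_le {κ h : ℝ} (hκ : 0 < κ) (hh : 0 < h) (h1 : h ≤ 1) :
    Integrable (fun γ : Phase n => Real.exp (-(κ * decay γ / h))) ∧
    ∫ γ : Phase n, Real.exp (-(κ * decay γ / h)) ≤
      h ^ n * ∫ γ : Phase n, Real.exp (-κ * decay γ) := by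
  have hs : 0 < Real.sqrt h := Real.sqrt_pos.2 hh
  have hint := integrable_exp_neg_decay (n := n) hκ
  have hcont : Continuous fun γ : Phase n => Real.exp (-(κ * decay γ / h)) :=
    Real.continuous_exp.comp ((continuous_const.mul continuous_decay).div_const _).neg
  have hI : Integrable fun γ : Phase n => Real.exp (-(κ * decay γ / h)) := by
    refine hint.mono' hcont.aestronglyMeasurable (Eventually.of_forall fun γ => ?_)
    rw [Real.norm_of_nonneg (Real.exp_pos _).le]
    refine Real.exp_le_exp.2 ?_
    have h2 : κ * decay γ ≤ κ * decay γ / h :=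
      le_div_self (mul_nonneg hκ.le (decay_nonneg γ)) hh h1
    linarith
  refine ⟨hI, ?_⟩
  have h2 := Measure.integral_comp_smul (volume : Measure (Phase n))
    (fun γ => Real.exp (-(κ * decay γ / h))) (Real.sqrt h)
  have hdim : Module.finrank ℝ (Phase n) = n + n := by simp
  have hpow : Real.sqrt h ^ (n + n) = h ^ n := by
    rw [← two_mul, pow_mul, Real.sq_sqrt hh.le]
  rw [hdim, hpow, abs_of_pos (by positivity), smul_eq_mul] at h2
  have h3 : ∫ γ : Phase n, Real.exp (-(κ * decay γ / h)) =
      h ^ n * ∫ γ : Phase n, Real.exp (-(κ * decay (Real.sqrt h • γ) / h)) := by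
    rw [h2, ← mul_assoc, mul_inv_cancel₀ (by positivity), one_mul]
  rw [h3]
  refine mul_le_mul_of_nonneg_left (integral_mono (hI.comp_smul hs.ne') hint fun γ => ?_)
    (by positivity)
  refine Real.exp_le_exp.2 ?_
  have h4 := mul_le_mul_of_nonneg_left (decay_le_decay_smul_div hh h1 γ) hκ.le
  rw [← mul_div_assoc] at h4
  linarith

/-! ### Bounds on the kernel -/

section KernelBounds

variable {G : Phase n → ℝ} {p : CConf n × CConf n → ℂ} {a b M ε δ h : ℝ}

theorem norm_exp_psiL (h : ℝ) (α β : Phase n) :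
    ‖Complex.exp (Complex.I / h * psiL G α β)‖ = Real.exp (-(psiL G α β).im / h) := by
  rw [Complex.norm_exp, div_mul_eq_mul_div, Complex.div_ofReal_re]
  simp

/-- The contour may be moved to any `w` in the strip; the powers of `h` from the prefactor and from
the Gaussian cancel, so the constant is uniform in `h`. -/
theorem norm_tpsKernel_le (hp : DifferentiableOn ℂ p (strip n a b))
    (hM : ∀ w ∈ strip n a b, ‖p w‖ ≤ M) (ha : 0 < a) (hb : 0 < b) (hh : 0 < h)
    {w : CConf n × CConf n} (hw : w ∈ strip n a b) (α β : Phase n) :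
    ‖tpsKernel G p h α β‖ ≤ Real.sqrt 2 ^ n * M *
      Real.exp (-((psiL G α β).im - imSq (w - critPt G α β (α - β))) / h) := by
  have h0 : (0 : CConf n × CConf n) ∈ strip n a b := by
    constructor <;> simpa [imNorm]
  rw [tpsKernel_eq G p hh, norm_mul, norm_mul, norm_exp_psiL, Complex.norm_real,
    Real.norm_of_nonneg (by positivity), contourInt_eq hp hM hh _ h0 hw]
  calc _ ≤ Real.sqrt 2 ^ n / (2 * Real.pi * h) ^ n * Real.exp (-(psiL G α β).im / h) *
        (M * Real.exp (imSq (w - critPt G α β (α - β)) / h) * (2 * Real.pi * h) ^ n) := by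
        gcongr
        exact norm_contourInt_le hM hh _ hw
    _ = Real.sqrt 2 ^ n * M * (Real.exp (-(psiL G α β).im / h) *
        Real.exp (imSq (w - critPt G α β (α - β)) / h)) := by
        field_simp
    _ = _ := by
        rw [← Real.exp_add]
        congr 2
        ring

theorem norm_smul_div_bracket_le (hδ : 0 ≤ δ) (α β : Phase n) :
    ‖((δ / bracket α β) • (α - β)).1‖ ≤ δ ∧ ‖((δ / bracket α β) • (α - β)).2‖ ≤ δ := by
  have hB : 1 ≤ bracket α β := by rw [bracket_eq]; exact one_le_bracket _
  have h1 : ‖α - β‖ ≤ bracket α β := by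
    rw [bracket_eq]
    exact Real.le_sqrt_of_sq_le (by linarith [sq_norm_le_phaseSq (α - β)])
  have h2 : ‖(δ / bracket α β) • (α - β)‖ ≤ δ := by
    rw [norm_smul, Real.norm_of_nonneg (by positivity), div_mul_eq_mul_div,
      div_le_iff₀ (by linarith)]
    gcongr
  exact ⟨(norm_fst_le _).trans h2, (norm_snd_le _).trans h2⟩

/-- The weighted exponential decay of the kernel. -/
theorem SmallC2.norm_tpsKernel_le (hG : SmallC2 G ε) (hε : ε ≤ 1) (hδ0 : 0 ≤ δ) (hδ : δ ≤ 1)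
    (hεδ : (2 * n + 4) * ε ≤ δ / 8) (hδa : 1 / 2 * δ + n * ε < a) (hδb : 1 / 2 * δ + n * ε < b)
    (hp : DifferentiableOn ℂ p (strip n a b)) (hM : ∀ w ∈ strip n a b, ‖p w‖ ≤ M)
    (ha : 0 < a) (hb : 0 < b) (hh : 0 < h) (α β : Phase n) :
    ‖tpsKernel G p h α β‖ ≤ Real.sqrt 2 ^ n * M *
      (Real.exp (weightH G α / h) * Real.exp (-(weightH G β / h)) *
        Real.exp (-(δ / 8 * decay (α - β) / h))) := by
  have hM0 : 0 ≤ M := (norm_nonneg _).trans (hM _ (toCC_mem_strip ha hb 0))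
  obtain ⟨h1, h2⟩ := norm_smul_div_bracket_le hδ0 α β
  have hw := hG.critPt_mem_strip (a := a) (b := b) α β
    (γ := (δ / bracket α β) • (α - β)) (by linarith) (by linarith)
  refine (FBI.norm_tpsKernel_le hp hM ha hb hh hw α β).trans ?_
  rw [← Real.exp_add, ← Real.exp_add]
  refine mul_le_mul_of_nonneg_left (Real.exp_le_exp.2 ?_) (by positivity)
  have h3 := hG.im_psiL_sub_imSq_ge hε hδ0 hδ hεδ α β
  rw [← sub_eq_add_neg, ← sub_eq_add_neg, ← sub_div, ← sub_div]
  refine div_le_div_of_nonneg_right ?_ hh.le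
  linarith

theorem measurable_tpsKernel (hp : DifferentiableOn ℂ p (strip n a b)) (ha : 0 < a) (hb : 0 < b)
    (hG : ContDiff ℝ ∞ G) (h : ℝ) :
    StronglyMeasurable fun q : Phase n × Phase n => tpsKernel G p h q.1 q.2 := by
  refine StronglyMeasurable.const_mul ?_ _
  refine StronglyMeasurable.integral_prod_right
    (f := fun q : Phase n × Phase n => fun σ => tpsIntegrand G p h q.1 q.2 σ) ?_
  refine Continuous.stronglyMeasurable ?_
  have hpc : Continuous fun q : (Phase n × Phase n) × Phase n => p (toC q.2.1, toC q.2.2) :=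
    hp.continuousOn.comp_continuous (continuous_toCC.comp continuous_snd)
      fun q => toCC_mem_strip ha hb q.2
  exact ((continuous_fbiKernel hG h (continuous_fst.comp continuous_fst)
    (continuous_fst.comp continuous_snd)).mul continuous_const).mul (hpc.mul
      (continuous_midKernel hG h (continuous_snd.comp continuous_fst)
        (continuous_fst.comp continuous_snd) (continuous_snd.comp continuous_snd)))

end KernelBounds

/-! ### Bounded operators on `L²_Λ` -/

open scoped ENNReal

/-- Young's inequality `L¹ * L² ⊆ L²` for nonnegative functions on the phase space. -/
theorem lintegral_sq_convolution_le {φ F : Phase n → ℝ≥0∞} (hφ : Measurable φ)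
    (hF : Measurable F) :
    ∫⁻ α, (∫⁻ β, φ (α - β) * F β) ^ 2 ≤ (∫⁻ γ, φ γ) ^ 2 * ∫⁻ β, F β ^ 2 := by
  have hneg : (volume : Measure (Phase n)).IsNegInvariant :=
    Measure.IsAddHaarMeasure.isNegInvariant_of_regular _
  have hmeas : ∀ α : Phase n, Measurable fun β => φ (α - β) := fun α =>
    hφ.comp (measurable_const.sub measurable_id)
  have hmass : ∀ α : Phase n, ∫⁻ β, φ (α - β) = ∫⁻ γ, φ γ := fun α =>
    lintegral_sub_left_eq_self φ α
  have hmass' : ∀ β : Phase n, ∫⁻ α, φ (α - β) = ∫⁻ γ, φ γ := fun β =>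
    lintegral_sub_right_eq_self φ β
  -- Cauchy–Schwarz after splitting φ as √φ · √φ.
  have hCS : ∀ α, (∫⁻ β, φ (α - β) * F β) ^ 2 ≤
      (∫⁻ γ, φ γ) * ∫⁻ β, φ (α - β) * F β ^ 2 := by
    intro α
    have h2 : ∀ x : ℝ≥0∞, (x ^ (1 / 2 : ℝ)) ^ (2 : ℝ) = x := fun x => by
      rw [← ENNReal.rpow_mul]; norm_num
    have h3 : ∀ x : ℝ≥0∞, x ^ (1 / 2 : ℝ) * x ^ (1 / 2 : ℝ) = x := fun x => by
      rw [← ENNReal.rpow_add_of_nonneg _ _ (by norm_num) (by norm_num)]; norm_num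
    have h := ENNReal.lintegral_mul_le_Lp_mul_Lq (μ := (volume : Measure (Phase n)))
      (p := 2) (q := 2) (Real.HolderConjugate.two_two)
      (f := fun β => φ (α - β) ^ (1 / 2 : ℝ)) (g := fun β => φ (α - β) ^ (1 / 2 : ℝ) * F β)
      ((hmeas α).pow_const _).aemeasurable (((hmeas α).pow_const _).mul hF).aemeasurable
    simp only [Pi.mul_apply, ← mul_assoc, h3, ENNReal.mul_rpow_of_nonneg _ _ zero_le_two, h2,
      hmass] at h
    have h4 := pow_le_pow_left₀ zero_le h 2
    rw [mul_pow, ← ENNReal.rpow_natCast (_ ^ (1 / 2 : ℝ)), ← ENNReal.rpow_natCast (_ ^ (1 / 2 : ℝ))]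
      at h4
    simp only [Nat.cast_ofNat, h2] at h4
    simpa only [ENNReal.rpow_ofNat] using h4
  calc ∫⁻ α, (∫⁻ β, φ (α - β) * F β) ^ 2
      ≤ ∫⁻ α, (∫⁻ γ, φ γ) * ∫⁻ β, φ (α - β) * F β ^ 2 := lintegral_mono hCS
    _ = (∫⁻ γ, φ γ) * ∫⁻ α, ∫⁻ β, φ (α - β) * F β ^ 2 := by
        rw [lintegral_const_mul]
        exact Measurable.lintegral_prod_right' (f := fun q : Phase n × Phase n =>
          φ (q.1 - q.2) * F q.2 ^ 2) ((hφ.comp (measurable_fst.sub measurable_snd)).mul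
          ((hF.comp measurable_snd).pow_const 2))
    _ = (∫⁻ γ, φ γ) * ∫⁻ β, ∫⁻ α, φ (α - β) * F β ^ 2 := by
        rw [lintegral_lintegral_swap]
        exact ((hφ.comp (measurable_fst.sub measurable_snd)).mul
          ((hF.comp measurable_snd).pow_const 2)).aemeasurable
    _ = (∫⁻ γ, φ γ) * ∫⁻ β, (∫⁻ γ, φ γ) * F β ^ 2 := by
        congr 2
        funext β
        have hβ : Measurable fun α => φ (α - β) := hφ.comp (measurable_id.sub measurable_const)
        rw [lintegral_mul_const _ hβ, hmass']
    _ = _ := by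
        rw [lintegral_const_mul _ (hF.pow_const 2)]
        ring

section Operator

variable {G : Phase n → ℝ} {h : ℝ}

/-- The weight `e^{-H/h}`. -/
def weightFn (G : Phase n → ℝ) (h : ℝ) (α : Phase n) : ℝ≥0∞ :=
  ENNReal.ofReal (Real.exp (-(weightH G α / h)))

theorem continuous_weightH (hG : ContDiff ℝ ∞ G) : Continuous (weightH G) := by
  unfold weightH
  refine hG.continuous.sub (continuous_finsetSum _ fun i _ => ?_)
  have := continuous_gradXi hG i
  fun_prop

theorem measurable_weightFn (hG : ContDiff ℝ ∞ G) (h : ℝ) : Measurable (weightFn G h) :=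
  (Real.continuous_exp.comp ((continuous_weightH hG).div_const h).neg).measurable.ennreal_ofReal

theorem measurable_density (hG : ContDiff ℝ ∞ G) (h : ℝ) :
    Measurable fun α => ENNReal.ofReal (Real.exp (-2 * weightH G α / h)) :=
  (Real.continuous_exp.comp
    ((continuous_const.mul (continuous_weightH hG)).div_const h)).measurable.ennreal_ofReal

theorem measL_absolutelyContinuous (G : Phase n → ℝ) (h : ℝ) : measL G h ≪ volume :=
  withDensity_absolutelyContinuous _ _

theorem absolutelyContinuous_measL (hG : ContDiff ℝ ∞ G) (h : ℝ) : volume ≪ measL G h :=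
  withDensity_absolutelyContinuous' (measurable_density hG h).aemeasurable
    (Eventually.of_forall fun α => by simpa using Real.exp_pos _)

theorem eLpNorm_measL_sq (hG : ContDiff ℝ ∞ G) (f : Phase n → ℂ) :
    eLpNorm f 2 (measL G h) ^ 2 = ∫⁻ α, (weightFn G h α * ‖f α‖ₑ) ^ 2 := by
  have h1 : eLpNorm f 2 (measL G h) ^ 2 = ∫⁻ α, ‖f α‖ₑ ^ 2 ∂(measL G h) := by
    have := eLpNorm_nnreal_pow_eq_lintegral (f := f) (μ := measL G h) (p := 2) two_ne_zero
    simpa using this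
  rw [h1, measL, lintegral_withDensity_eq_lintegral_mul_non_measurable _
    (measurable_density hG h) (Eventually.of_forall fun _ => ENNReal.ofReal_lt_top)]
  refine lintegral_congr fun α => ?_
  rw [Pi.mul_apply, mul_pow, weightFn, ← ENNReal.ofReal_pow (Real.exp_pos _).le, ← Real.exp_nat_mul]
  congr 3
  push_cast; ring

variable {k : Phase n → Phase n → ℂ} {φ : Phase n → ℝ≥0∞} {C : ℝ}

theorem weight_mul_lintegral_le
    (hk : ∀ α β, weightFn G h α * ‖k α β‖ₑ ≤ φ (α - β) * weightFn G h β)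
    (f : Phase n → ℂ) (α : Phase n) :
    weightFn G h α * ∫⁻ β, ‖k α β * f β‖ₑ ≤ ∫⁻ β, φ (α - β) * (weightFn G h β * ‖f β‖ₑ) := by
  rw [← lintegral_const_mul' (weightFn G h α) _ ENNReal.ofReal_ne_top]
  refine lintegral_mono fun β => ?_
  rw [enorm_mul, ← mul_assoc, ← mul_assoc]
  exact mul_le_mul_left (hk α β) _

theorem lintegral_sq_weight_le (hG : ContDiff ℝ ∞ G) (hφ : Measurable φ)
    (hk : ∀ α β, weightFn G h α * ‖k α β‖ₑ ≤ φ (α - β) * weightFn G h β)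
    {f : Phase n → ℂ} (hf : Measurable f) :
    ∫⁻ α, (weightFn G h α * ∫⁻ β, ‖k α β * f β‖ₑ) ^ 2 ≤
      (∫⁻ γ, φ γ) ^ 2 * eLpNorm f 2 (measL G h) ^ 2 := by
  rw [eLpNorm_measL_sq hG]
  refine le_trans (lintegral_mono fun α => ?_)
    (lintegral_sq_convolution_le hφ ((measurable_weightFn hG h).mul hf.enorm))
  exact pow_le_pow_left₀ zero_le (weight_mul_lintegral_le hk f α) 2

/-- The weighted integral of absolute values is square integrable, hence finite almost everywhere,
and the weight never vanishes. -/
theorem ae_integrable_kernel (hG : ContDiff ℝ ∞ G) (hφ : Measurable φ) (hφC : ∫⁻ γ, φ γ ≠ ⊤)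
    (hkm : StronglyMeasurable fun q : Phase n × Phase n => k q.1 q.2)
    (hk : ∀ α β, weightFn G h α * ‖k α β‖ₑ ≤ φ (α - β) * weightFn G h β)
    {f : Phase n → ℂ} (hf : StronglyMeasurable f) (hf2 : eLpNorm f 2 (measL G h) ≠ ⊤) :
    ∀ᵐ α, Integrable fun β => k α β * f β := by
  have hkf : StronglyMeasurable fun q : Phase n × Phase n => k q.1 q.2 * f q.2 :=
    hkm.mul (hf.comp_measurable measurable_snd)
  have hm : Measurable fun α => (weightFn G h α * ∫⁻ β, ‖k α β * f β‖ₑ) ^ 2 :=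
    ((measurable_weightFn hG h).mul
      (hkf.enorm.lintegral_prod_right' (f := fun q => ‖k q.1 q.2 * f q.2‖ₑ))).pow_const 2
  have hfin : ∫⁻ α, (weightFn G h α * ∫⁻ β, ‖k α β * f β‖ₑ) ^ 2 ≠ ⊤ := by
    refine ne_top_of_le_ne_top ?_ (lintegral_sq_weight_le hG hφ hk hf.measurable)
    exact ENNReal.mul_ne_top (ENNReal.pow_ne_top hφC) (ENNReal.pow_ne_top hf2)
  filter_upwards [ae_lt_top hm hfin] with α hα
  refine ⟨(hkf.comp_measurable measurable_prodMk_left).aestronglyMeasurable, ?_⟩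
  rw [hasFiniteIntegral_iff_enorm]
  by_contra hcon
  rw [not_lt, top_le_iff] at hcon
  have hw : weightFn G h α ≠ 0 := by simpa [weightFn] using Real.exp_pos _
  rw [hcon, ENNReal.mul_top hw] at hα
  simp at hα

theorem eLpNorm_kernel_le (hG : ContDiff ℝ ∞ G) (hφ : Measurable φ)
    (hk : ∀ α β, weightFn G h α * ‖k α β‖ₑ ≤ φ (α - β) * weightFn G h β)
    {f : Phase n → ℂ} (hf : Measurable f) :
    eLpNorm (fun α => ∫ β, k α β * f β) 2 (measL G h) ≤
      (∫⁻ γ, φ γ) * eLpNorm f 2 (measL G h) := by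
  rw [← ENNReal.pow_le_pow_left_iff two_ne_zero, mul_pow]
  refine le_trans ?_ (lintegral_sq_weight_le hG hφ hk hf)
  rw [eLpNorm_measL_sq hG]
  refine lintegral_mono fun α => ?_
  gcongr
  exact enorm_integral_le_lintegral_enorm _

/-- An integral operator whose weighted kernel is dominated by a convolution kernel of mass at
most `C` is bounded on `L²_Λ` with norm at most `C`. -/
theorem exists_clm_of_kernel (hG : ContDiff ℝ ∞ G) (hφ : Measurable φ) (hC : 0 ≤ C)
    (hφC : ∫⁻ γ, φ γ ≤ ENNReal.ofReal C)
    (hkm : StronglyMeasurable fun q : Phase n × Phase n => k q.1 q.2)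
    (hk : ∀ α β, weightFn G h α * ‖k α β‖ₑ ≤ φ (α - β) * weightFn G h β) :
    ∃ A : Lp ℂ 2 (measL G h) →L[ℂ] Lp ℂ 2 (measL G h), ‖A‖ ≤ C ∧
      ∀ f : Lp ℂ 2 (measL G h), (A f =ᵐ[measL G h] fun α => ∫ β, k α β * f β) ∧
        ∀ᵐ α ∂(measL G h), Integrable fun β => k α β * f β := by
  have hφtop : ∫⁻ γ, φ γ ≠ ⊤ := ne_top_of_le_ne_top ENNReal.ofReal_ne_top hφC
  have hint : ∀ f : Lp ℂ 2 (measL G h), ∀ᵐ α ∂(measL G h), Integrable fun β => k α β * f β :=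
    fun f => measL_absolutelyContinuous G h (ae_integrable_kernel hG hφ hφtop hkm hk
      (Lp.stronglyMeasurable f) (Lp.eLpNorm_ne_top f))
  have hbound : ∀ f : Lp ℂ 2 (measL G h),
      eLpNorm (fun α => ∫ β, k α β * f β) 2 (measL G h) ≤
        ENNReal.ofReal C * eLpNorm f 2 (measL G h) := fun f =>
    (eLpNorm_kernel_le hG hφ hk (Lp.stronglyMeasurable f).measurable).trans (by gcongr)
  have hmem : ∀ f : Lp ℂ 2 (measL G h), MemLp (fun α => ∫ β, k α β * f β) 2 (measL G h) := by
    intro f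
    refine ⟨?_, (hbound f).trans_lt (ENNReal.mul_lt_top ENNReal.ofReal_lt_top
      (Lp.eLpNorm_lt_top f))⟩
    have : StronglyMeasurable fun q : Phase n × Phase n => k q.1 q.2 * f q.2 :=
      hkm.mul ((Lp.stronglyMeasurable f).comp_measurable measurable_snd)
    exact this.integral_prod_right'.aestronglyMeasurable
  -- Identities in `Lp` hold almost everywhere for the weighted measure, while the kernel is
  -- integrated against Lebesgue measure; the two have the same null sets.
  have hvol := absolutelyContinuous_measL hG h
  let A₀ : Lp ℂ 2 (measL G h) →ₗ[ℂ] Lp ℂ 2 (measL G h) :=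
    { toFun := fun f => (hmem f).toLp
      map_add' := fun f g => by
        rw [← MemLp.toLp_add]
        refine (MemLp.toLp_eq_toLp_iff _ _).2 ?_
        filter_upwards [hint f, hint g] with α hf hg
        rw [Pi.add_apply, ← integral_add hf hg]
        refine integral_congr_ae ?_
        filter_upwards [hvol (Lp.coeFn_add f g)] with β hβ
        rw [hβ, Pi.add_apply, mul_add]
      map_smul' := fun c f => by
        rw [RingHom.id_apply, ← MemLp.toLp_const_smul]
        refine (MemLp.toLp_eq_toLp_iff _ _).2 (Eventually.of_forall fun α => ?_)
        simp only [Pi.smul_apply, smul_eq_mul]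
        rw [← integral_const_mul]
        refine integral_congr_ae ?_
        filter_upwards [hvol (Lp.coeFn_smul c f)] with β hβ
        rw [hβ, Pi.smul_apply, smul_eq_mul]
        ring }
  have hA₀ : ∀ f, ‖A₀ f‖ ≤ C * ‖f‖ := by
    intro f
    change ‖(hmem f).toLp‖ ≤ _
    rw [Lp.norm_toLp, Lp.norm_def, ← ENNReal.toReal_ofReal hC, ← ENNReal.toReal_mul]
    refine ENNReal.toReal_mono ?_ (hbound f)
    exact ENNReal.mul_ne_top ENNReal.ofReal_ne_top (Lp.eLpNorm_ne_top f)
  exact ⟨A₀.mkContinuous C hA₀, A₀.mkContinuous_norm_le hC hA₀,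
    fun f => ⟨(hmem f).coeFn_toLp, hint f⟩⟩

end Operator

/-! ### Composition of holomorphic functions with maps of bounded derivatives -/

namespace BddDeriv

variable {E F F' : Type} [NormedAddCommGroup E] [NormedSpace ℝ E] [NormedAddCommGroup F]
    [NormedSpace ℝ F] [NormedAddCommGroup F'] [NormedSpace ℝ F']

theorem prodMk {f : E → F} {g : E → F'} (hf : BddDeriv f) (hg : BddDeriv g) :
    BddDeriv fun x => (f x, g x) := by
  have h := (hf.clm_comp (ContinuousLinearMap.inl ℝ F F')).add
    (hg.clm_comp (ContinuousLinearMap.inr ℝ F F'))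
  simpa using h

theorem pi {f : E → Fin n → F} (hf : ∀ i, BddDeriv fun x => f x i) : BddDeriv f := by
  have h := BddDeriv.sum Finset.univ fun i _ =>
    (hf i).clm_comp (ContinuousLinearMap.single ℝ (fun _ : Fin n => F) i)
  refine cast ?_ h
  congr 1
  funext x
  simpa using Finset.univ_sum_single (f x)

theorem add_mul_I {f g : E → ℝ} (hf : BddDeriv f) (hg : BddDeriv g) :
    BddDeriv fun x => (f x : ℂ) + (g x : ℂ) * Complex.I := by
  have h := (hf.smul_const (1 : ℂ)).add (hg.smul_const Complex.I)
  simpa using h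

/-- The composition estimate for iterated derivatives requires bounds of the geometric form D^i;
taking `D ≥ 1` above all the individual constants suffices. -/
theorem exists_pow_bound {f : E → F} (hf : BddDeriv f) (k : ℕ) :
    ∃ D : ℝ, 0 ≤ D ∧ ∀ x i, 1 ≤ i → i ≤ k → ‖iteratedFDeriv ℝ i f x‖ ≤ D ^ i := by
  have hb : ∀ i : ℕ, ∃ C : ℝ, 1 ≤ i → ∀ x, ‖iteratedFDeriv ℝ i f x‖ ≤ C := by
    intro i
    by_cases hi : 1 ≤ i
    · obtain ⟨C, hC⟩ := hf.bound i hi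
      exact ⟨C, fun _ => hC⟩
    · exact ⟨0, fun h => absurd h hi⟩
  choose C hC using hb
  have h0 : 0 ≤ ∑ j ∈ Finset.range (k + 1), |C j| := Finset.sum_nonneg fun j _ => abs_nonneg _
  refine ⟨1 + ∑ j ∈ Finset.range (k + 1), |C j|, by linarith, fun x i h1 hi => ?_⟩
  have h2 : |C i| ≤ ∑ j ∈ Finset.range (k + 1), |C j| :=
    Finset.single_le_sum (f := fun j => |C j|) (fun j _ => abs_nonneg _)
      (Finset.mem_range.2 (Nat.lt_succ_of_le hi))
  calc ‖iteratedFDeriv ℝ i f x‖ ≤ 1 + ∑ j ∈ Finset.range (k + 1), |C j| := by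
        linarith [hC i h1 x, le_abs_self (C i)]
    _ ≤ _ := le_self_pow₀ (by linarith) (by omega)

/-- The derivatives of `g ∘ f` are bounded by the supremum of the holomorphic function `g` on a
neighbourhood of uniform size of the range of `f`. -/
theorem exists_norm_iteratedFDeriv_comp_le {V : Type} [NormedAddCommGroup V] [NormedSpace ℂ V]
    [FiniteDimensional ℂ V] {f : E → V} (hf : BddDeriv f) {S : Set V} (hS : IsOpen S) {r : ℝ}
    (hr : 0 < r) (hfS : ∀ x, Metric.ball (f x) r ⊆ S) (k : ℕ) :
    ∃ C : ℝ, 0 ≤ C ∧ ∀ (g : V → ℂ) (B : ℝ), DifferentiableOn ℂ g S → (∀ w ∈ S, ‖g w‖ ≤ B) →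
      ∀ x, ‖iteratedFDeriv ℝ k (g ∘ f) x‖ ≤ C * B := by
  choose C hC0 hC using fun i : ℕ =>
    exists_norm_iteratedFDeriv_le_of_holomorphic (E := V) (F := ℂ) i hr
  obtain ⟨D, hD0, hD⟩ := hf.exists_pow_bound k
  have hs0 : 0 ≤ ∑ i ∈ Finset.range (k + 1), C i := Finset.sum_nonneg fun i _ => hC0 i
  refine ⟨k.factorial * (∑ i ∈ Finset.range (k + 1), C i) * D ^ k, by positivity,
    fun g B hg hB x => ?_⟩
  have hmem : ∀ x, f x ∈ S := fun x => hfS x (Metric.mem_ball_self hr)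
  have hB0 : 0 ≤ B := (norm_nonneg _).trans (hB _ (hmem x))
  have hgc : ContDiffOn ℂ ∞ g S := contDiffOn_of_differentiableOn_several hS hg
  have h := norm_iteratedFDeriv_comp_le' (N := ∞) (t := S) (g := g) (f := f) (n := k)
    (Set.range_subset_iff.2 hmem) hS.uniqueDiffOn (hgc.restrict_scalars ℝ) hf.contDiff
    (by exact_mod_cast le_top) x (C := (∑ i ∈ Finset.range (k + 1), C i) * B) (D := D)
    (fun i hi => ?_) (hD x)
  · refine h.trans (le_of_eq ?_)
    ring
  · rw [iteratedFDerivWithin_of_isOpen i hS (hmem x)]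
    have h1 : ContDiffAt ℂ i g (f x) :=
      (hgc.contDiffAt (hS.mem_nhds (hmem x))).of_le (by exact_mod_cast le_top)
    rw [norm_iteratedFDeriv_real_eq h1]
    refine (hC i g (f x) B (hg.mono (hfS x)) fun y hy => hB y (hfS x hy)).trans ?_
    refine mul_le_mul_of_nonneg_right ?_ hB0
    exact Finset.single_le_sum (f := C) (fun j _ => hC0 j)
      (Finset.mem_range.2 (Nat.lt_succ_of_le hi))

end BddDeriv

/-! ### The symbol -/

section Symbol

variable {p : CConf n × CConf n → ℂ} {a b a' b' M : ℝ}

theorem contDiff_comp_of_strip {E : Type} [NormedAddCommGroup E] [NormedSpace ℝ E]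
    {f : E → CConf n × CConf n} (hf : ContDiff ℝ ∞ f) (hfS : ∀ x, f x ∈ strip n a b)
    (hp : DifferentiableOn ℂ p (strip n a b)) : ContDiff ℝ ∞ (p ∘ f) :=
  ((contDiffOn_of_differentiableOn_several (isOpen_strip a b) hp).restrict_scalars ℝ).comp_contDiff
    hf hfS

/-- Gaussian averages along a map with bounded derivatives are symbols. -/
theorem symbolExpansion_gaussAvg (hp : DifferentiableOn ℂ p (strip n a b))
    (hM : ∀ w ∈ strip n a b, ‖p w‖ ≤ M) (ha : a' < a) (hb : b' < b)
    {f : Phase n × Phase n → CConf n × CConf n} (hf : BddDeriv f)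
    (hfS : ∀ q, f q ∈ strip n a' b') :
    SymbolExpansion (fun h => gaussAvg p (Real.sqrt h) ∘ f)
      fun j => gaussMoment p (2 * j) ∘ f := by
  -- An intermediate strip: the moments need room inside the strip of `p`, and the composition
  -- estimate needs room around the range of `f`.
  have ha1 : a' < (a' + a) / 2 := by linarith
  have ha2 : (a' + a) / 2 < a := by linarith
  have hb1 : b' < (b' + b) / 2 := by linarith
  have hb2 : (b' + b) / 2 < b := by linarith
  obtain ⟨r, hr, hball⟩ := exists_ball_subset_strip (n := n) ha1 hb1
  have hfr : ∀ q, Metric.ball (f q) r ⊆ strip n ((a' + a) / 2) ((b' + b) / 2) :=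
    fun q => hball _ (hfS q)
  have hmom := fun j => differentiableOn_gaussMoment hp hM ha2 hb2 (2 * j)
  have havg : ∀ t, DifferentiableOn ℂ (gaussAvg p t) (strip n ((a' + a) / 2) ((b' + b) / 2)) :=
    fun t => (differentiableOn_gaussAvg hp hM t).mono (strip_mono ha2.le hb2.le)
  have hfm : ∀ q, f q ∈ strip n ((a' + a) / 2) ((b' + b) / 2) :=
    fun q => strip_mono ha1.le hb1.le (hfS q)
  refine ⟨fun h _ _ => contDiff_comp_of_strip hf.contDiff hfm (havg _),
    fun j => contDiff_comp_of_strip hf.contDiff hfm (hmom j), fun j k => ?_, fun N k => ?_⟩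
  · obtain ⟨C, _, hC⟩ := hf.exists_norm_iteratedFDeriv_comp_le (isOpen_strip _ _) hr hfr k
    obtain ⟨B, hB⟩ := exists_norm_gaussMoment_le hp hM ha2 hb2 (2 * j)
    exact ⟨C * B, hC _ B (hmom j) hB⟩
  · obtain ⟨C, hC0, hC⟩ := hf.exists_norm_iteratedFDeriv_comp_le (isOpen_strip _ _) hr hfr k
    obtain ⟨B, hB⟩ := exists_norm_gaussAvg_sub_le hp hM ha2 hb2 N
    refine ⟨C * B, fun h hh _ q => ?_⟩
    rw [mul_assoc]
    -- The remainder is itself holomorphic with sup norm O(h^N), so all its derivatives are O(h^N)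
    -- without differentiating the expansion.
    refine hC (fun w => gaussAvg p (Real.sqrt h) w -
      ∑ j ∈ Finset.range N, (h : ℂ) ^ j * gaussMoment p (2 * j) w) _ ?_ (hB h hh) q
    exact (havg _).sub (DifferentiableOn.fun_sum fun j _ => (hmom j).const_mul _)

end Symbol

/-! ### The truncated critical point -/

/-- A bump function times the identity: small displacements are unchanged, large ones are kept
within δ, so the truncated critical point stays in the strip. -/
theorem exists_cutoff {δ : ℝ} (hδ : 0 < δ) : ∃ χ : Conf n → Conf n, ContDiff ℝ ∞ χ ∧
    HasCompactSupport χ ∧ (∀ x, ‖χ x‖ ≤ δ) ∧ ∀ x, ‖x‖ ≤ δ / 2 → χ x = x := by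
  let f : ContDiffBump (0 : Conf n) := ⟨δ / 2, δ, half_pos hδ, half_lt_self hδ⟩
  refine ⟨fun x => f x • x, f.contDiff.smul contDiff_id, f.hasCompactSupport.smul_right,
    fun x => ?_, fun x hx => ?_⟩
  · rw [norm_smul, Real.norm_of_nonneg f.nonneg]
    rcases le_total δ ‖x‖ with h | h
    · rw [f.zero_of_le_dist (by simpa using h), zero_mul]
      exact hδ.le
    · calc f x * ‖x‖ ≤ 1 * δ := mul_le_mul f.le_one h (norm_nonneg _) zero_le_one
        _ = δ := one_mul δ
  · change f x • x = x
    rw [f.one_of_mem_closedBall (by simpa using hx), one_smul]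

/-- The critical point, with the displacement `α - β` truncated by `χ`. -/
def cutPt (G : Phase n → ℝ) (χ : Conf n → Conf n) (q : Phase n × Phase n) : CConf n × CConf n :=
  critPt G q.1 q.2 (χ (q.1 - q.2).1, χ (q.1 - q.2).2)

section CutPt

variable {G : Phase n → ℝ} {χ : Conf n → Conf n}

theorem bddDeriv_cutPt (hG : ContDiff ℝ ∞ G) (hc : HasCompactSupport G) (hχ : BddDeriv χ) :
    BddDeriv (cutPt G χ) := by
  let L : Phase n × Phase n →L[ℝ] Phase n := ContinuousLinearMap.fst ℝ (Phase n) (Phase n)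
  let L' : Phase n × Phase n →L[ℝ] Phase n := ContinuousLinearMap.snd ℝ (Phase n) (Phase n)
  have hx := fun i => (BddDeriv.clm (coordX (n := n) i)).comp_clm L
  have hx' := fun i => (BddDeriv.clm (coordX (n := n) i)).comp_clm L'
  have hξ := fun i => (BddDeriv.clm (coordXi (n := n) i)).comp_clm L
  have hξ' := fun i => (BddDeriv.clm (coordXi (n := n) i)).comp_clm L'
  have hgx := fun i => (bddDeriv_gradX hG hc i).comp_clm L
  have hgx' := fun i => (bddDeriv_gradX hG hc i).comp_clm L'
  have hgξ := fun i => (bddDeriv_gradXi hG hc i).comp_clm L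
  have hgξ' := fun i => (bddDeriv_gradXi hG hc i).comp_clm L'
  have h1 := fun i => (hχ.clm_comp (EuclideanSpace.proj (𝕜 := ℝ) i)).comp_clm
    ((ContinuousLinearMap.fst ℝ (Conf n) (Conf n)).comp (L - L'))
  have h2 := fun i => (hχ.clm_comp (EuclideanSpace.proj (𝕜 := ℝ) i)).comp_clm
    ((ContinuousLinearMap.snd ℝ (Conf n) (Conf n)).comp (L - L'))
  refine BddDeriv.prodMk (BddDeriv.pi fun i => BddDeriv.add_mul_I ?_ ?_)
    (BddDeriv.pi fun i => BddDeriv.add_mul_I ?_ ?_)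
  · exact (((hx i).add (hx' i)).add ((hgx' i).sub (hgx i))).const_mul _
  · exact (((hgξ i).add (hgξ' i)).sub (h2 i)).const_mul _
  · exact (((hξ i).add (hξ' i)).add ((hgξ' i).sub (hgξ i))).const_mul _
  · exact (((hgx i).add (hgx' i)).sub (h1 i)).const_mul _

theorem cutPt_self (G : Phase n → ℝ) (hχ : χ 0 = 0) (α : Phase n) :
    cutPt G χ (α, α) = (zL G α, zetaL G α) := by
  rw [← critPt_self]
  change critPt G α α (χ (α.1 - α.1), χ (α.2 - α.2)) = _
  rw [sub_self, sub_self, hχ]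
  rfl

end CutPt

section Remainder

variable {G : Phase n → ℝ} {p : CConf n × CConf n → ℂ} {a b M ε δ h : ℝ} {χ : Conf n → Conf n}

/-- If the critical point lies in the strip, the kernel is a Gaussian average. -/
theorem tpsKernel_eq_gaussAvg (hp : DifferentiableOn ℂ p (strip n a b))
    (hM : ∀ w ∈ strip n a b, ‖p w‖ ≤ M) (ha : 0 < a) (hb : 0 < b) (hh : 0 < h) {α β : Phase n}
    (hw : critPt G α β (α - β) ∈ strip n a b) :
    tpsKernel G p h α β = Complex.exp (Complex.I / h * psiL G α β) *
      gaussAvg p (Real.sqrt h) (critPt G α β (α - β)) := by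
  have h0 : (0 : CConf n × CConf n) ∈ strip n a b := by
    constructor <;> simpa [imNorm]
  have hc : (Real.sqrt 2 ^ n / (2 * Real.pi * h) ^ n) * ((2 * Real.pi * h) ^ n / Real.sqrt 2 ^ n) =
      1 := by field_simp
  have hc' := congrArg (fun x : ℝ => (x : ℂ)) hc
  simp only [Complex.ofReal_mul, Complex.ofReal_one] at hc'
  rw [tpsKernel_eq G p hh, contourInt_eq hp hM hh _ h0 hw, contourInt_self hh]
  linear_combination (Complex.exp (Complex.I / h * psiL G α β) *
      gaussAvg p (Real.sqrt h) (critPt G α β (α - β))) * hc'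

/-- Away from the diagonal the decay is comparable with the bracket. -/
theorem le_decay_of_phaseSq_ge (hδ0 : 0 ≤ δ) (hδ : δ ≤ 1) {α β : Phase n}
    (hs : δ ^ 2 / 4 ≤ phaseSq (α - β)) : δ ^ 2 / 5 * bracket α β ≤ decay (α - β) := by
  have hB := one_le_bracket (α - β)
  have h0 := phaseSq_nonneg (α - β)
  rw [bracket_eq, decay, le_div_iff₀ (by linarith), mul_assoc, Real.mul_self_sqrt (by linarith)]
  -- With s = |α - β|², the claim (δ²/5)(1 + s) ≤ s follows from δ²s/5 ≤ s/5 and δ²/5 ≤ 4s/5.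
  have h1 : δ ^ 2 ≤ 1 := pow_le_one₀ hδ0 hδ
  have h2 := mul_le_mul_of_nonneg_right h1 h0
  linarith

/-- The remainder of the kernel. -/
def kernelRemainder (G : Phase n → ℝ) (p : CConf n × CConf n → ℂ) (χ : Conf n → Conf n) (h : ℝ)
    (α β : Phase n) : ℂ :=
  tpsKernel G p h α β -
    Complex.exp (Complex.I / h * psiL G α β) * gaussAvg p (Real.sqrt h) (cutPt G χ (α, β))

/-- Near the diagonal the truncation is inactive and the remainder is exactly zero. Elsewhere no
cancellation is needed: the kernel and the approximate kernel are each exponentially small. -/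
theorem SmallC2.norm_kernelRemainder_le (hG : SmallC2 G ε) (hε : ε ≤ 1) (hδ0 : 0 < δ) (hδ : δ ≤ 1)
    (hεδ : (2 * n + 4) * ε ≤ δ / 8) (hδa : 1 / 2 * δ + n * ε < a) (hδb : 1 / 2 * δ + n * ε < b)
    (hH : ∀ α, |weightH G α| ≤ δ ^ 3 / 160)
    (hp : DifferentiableOn ℂ p (strip n a b)) (hM : ∀ w ∈ strip n a b, ‖p w‖ ≤ M)
    (ha : 0 < a) (hb : 0 < b) (hχ : ∀ x, ‖χ x‖ ≤ δ) (hχ' : ∀ x, ‖x‖ ≤ δ / 2 → χ x = x)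
    (hh : 0 < h) (α β : Phase n) :
    ‖kernelRemainder G p χ h α β‖ ≤
      2 * (Real.sqrt 2 ^ n * M) * Real.exp (-(δ ^ 3 / 80 * bracket α β / h)) := by
  have hM0 : 0 ≤ M := (norm_nonneg _).trans (hM _ (toCC_mem_strip ha hb 0))
  have hcut : cutPt G χ (α, β) ∈ strip n a b :=
    hG.critPt_mem_strip (a := a) (b := b) α β
      (by dsimp only; linarith [hχ (α - β).2]) (by dsimp only; linarith [hχ (α - β).1])
  by_cases hnear : ‖(α - β).1‖ ≤ δ / 2 ∧ ‖(α - β).2‖ ≤ δ / 2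
  · have he : cutPt G χ (α, β) = critPt G α β (α - β) := by
      rw [cutPt, hχ' _ hnear.1, hχ' _ hnear.2]
    rw [kernelRemainder, he, tpsKernel_eq_gaussAvg hp hM ha hb hh (he ▸ hcut), sub_self, norm_zero]
    positivity
  · have hs : δ ^ 2 / 4 ≤ phaseSq (α - β) := by
      rw [not_and_or, not_le, not_le] at hnear
      unfold phaseSq
      rcases hnear with h1 | h1
      · nlinarith [sq_nonneg ‖(α - β).2‖]
      · nlinarith [sq_nonneg ‖(α - β).1‖]
    have hdec := le_decay_of_phaseSq_ge hδ0.le hδ hs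
    have hB : 1 ≤ bracket α β := by rw [bracket_eq]; exact one_le_bracket _
    have hd3 : 0 < δ ^ 3 := by positivity
    -- The gain is (δ/8)(δ²/5)⟨α - β⟩ = (δ³/40)⟨α - β⟩. The two weights take at most δ³/80, hence at
    -- most half of it since the bracket is at least 1.
    have hexp : weightH G α - weightH G β - δ / 8 * decay (α - β) ≤
        -(δ ^ 3 / 80 * bracket α β) := by
      have h1 := (abs_le.1 (hH α)).2
      have h2 := (abs_le.1 (hH β)).1
      have h3 := mul_le_mul_of_nonneg_left hdec (show 0 ≤ δ / 8 by positivity)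
      have h4 : δ / 8 * (δ ^ 2 / 5 * bracket α β) = δ ^ 3 / 40 * bracket α β := by ring
      nlinarith
    have h1 : ‖tpsKernel G p h α β‖ ≤
        Real.sqrt 2 ^ n * M * Real.exp (-(δ ^ 3 / 80 * bracket α β / h)) := by
      refine (hG.norm_tpsKernel_le hε hδ0.le hδ hεδ hδa hδb hp hM ha hb hh α β).trans ?_
      rw [← Real.exp_add, ← Real.exp_add]
      refine mul_le_mul_of_nonneg_left (Real.exp_le_exp.2 ?_) (by positivity)
      rw [← sub_eq_add_neg, ← sub_eq_add_neg, ← sub_div, ← sub_div, ← neg_div]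
      exact div_le_div_of_nonneg_right hexp hh.le
    have h2 : ‖Complex.exp (Complex.I / h * psiL G α β) *
        gaussAvg p (Real.sqrt h) (cutPt G χ (α, β))‖ ≤
        Real.sqrt 2 ^ n * M * Real.exp (-(δ ^ 3 / 80 * bracket α β / h)) := by
      rw [norm_mul, norm_exp_psiL, mul_comm, mul_comm (Real.sqrt 2 ^ n)]
      refine mul_le_mul (norm_gaussAvg_le hM _ hcut) (Real.exp_le_exp.2 ?_) (Real.exp_pos _).le
        (by positivity)
      rw [← neg_div]
      refine div_le_div_of_nonneg_right ?_ hh.le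
      linarith [hG.im_psiL_ge hε hδ hεδ α β]
    refine (norm_sub_le _ _).trans ?_
    linarith

end Remainder

/-! ### The operator on `L²_Λ` -/

section Bounded

variable {G : Phase n → ℝ} {p : CConf n × CConf n → ℂ} {a b M ε δ h B Cb : ℝ}

theorem schwartz_composition (hp : DifferentiableOn ℂ p (strip n a b))
    (hM : ∀ w ∈ strip n a b, ‖p w‖ ≤ M) (ha : 0 < a) (hb : 0 < b) (hG : ContDiff ℝ ∞ G)
    (hc : HasCompactSupport G) (hB : DisplacementBound G B) (hh : 0 < h) (u : 𝓢(Phase n, ℂ)) :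
    TPSLConverges G p h u ∧
      ∀ α, Integrable (fun β => tpsKernel G p h α β * u β * bDens G β) ∧
        TPSL G p h u α = ((cZero n * (h ^ n)⁻¹ : ℝ) : ℂ) *
          ∫ β, tpsKernel G p h α β * u β * bDens G β := by
  obtain ⟨Cb, hCb⟩ := exists_norm_bDens_le hG hc
  have hUc : Continuous fun α => bDens G α * u α := (continuous_bDens hG hc).mul u.continuous
  have hU : Integrable fun α => bDens G α * u α :=
    u.integrable.bdd_mul (continuous_bDens hG hc).aestronglyMeasurable
      (Eventually.of_forall hCb)
  obtain ⟨h3, h4, h5, h6⟩ := composition_formula hp hM ha hb hG hB hh hU hUc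
  have hconst : cZero n * (h ^ n)⁻¹ ≠ 0 := by unfold cZero; positivity
  have hk : ∀ α, (fun β => tpsKernel G p h α β * u β * bDens G β) = fun β =>
      (((cZero n * (h ^ n)⁻¹)⁻¹ : ℝ) : ℂ) *
        ((∫ σ, tpsIntegrand G p h α β σ) * (bDens G β * u β)) := by
    intro α
    funext β
    rw [tpsKernel]
    ring
  refine ⟨⟨fun y => integrable_invKernel hG hB hh hU hUc y, fun x ξ =>
    integrable_pseudoIntegrand p (integrable_invTransform hG hB hh hU hUc) x ξ, h3, h4⟩,
    fun α => ⟨?_, ?_⟩⟩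
  · rw [hk]
    exact (h5 α).const_mul _
  · rw [hk, integral_const_mul, ← mul_assoc, ← Complex.ofReal_mul, mul_inv_cancel₀ hconst,
      Complex.ofReal_one, one_mul]
    exact h6 α

/-- `H` is bounded, so at fixed `h` the weighted measure is at most a multiple of Lebesgue measure.
-/
theorem memLp_measL (hH : ∀ α, |weightH G α| ≤ B) (hh : 0 < h) {u : Phase n → ℂ}
    (hu : MemLp u 2) : MemLp u 2 (measL G h) := by
  refine hu.of_measure_le_smul (c := ENNReal.ofReal (Real.exp (2 * B / h))) ENNReal.ofReal_ne_top ?_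
  rw [measL, ← withDensity_const]
  refine withDensity_mono (Eventually.of_forall fun α => ENNReal.ofReal_le_ofReal ?_)
  refine Real.exp_le_exp.2 (div_le_div_of_nonneg_right ?_ hh.le)
  linarith [(abs_le.1 (hH α)).1]

/-- The convolution kernel dominating the kernel of `T_Λ P S_Λ`. -/
def dominatingKernel (n : ℕ) (D δ h : ℝ) (γ : Phase n) : ℝ≥0∞ :=
  ENNReal.ofReal (D * (h ^ n)⁻¹ * Real.exp (-(δ / 8 * decay γ / h)))

/-- The factor h^{-n} of the kernel is compensated by the concentration of the decay at scale `√h`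
in 2n dimensions, so the mass is uniform in `h`. -/
theorem lintegral_dominatingKernel_le {D : ℝ} (hD : 0 ≤ D) (hδ : 0 < δ) (hh : 0 < h) (h1 : h ≤ 1) :
    ∫⁻ γ, dominatingKernel n D δ h γ ≤
      ENNReal.ofReal (D * ∫ γ : Phase n, Real.exp (-(δ / 8) * decay γ)) := by
  obtain ⟨hI, hle⟩ := integral_exp_neg_decay_le (n := n) (show 0 < δ / 8 by positivity) hh h1
  unfold dominatingKernel
  rw [← ofReal_integral_eq_lintegral_ofReal (hI.const_mul _)
    (Eventually.of_forall fun γ => by positivity), integral_const_mul]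
  refine ENNReal.ofReal_le_ofReal ?_
  calc _ ≤ D * (h ^ n)⁻¹ * (h ^ n * ∫ γ : Phase n, Real.exp (-(δ / 8) * decay γ)) := by gcongr
    _ = _ := by field_simp

/-- Conjugation by e^{-H/h} cancels the weights in the kernel estimate and leaves a function of α -
β. -/
theorem weightFn_mul_enorm_le {D : ℝ} {α β : Phase n} {z : ℂ}
    (hz : ‖z‖ ≤ D * (h ^ n)⁻¹ * (Real.exp (weightH G α / h) * Real.exp (-(weightH G β / h)) *
        Real.exp (-(δ / 8 * decay (α - β) / h)))) :
    weightFn G h α * ‖z‖ₑ ≤ dominatingKernel n D δ h (α - β) * weightFn G h β := by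
  rw [weightFn, weightFn, dominatingKernel, ← ofReal_norm,
    ← ENNReal.ofReal_mul (Real.exp_pos _).le, ← ENNReal.ofReal_mul' (Real.exp_pos _).le]
  refine ENNReal.ofReal_le_ofReal ?_
  have h1 : Real.exp (-(weightH G α / h)) * Real.exp (weightH G α / h) = 1 := by
    rw [← Real.exp_add]; simp
  calc _ ≤ Real.exp (-(weightH G α / h)) * (D * (h ^ n)⁻¹ * (Real.exp (weightH G α / h) *
        Real.exp (-(weightH G β / h)) * Real.exp (-(δ / 8 * decay (α - β) / h)))) :=
        mul_le_mul_of_nonneg_left hz (Real.exp_pos _).le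
    _ = (Real.exp (-(weightH G α / h)) * Real.exp (weightH G α / h)) * (D * (h ^ n)⁻¹ *
        Real.exp (-(δ / 8 * decay (α - β) / h)) * Real.exp (-(weightH G β / h))) := by ring
    _ = _ := by rw [h1, one_mul]

theorem SmallC2.exists_clm_tps (hG : SmallC2 G ε) (hε : ε ≤ 1) (hδ0 : 0 < δ) (hδ : δ ≤ 1)
    (hεδ : (2 * n + 4) * ε ≤ δ / 8) (hδa : 1 / 2 * δ + n * ε < a) (hδb : 1 / 2 * δ + n * ε < b)
    (hc : HasCompactSupport G) (hp : DifferentiableOn ℂ p (strip n a b))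
    (hM : ∀ w ∈ strip n a b, ‖p w‖ ≤ M) (ha : 0 < a) (hb : 0 < b)
    (hCb : ∀ α, ‖bDens G α‖ ≤ Cb) (hh : 0 < h) (h1 : h ≤ 1) :
    ∃ A : Lp ℂ 2 (measL G h) →L[ℂ] Lp ℂ 2 (measL G h),
      ‖A‖ ≤ cZero n * (Real.sqrt 2 ^ n * M) * Cb *
        ∫ γ : Phase n, Real.exp (-(δ / 8) * decay γ) ∧
      ∀ f : Lp ℂ 2 (measL G h), ∀ᵐ α ∂(measL G h),
        Integrable (fun β => tpsKernel G p h α β * f β * bDens G β) ∧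
        A f α = ((cZero n * (h ^ n)⁻¹ : ℝ) : ℂ) *
          ∫ β, tpsKernel G p h α β * f β * bDens G β := by
  have hM0 : 0 ≤ M := (norm_nonneg _).trans (hM _ (toCC_mem_strip ha hb 0))
  have hCb0 : 0 ≤ Cb := (norm_nonneg _).trans (hCb 0)
  have hc0 : 0 < cZero n := by unfold cZero; positivity
  have hconst : cZero n * (h ^ n)⁻¹ ≠ 0 := by positivity
  have hD : 0 ≤ cZero n * (Real.sqrt 2 ^ n * M) * Cb := by positivity
  have hcC : ((cZero n * (h ^ n)⁻¹ : ℝ) : ℂ) ≠ 0 := Complex.ofReal_ne_zero.2 hconst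
  obtain ⟨A, hA, hAf⟩ := exists_clm_of_kernel (G := G) (h := h)
    (k := fun α β => ((cZero n * (h ^ n)⁻¹ : ℝ) : ℂ) * (tpsKernel G p h α β * bDens G β))
    (φ := dominatingKernel n (cZero n * (Real.sqrt 2 ^ n * M) * Cb) δ h) hG.contDiff
    (by
      refine Measurable.ennreal_ofReal (Continuous.measurable ?_)
      exact continuous_const.mul (Real.continuous_exp.comp
        ((continuous_const.mul continuous_decay).div_const _).neg))
    (mul_nonneg hD (integral_nonneg fun γ => (Real.exp_pos _).le))
    (lintegral_dominatingKernel_le hD hδ0 hh h1)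
    (((measurable_tpsKernel hp ha hb hG.contDiff h).mul
      ((continuous_bDens hG.contDiff hc).comp continuous_snd).stronglyMeasurable).const_mul _)
    (fun α β => weightFn_mul_enorm_le (by
      rw [norm_mul, norm_mul, Complex.norm_real, Real.norm_of_nonneg (by positivity)]
      have h2 := hG.norm_tpsKernel_le hε hδ0.le hδ hεδ hδa hδb hp hM ha hb hh α β
      calc _ ≤ cZero n * (h ^ n)⁻¹ * (Real.sqrt 2 ^ n * M *
            (Real.exp (weightH G α / h) * Real.exp (-(weightH G β / h)) *
              Real.exp (-(δ / 8 * decay (α - β) / h))) * Cb) := by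
            gcongr
            exact hCb β
        _ = _ := by ring))
  refine ⟨A, hA, fun f => ?_⟩
  filter_upwards [(hAf f).1, (hAf f).2] with α h3 h4
  have h5 : (fun β => ((cZero n * (h ^ n)⁻¹ : ℝ) : ℂ) * (tpsKernel G p h α β * bDens G β) * f β) =
      fun β => ((cZero n * (h ^ n)⁻¹ : ℝ) : ℂ) * (tpsKernel G p h α β * f β * bDens G β) := by
    funext β; ring
  rw [h5] at h3 h4
  refine ⟨?_, by rw [h3, integral_const_mul]⟩
  have h6 := h4.const_mul (((cZero n * (h ^ n)⁻¹ : ℝ) : ℂ))⁻¹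
  simpa only [← mul_assoc, inv_mul_cancel₀ hcC, one_mul] using h6

end Bounded

/-! ### Choice of the constants. -/

theorem exists_small_constants (n : ℕ) {a b R : ℝ} (ha : 0 < a) (hb : 0 < b) (hR : 0 < R) :
    ∃ δ ε : ℝ, 0 < δ ∧ δ ≤ 1 ∧ 0 < ε ∧ ε ≤ 1 ∧ (2 * n + 4) * ε ≤ δ / 8 ∧
      1 / 2 * δ + n * ε < 3 / 4 * a ∧ 1 / 2 * δ + n * ε < 3 / 4 * b ∧
      ε * (1 + n * R) ≤ δ ^ 3 / 160 := by
  have hδ0 : 0 < min 1 (min a b) / 2 := by positivity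
  have h1 : min 1 (min a b) / 2 ≤ 1 := by linarith [min_le_left 1 (min a b)]
  have h2 : min 1 (min a b) ≤ a := (min_le_right _ _).trans (min_le_left _ _)
  have h3 : min 1 (min a b) ≤ b := (min_le_right _ _).trans (min_le_right _ _)
  have hδa : min 1 (min a b) / 2 ≤ a / 2 := by linarith
  have hδb : min 1 (min a b) / 2 ≤ b / 2 := by linarith
  generalize min 1 (min a b) / 2 = δ at *
  have hn : (0 : ℝ) ≤ n := n.cast_nonneg
  have hd3 : 0 < δ ^ 3 := by positivity
  have hd3' : δ ^ 3 ≤ δ := by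
    calc δ ^ 3 ≤ δ ^ 1 := pow_le_pow_of_le_one hδ0.le h1 (by norm_num)
      _ = δ := pow_one δ
  -- The size of `ε` is dictated by the bound on `H`, of order δ³; the remaining conditions are
  -- weaker because δ ≤ 1, and 200 > 160 leaves some slack.
  obtain ⟨ε, hε0, hε⟩ : ∃ ε : ℝ, 0 < ε ∧ ε * ((n + 1) * (1 + R)) = δ ^ 3 / 200 :=
    ⟨δ ^ 3 / 200 / ((n + 1) * (1 + R)), by positivity, by field_simp⟩
  have e1 : ε * ((n + 1) * (1 + R)) = ε * (n + 1) + ε * n * R + ε * R := by ring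
  have e2 : 0 ≤ ε * n * R := by positivity
  have e3 : 0 < ε * R := by positivity
  have e4 : 0 ≤ ε * n := by positivity
  refine ⟨δ, ε, hδ0, h1, hε0, ?_, ?_, ?_, ?_, ?_⟩ <;> nlinarith

end FBI

end

/-! ### Assembly of the theorem. -/

theorem mainTheorem6 (n : ℕ) (a b R : ℝ) (ha : 0 < a) (hb : 0 < b) (hR : 0 < R) :
    ∃ ε : ℝ, 0 < ε ∧
    ∀ G : FBI.Phase n → ℝ, ContDiff ℝ ∞ G →
    tsupport G ⊆ Metric.closedBall 0 R →
    (∀ k : ℕ, k ≤ 2 → ∀ α, ‖iteratedFDeriv ℝ k G α‖ ≤ ε) →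
    ∀ (p : FBI.CConf n × FBI.CConf n → ℂ) (M : ℝ),
    DifferentiableOn ℂ p (FBI.strip n a b) →
    (∀ w ∈ FBI.strip n a b, ‖p w‖ ≤ M) →
    ∃ (K : ℝ → FBI.Phase n → FBI.Phase n → ℂ)
      (aP : ℝ → FBI.Phase n × FBI.Phase n → ℂ)
      (aj : ℕ → FBI.Phase n × FBI.Phase n → ℂ)
      (r : ℝ → FBI.Phase n → FBI.Phase n → ℂ)
      (C : ℝ), 0 < C ∧
      (∀ h : ℝ, 0 < h → h ≤ 1 →
        (∀ u : 𝓢(FBI.Phase n, ℂ), FBI.TPSLConverges G p h u ∧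
          ∀ α, Integrable (fun β => K h α β * u β * FBI.bDens G β) ∧
            FBI.TPSL G p h u α =
              ((FBI.cZero n * (h ^ n)⁻¹ : ℝ) : ℂ) * ∫ β, K h α β * u β * FBI.bDens G β) ∧
        (∃ A : Lp ℂ 2 (FBI.measL G h) →L[ℂ] Lp ℂ 2 (FBI.measL G h),
          ‖A‖ ≤ C ∧
          (∀ u : 𝓢(FBI.Phase n, ℂ), ∃ hu : MemLp u 2 (FBI.measL G h),
            A (hu.toLp u) =ᵐ[FBI.measL G h] FBI.TPSL G p h u) ∧
          (∀ f : Lp ℂ 2 (FBI.measL G h), ∀ᵐ α ∂(FBI.measL G h),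
            Integrable (fun β => K h α β * f β * FBI.bDens G β) ∧
            A f α =
              ((FBI.cZero n * (h ^ n)⁻¹ : ℝ) : ℂ) * ∫ β, K h α β * f β * FBI.bDens G β)) ∧
        (∀ α β, K h α β =
          Complex.exp (Complex.I / h * FBI.psiL G α β) * aP h (α, β) + r h α β) ∧
        (∀ α β, ‖r h α β‖ ≤ C * Real.exp (-(FBI.bracket α β) / (C * h)))) ∧
      FBI.SymbolExpansion aP aj ∧
      (∀ α, aj 0 (α, α) = p (FBI.zL G α, FBI.zetaL G α)) := by
  obtain ⟨δ, ε, hδ0, hδ, hε0, hε, hεδ, hδa, hδb, hεH⟩ := FBI.exists_small_constants n ha hb hR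
  refine ⟨ε, hε0, fun G hG hsupp hsmall p M hp hM => ?_⟩
  have hS : FBI.SmallC2 G ε := .of_iteratedFDeriv hG hsmall
  have hc : HasCompactSupport G :=
    (isCompact_closedBall _ _).of_isClosed_subset (isClosed_tsupport G) hsupp
  have hB := hS.displacementBound hR.le hsupp
  have hH : ∀ α, |FBI.weightH G α| ≤ δ ^ 3 / 160 :=
    fun α => (hS.abs_weightH_le hR.le hsupp α).trans hεH
  have hδa' : 1 / 2 * δ + n * ε < a := by linarith
  have hδb' : 1 / 2 * δ + n * ε < b := by linarith
  obtain ⟨Cb, hCb⟩ := FBI.exists_norm_bDens_le hG hc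
  obtain ⟨χ, hχs, hχc, hχ, hχ'⟩ := FBI.exists_cutoff (n := n) hδ0
  have hM0 : 0 ≤ M := (norm_nonneg _).trans (hM _ (FBI.toCC_mem_strip ha hb 0))
  have hCb0 : 0 ≤ Cb := (norm_nonneg _).trans (hCb 0)
  -- Staying in three quarters of the strip leaves the room that Cauchy's inequalities require.
  have hcut : ∀ q, FBI.cutPt G χ q ∈ FBI.strip n (3 / 4 * a) (3 / 4 * b) := fun q =>
    hS.critPt_mem_strip _ _ (by dsimp only; linarith [hχ (q.1 - q.2).2])
      (by dsimp only; linarith [hχ (q.1 - q.2).1])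
  set C₁ : ℝ := 2 * (Real.sqrt 2 ^ n * M) with hC₁
  set C₂ : ℝ := FBI.cZero n * (Real.sqrt 2 ^ n * M) * Cb *
    ∫ γ : FBI.Phase n, Real.exp (-(δ / 8) * FBI.decay γ) with hC₂
  have hC₁0 : 0 ≤ C₁ := by positivity
  have hC₂0 : 0 ≤ C₂ := by
    have h0 : 0 ≤ FBI.cZero n := by unfold FBI.cZero; positivity
    exact mul_nonneg (by positivity) (integral_nonneg fun γ => (Real.exp_pos _).le)
  have hC₃0 : 0 < 80 / δ ^ 3 := by positivity
  -- `C` occurs both as a factor and inside the exponent: C₁ bounds the remainder, C₂ the operator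
  -- norm, and 80/δ³ makes 1/C at most the decay rate δ³/80.
  refine ⟨FBI.tpsKernel G p, fun h => FBI.gaussAvg p (Real.sqrt h) ∘ FBI.cutPt G χ,
    fun j => FBI.gaussMoment p (2 * j) ∘ FBI.cutPt G χ, FBI.kernelRemainder G p χ,
    C₁ + C₂ + 80 / δ ^ 3, by positivity, fun h hh h1 => ⟨fun u => ?_, ?_, fun α β => ?_,
      fun α β => ?_⟩, ?_, fun α => ?_⟩
  · exact FBI.schwartz_composition hp hM ha hb hG hc hB hh u
  · obtain ⟨A, hA, hAf⟩ := hS.exists_clm_tps hε hδ0 hδ hεδ hδa' hδb' hc hp hM ha hb hCb hh h1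
    refine ⟨A, hA.trans (by linarith), fun u => ?_, hAf⟩
    have hu : MemLp u 2 (FBI.measL G h) := FBI.memLp_measL hH hh (u.memLp 2)
    refine ⟨hu, ?_⟩
    -- Both sides are integrals of the same kernel, against `u` and against its class in `Lp`.
    filter_upwards [hAf (hu.toLp u)] with α hα
    rw [hα.2, ((FBI.schwartz_composition hp hM ha hb hG hc hB hh u).2 α).2]
    congr 1
    refine integral_congr_ae ?_
    filter_upwards [FBI.absolutelyContinuous_measL hG h hu.coeFn_toLp] with β hβ
    rw [hβ]
  · exact (add_sub_cancel _ _).symm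
  · refine (hS.norm_kernelRemainder_le hε hδ0 hδ hεδ hδa' hδb' hH hp hM ha hb hχ hχ' hh α β).trans ?_
    refine mul_le_mul (by linarith) (Real.exp_le_exp.2 ?_) (Real.exp_pos _).le (by positivity)
    rw [neg_div, neg_le_neg_iff, mul_comm (C₁ + C₂ + 80 / δ ^ 3), ← div_div]
    have hbr : 0 ≤ FBI.bracket α β / h := div_nonneg (Real.sqrt_nonneg _) hh.le
    have hinv : FBI.bracket α β / h / (C₁ + C₂ + 80 / δ ^ 3) ≤
        FBI.bracket α β / h / (80 / δ ^ 3) := by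
      gcongr
      linarith
    refine hinv.trans (le_of_eq ?_)
    field_simp
  · exact FBI.symbolExpansion_gaussAvg hp hM (by linarith) (by linarith)
      (FBI.bddDeriv_cutPt hG hc (.of_hasCompactSupport hχs hχc)) hcut
  · have hχ0 : χ 0 = 0 := hχ' 0 (by rw [norm_zero]; positivity)
    simp only [Function.comp_apply, mul_zero, FBI.gaussMoment_zero, FBI.cutPt_self G hχ0]
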